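/- Let $n\ge 1$, $\varepsilon>0$, $T>0$, $\mathbb{T}^n=\mathbb{R}^n/\mathbb{Z}^n$, $Q_T=\mathbb{T}^n\times(0,T)$, $p\in(1,\infty)$, and let $q\in[1,\infty]$, $r\in[1,\infty]$ satisfy $q>\frac n2$ and $\frac{n}{2q}+\frac1r\le 1$. Let $K\ge 0$. There is a constant $C$, depending only on $n,\varepsilon,T,p,q,r,K$, such that the following holds. (1) Let $H(x,t,\xi)$ be measurable in $(x,t)\in Q_T$ and of class $C^1$ in $\xi\in\mathbb{R}^n$. For $i=1,2$ let $g_i\in L^p(\mathbb{T}^n)$, $f_i\in L^1(0,T;L^p(\mathbb{T}^n))$, and let $u_i$ be an energy solution of $$-\partial_t u_i-\varepsilon\Delta u_i+H(x,t,Du_i)=f_i\ \text{ in } Q_T,\qquad u_i(\cdot,T)=g_i\ \text{ on }\mathbb{T}^n,$$ that is, $u_i\in L^2(0,T;H^1(\mathbb{T}^n))$, $\partial_t u_i\in L^2(0,T;H^{-1}(\mathbb{T}^n))$ (with $u_i$ the representative in $C([0,T];L^2(\mathbb{T}^n))$), $H(x,t,Du_i)\in L^1(Q_T)$, and the equation holds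 in the sense of distributions. For $\theta\in[0,1]$ put $V_\theta(x,t)=D_\xi H\big(x,t,\theta Du_1(x,t)+(1-\theta)Du_2(x,t)\big)$, and assume that $(\theta,x,t)\mapsto V_\theta(x,t)$ is in $L^2((0,1)\times Q_T)$ and that $[\mathrm{div}\,V_\theta]^+\in L^r(0,T;L^q(\mathbb{T}^n))$ with norm at most $K$ for a.e. $\theta$; that is, there is a measurable $G=G_\theta(x,t)\ge 0$ such that for a.e. $\theta$ one has $\|G_\theta\|_{L^r(0,T;L^q)}\le K$ and $\mathrm{div}\,V_\theta\le G_\theta$ in the sense of distributions on $Q_T$. Then for all $t\in(0,T)$ $$\|(u_1-u_2)(t)\|_{L^p(\mathbb{T}^n)}\le C\Big(\|g_1-g_2\|_{L^p(\mathbb{T}^n)}+\int_0^T\|f_1(s)-f_2(s)\|_{L^p(\mathbb{T}^n)}\,ds\Big).$$ (2) Let $H(\xi)=\frac{|\xi|^2}{2}$, let $g_i,f_i,u_i$ be as in (1), and suppose that $\Delta u_1\le k$ and $\Delta u_2\le k$ in the sense of distributions on $Q_T$ for some $k$ with $\|k\|_{L^r(0,T;L^q(\mathbb{T}^n))}\le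 K$. Then the same estimate holds; in particular, if $f_1=f_2$ a.e. and $g_1=g_2$ a.e., then $u_1(t)=u_2(t)$ a.e. on $\mathbb{T}^n$ for every $t\in[0,T]$. -/

import Mathlib

open MeasureTheory Set Filter Topology
open scoped ENNReal NNReal ContDiff

/-- The flat torus `ℝⁿ / ℤⁿ`; its `volume` is the Haar probability measure. -/
abbrev Torus (n : ℕ) : Type := UnitAddTorus (Fin n)

/-- The space of gradients `ℝⁿ`, with the Euclidean norm. -/
abbrev Vec (n : ℕ) : Type := EuclideanSpace ℝ (Fin n)

/-- The measure `dt dx` on the cylinder `(0, T) × 𝕋ⁿ`. -/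
noncomputable def cylMeasure (n : ℕ) (T : ℝ) : Measure (ℝ × Torus n) :=
  (volume.restrict (Ioo 0 T)).prod volume

/-- The classical spatial gradient of a function on the torus: its `i`-th component at `x` is
the derivative at `s = 0` of `s ↦ ψ (x + s eᵢ)`. -/
noncomputable def torusGrad {n : ℕ} (ψ : Torus n → ℝ) (x : Torus n) : Vec n :=
  WithLp.toLp 2 fun i => deriv (fun s : ℝ => ψ (x + Pi.single i (s : UnitAddCircle))) 0

/-- `ψ ∈ C^∞(𝕋ⁿ)`: the `ℤⁿ`-periodic lift of `ψ` to `ℝⁿ` is smooth. -/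
def IsSmoothOnTorus {n : ℕ} (ψ : Torus n → ℝ) : Prop :=
  ContDiff ℝ ∞ fun x : Fin n → ℝ => ψ fun i => (x i : UnitAddCircle)

/-- `φ ∈ C_c^∞((0, T) × 𝕋ⁿ)`, written as a function of `t` and then `x`. -/
structure IsTestFunction {n : ℕ} (T : ℝ) (φ : ℝ → Torus n → ℝ) : Prop where
  smooth : ContDiff ℝ ∞ fun z : ℝ × (Fin n → ℝ) => φ z.1 fun i => (z.2 i : UnitAddCircle)
  support : ∃ a b : ℝ, 0 < a ∧ b < T ∧ ∀ t, t ∉ Icc a b → ∀ x, φ t x = 0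

/-- `v` is the weak gradient of `w` on the torus. -/
def IsWeakGradient {n : ℕ} (w : Torus n → ℝ) (v : Torus n → Vec n) : Prop :=
  ∀ ψ : Torus n → ℝ, IsSmoothOnTorus ψ → ∀ i : Fin n,
    ∫ x, w x * torusGrad ψ x i = -∫ x, v x i * ψ x

/-- The norm of `L^r(0, T; L^q(𝕋ⁿ))`, with values in `[0, ∞]`. -/
noncomputable def mixedNorm {n : ℕ} (T : ℝ) (r q : ℝ≥0∞) (G : ℝ → Torus n → ℝ) : ℝ≥0∞ :=
  eLpNorm (fun t => eLpNorm (G t) q volume) r (volume.restrict (Ioo 0 T))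

/-- `G ∈ L^r(0, T; L^q(𝕋ⁿ))`. -/
def MemMixed {n : ℕ} (T : ℝ) (r q : ℝ≥0∞) (G : ℝ → Torus n → ℝ) : Prop :=
  AEStronglyMeasurable (fun z : ℝ × Torus n => G z.1 z.2) (cylMeasure n T) ∧
    mixedNorm T r q G < ⊤

/-- `u` belongs to the parabolic class
`{u ∈ L²(0, T; H¹(𝕋ⁿ)), ∂ₜu ∈ L²(0, T; H⁻¹(𝕋ⁿ))}`, with weak spatial gradient `Du`, and `u` is
the representative of its class that is continuous from `[0, T]` to `L²(𝕋ⁿ)`. -/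
structure IsParabolic {n : ℕ} (T : ℝ) (u : ℝ → Torus n → ℝ) (Du : ℝ → Torus n → Vec n) :
    Prop where
  memLp : MemLp (fun z : ℝ × Torus n => u z.1 z.2) 2 (cylMeasure n T)
  memLp_grad : MemLp (fun z : ℝ × Torus n => Du z.1 z.2) 2 (cylMeasure n T)
  weakGrad : ∀ᵐ t ∂(volume.restrict (Ioo 0 T)), IsWeakGradient (u t) (Du t)
  /-- The distribution `∂ₜu` is bounded for the norm of `L²(0, T; H¹)`, that is, it extends to
  an element of the dual space `L²(0, T; H⁻¹)`. -/
  timeDeriv : ∃ M : ℝ, ∀ φ : ℝ → Torus n → ℝ, IsTestFunction T φ →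
    |∫ z, u z.1 z.2 * deriv (fun s => φ s z.2) z.1 ∂(cylMeasure n T)| ≤
      M * √(∫ z, (φ z.1 z.2 ^ 2 + ‖torusGrad (φ z.1) z.2‖ ^ 2) ∂(cylMeasure n T))
  memLp_slice : ∀ t ∈ Icc 0 T, MemLp (u t) 2 volume
  continuous : ∀ t ∈ Icc 0 T,
    Tendsto (fun s => eLpNorm (u s - u t) 2 volume) (𝓝[Icc 0 T] t) (𝓝 0)

/-- `H(x, t, p)` is measurable in `(x, t)` and of class `C¹` in `p`. -/
structure IsHamiltonian {n : ℕ} (T : ℝ) (H : Torus n → ℝ → Vec n → ℝ) : Prop where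
  measurable : ∀ p : Vec n,
    AEStronglyMeasurable (fun z : ℝ × Torus n => H z.2 z.1 p) (cylMeasure n T)
  contDiff : ∀ᵐ z ∂(cylMeasure n T), ContDiff ℝ 1 (H z.2 z.1)

/-- `u`, with weak spatial gradient `Du`, is a weak energy solution of
`-∂ₜu - ε Δu + H(x, t, Du) = f` in `𝕋ⁿ × (0, T)`, `u(·, T) = g`. -/
structure IsEnergySolution {n : ℕ} (ε T : ℝ) (H : Torus n → ℝ → Vec n → ℝ)
    (f : ℝ → Torus n → ℝ) (g : Torus n → ℝ)
    (u : ℝ → Torus n → ℝ) (Du : ℝ → Torus n → Vec n) : Prop where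
  parabolic : IsParabolic T u Du
  integrable : Integrable (fun z : ℝ × Torus n => H z.2 z.1 (Du z.1 z.2)) (cylMeasure n T)
  equation : ∀ φ : ℝ → Torus n → ℝ, IsTestFunction T φ →
    (∫ z, u z.1 z.2 * deriv (fun s => φ s z.2) z.1 ∂(cylMeasure n T))
        + ε * (∫ z, inner ℝ (Du z.1 z.2) (torusGrad (φ z.1) z.2) ∂(cylMeasure n T))
        + (∫ z, H z.2 z.1 (Du z.1 z.2) * φ z.1 z.2 ∂(cylMeasure n T))
      = ∫ z, f z.1 z.2 * φ z.1 z.2 ∂(cylMeasure n T)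
  terminal : u T =ᵐ[volume] g

/-- `div V ≤ G` in the sense of distributions on `(0, T) × 𝕋ⁿ` (divergence in space). -/
def DivLE {n : ℕ} (T : ℝ) (V : ℝ → Torus n → Vec n) (G : ℝ → Torus n → ℝ) : Prop :=
  ∀ φ : ℝ → Torus n → ℝ, IsTestFunction T φ → (∀ t x, 0 ≤ φ t x) →
    -(∫ z, inner ℝ (V z.1 z.2) (torusGrad (φ z.1) z.2) ∂(cylMeasure n T)) ≤
      ∫ z, G z.1 z.2 * φ z.1 z.2 ∂(cylMeasure n T)

/-- The field `D_pH(x, t, θ Du₁ + (1 - θ) Du₂)`. -/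
noncomputable def segmentField {n : ℕ} (H : Torus n → ℝ → Vec n → ℝ)
    (Du₁ Du₂ : ℝ → Torus n → Vec n) (θ t : ℝ) (x : Torus n) : Vec n :=
  gradient (H x t) (θ • Du₁ t x + (1 - θ) • Du₂ t x)

/-- For a family of fields `V_θ`, `θ ∈ [0, 1]`: `[div V_θ]⁺` lies in `L^r(0, T; L^q(𝕋ⁿ))` with
norm at most `K`, for almost every `θ`. The positive part of a distribution is a function in this
space, with norm at most `K`, exactly if the distribution is bounded above by a nonnegative
function `G θ` of this kind; if `div V_θ` is a function, then `G θ = max (div V_θ) 0` is the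
smallest choice. -/
def DivPosPartBound {n : ℕ} (T : ℝ) (r q : ℝ≥0∞) (K : ℝ≥0) (V : ℝ → ℝ → Torus n → Vec n) :
    Prop :=
  ∃ G : ℝ → ℝ → Torus n → ℝ,
    AEStronglyMeasurable (fun z : ℝ × ℝ × Torus n => G z.1 z.2.1 z.2.2)
      ((volume.restrict (Icc (0 : ℝ) 1)).prod (cylMeasure n T)) ∧
    (∀ θ t x, 0 ≤ G θ t x) ∧
    ∀ᵐ θ ∂(volume.restrict (Icc (0 : ℝ) 1)),
      MemMixed T r q (G θ) ∧ mixedNorm T r q (G θ) ≤ K ∧ DivLE T (V θ) (G θ)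

/-! ### The torus and its smooth functions -/

/-! The difference `w = u₁ - u₂` solves the linear equation `-∂ₜw - εΔw + V·Dw = f`, with `f = f₁ -
f₂` and `V` the average over `θ` of the fields `V_θ` (`sub_eq_inner_integral_gradient`). For an even
convex `Φ` resembling `|s|^p`, testing with `Φ'(w)` gives `∫Φ(w(s)) + ε∬Φ''(w)|Dw|² ≤ ∫Φ(w(T)) +
∬Φ(w)G + ∬|Φ'(w)||f|`. Indeed `Φ'(w) V·Dw = V·D(Φ(w))` integrates to at least `-∫Φ(w)G`, where `div
V ≤ G`, so that a one-sided bound on the divergence suffices.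

The term with `G` is absorbed by the diffusion. A weight in `L^q` with `α = n/(2q) < 1` satisfies
`∫Gv² ≤ δ∫|Dv|² + C(1 + ‖G‖_q^{1/(1-α)})∫v²` for every `δ > 0` (`exists_weight_interpolation`). The
proof splits `v` into dyadic blocks of its Fourier series: on a block of frequencies of size `2^L`
the supremum costs `4^{αL}` after interpolation with `L^q`, while the gradient gains `4^{-L}`. With
`v = √Φ(w)` and `Φ'² ≤ AΦΦ''` the gradient term is at most `δ(A/4)∫Φ''(w)|Dw|²`, hence below the
diffusion for small `δ`. The remainder is integrable in time because `n/(2q) + 1/r ≤ 1` means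
`1/(1-α) ≤ r` (`exponent_facts`). Hölder's inequality and `|Φ'| ≤ AΦ^{1-1/p}` bound the source by
`A‖f‖_p m^{1-1/p}` with `m = ∫Φ(w)`, and a Gronwall argument for `m^{1/p}` concludes
(`gronwall_rpow`, `integral_profile_rpow_le`).

The rigorous version has to respect that `V` is only square integrable, so that `V·Dw` is merely
integrable and only bounded functions of `w` may be tested. Mollifying in space turns the equation
into an ordinary differential equation in `t` at each point `x`; its chain rule passes to the limit
when `Φ'` and `Φ''` are bounded (`energy_identity`). If `Φ` is bounded as well, `Φ(w)` is admissible
in `div V ≤ G` (`drift_nonneg`, `energy_inequality_bounded`). Composition with an arctangent extends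
the inequality to quadratic growth (`energy_inequality`). Profiles of quadratic growth approximate
`|s|^p` with a constant `A` that depends on `p` alone (`isEnergyProfile_powProfile`), and Fatou's
lemma yields the `L^p` bound (`IsHeatSolution.eLpNorm_le`).

For `H = |ξ|²/2` the fields are convex combinations of `Du₁` and `Du₂`, so the two bounds `Δuᵢ ≤ k`
give the divergence condition with `k⁺`. -/

instance unitAddCircle_isProbabilityMeasure :
    IsProbabilityMeasure (volume : Measure UnitAddCircle) :=
  ⟨by simp⟩

instance torus_isNegInvariant (n : ℕ) : (volume : Measure (Torus n)).IsNegInvariant :=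
  Measure.IsAddHaarMeasure.isNegInvariant_of_regular volume

instance cylMeasure_isFinite (n : ℕ) (T : ℝ) : IsFiniteMeasure (cylMeasure n T) := by
  unfold cylMeasure; infer_instance

/-- The quotient map `ℝⁿ → 𝕋ⁿ`. -/
def torusMk {n : ℕ} (X : Fin n → ℝ) : Torus n := fun i => (X i : UnitAddCircle)

theorem torusMk_surjective {n : ℕ} : Function.Surjective (torusMk (n := n)) := fun x => by
  choose X hX using fun i => QuotientAddGroup.mk_surjective (x i)
  exact ⟨X, funext hX⟩

theorem isQuotientMap_torusMk {n : ℕ} : IsQuotientMap (torusMk (n := n)) := by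
  have h : IsOpenMap (torusMk (n := n)) := by
    refine IsOpenMap.piMap (fun i => QuotientAddGroup.isOpenMap_coe) ?_
    exact Eventually.of_forall fun i => QuotientAddGroup.mk_surjective
  refine h.isQuotientMap ?_ torusMk_surjective
  exact continuous_pi fun i => (AddCircle.continuous_mk' 1).comp (continuous_apply i)

theorem torusMk_add_single {n : ℕ} (X : Fin n → ℝ) (i : Fin n) (s : ℝ) :
    torusMk X + Pi.single i (s : UnitAddCircle) = torusMk (X + s • Pi.single i 1) := by
  ext j
  by_cases h : j = i
  · subst h; simp [torusMk]
  · simp [torusMk, h]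

theorem torusMk_sub {n : ℕ} (X Y : Fin n → ℝ) : torusMk X - torusMk Y = torusMk (X - Y) := by
  ext j; simp [torusMk]

theorem isSmoothOnTorus_iff {n : ℕ} {ψ : Torus n → ℝ} :
    IsSmoothOnTorus ψ ↔ ContDiff ℝ ∞ fun X : Fin n → ℝ => ψ (torusMk X) := Iff.rfl

/-- `F'` is the continuous partial derivative of `F` in the `i`-th direction. -/
structure HasPartial {n : ℕ} (i : Fin n) (F F' : Torus n → ℝ) : Prop where
  continuous : Continuous F'
  hasDerivAt_zero : ∀ x, HasDerivAt (fun s : ℝ => F (x + Pi.single i (s : UnitAddCircle))) (F' x) 0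

theorem Continuous.exists_torus_bound {n : ℕ} {F : Torus n → ℝ} (hF : Continuous F) :
    ∃ B, ∀ x, |F x| ≤ B := by
  obtain ⟨B, hB⟩ := isCompact_univ.exists_bound_of_continuousOn hF.continuousOn
  exact ⟨B, fun x => hB x (mem_univ x)⟩

theorem Continuous.integrable_torus {n : ℕ} {F : Torus n → ℝ} (hF : Continuous F) :
    Integrable F volume := by
  obtain ⟨B, hB⟩ := hF.exists_torus_bound
  exact Integrable.of_bound hF.aestronglyMeasurable B (Eventually.of_forall hB)

namespace HasPartial

variable {n : ℕ} {i : Fin n} {F F' G G' : Torus n → ℝ}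

theorem hasDerivAt (h : HasPartial i F F') (x : Torus n) (s : ℝ) :
    HasDerivAt (fun s : ℝ => F (x + Pi.single i (s : UnitAddCircle)))
      (F' (x + Pi.single i (s : UnitAddCircle))) s := by
  have h0 := h.hasDerivAt_zero (x + Pi.single i (s : UnitAddCircle))
  rw [← sub_self s] at h0
  have h1 := h0.comp_sub_const s s
  refine h1.congr_of_eventuallyEq (Eventually.of_forall fun r => ?_)
  simp only [add_assoc, ← Pi.single_add, ← AddCircle.coe_add]
  congr 4
  ring

theorem torusGrad_eq (h : HasPartial i F F') (x : Torus n) : torusGrad F x i = F' x :=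
  (h.hasDerivAt_zero x).deriv

theorem mul (hF : HasPartial i F F') (hG : HasPartial i G G') (hFc : Continuous F)
    (hGc : Continuous G) :
    HasPartial i (fun x => F x * G x) (fun x => F' x * G x + F x * G' x) where
  continuous := (hF.continuous.mul hGc).add (hFc.mul hG.continuous)
  hasDerivAt_zero x := by
    simpa using! (hF.hasDerivAt_zero x).mul (hG.hasDerivAt_zero x)

theorem comp {β β' : ℝ → ℝ} (hβ : ∀ s, HasDerivAt β (β' s) s) (hβ' : Continuous β')
    (hF : HasPartial i F F') (hFc : Continuous F) :
    HasPartial i (fun x => β (F x)) (fun x => β' (F x) * F' x) where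
  continuous := (hβ'.comp hFc).mul hF.continuous
  hasDerivAt_zero x := by
    refine HasDerivAt.comp (h₂ := β) (0 : ℝ) ?_ (hF.hasDerivAt_zero x)
    simpa using hβ (F x)

theorem const_sub (h : HasPartial i F F') (x : Torus n) :
    HasPartial i (fun y => F (x - y)) (fun y => -F' (x - y)) where
  continuous := (h.continuous.comp (continuous_const.sub continuous_id)).neg
  hasDerivAt_zero y := by
    have h0 : HasDerivAt (fun s : ℝ => F (x - y + Pi.single i (s : UnitAddCircle))) (F' (x - y))
      (-0) := by rw [neg_zero]; exact h.hasDerivAt_zero (x - y)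
    have := h0.scomp (0 : ℝ) (hasDerivAt_neg (0 : ℝ))
    rw [neg_one_smul] at this
    refine this.congr_of_eventuallyEq (Eventually.of_forall fun r => ?_)
    simp only [Function.comp, AddCircle.coe_neg, Pi.single_neg]
    congr 1
    abel

/-- The integral of a partial derivative over the torus vanishes. -/
theorem integral_eq_zero (h : HasPartial i F F') : ∫ x, F' x = 0 := by
  -- The curve `s ↦ x + s eᵢ` closes up at `s = 1`, so `F'` has integral zero along it. Averaging
  -- over `x` and using translation invariance leaves the integral of `F'`.
  have key : ∀ x : Torus n, ∫ s in (0 : ℝ)..1, F' (x + Pi.single i (s : UnitAddCircle)) = 0 := by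
    intro x
    rw [intervalIntegral.integral_eq_sub_of_hasDerivAt (fun s _ => h.hasDerivAt x s)]
    · have : ((1 : ℝ) : UnitAddCircle) = 0 := AddCircle.coe_period 1
      simp [this]
    · refine (h.continuous.comp ?_).intervalIntegrable _ _
      exact continuous_const.add ((continuous_single i).comp (AddCircle.continuous_mk' 1))
  obtain ⟨B, hB⟩ := h.continuous.exists_torus_bound
  have hswap : ∫ x : Torus n, ∫ s in (0 : ℝ)..1, F' (x + Pi.single i (s : UnitAddCircle)) =
      ∫ s in (0 : ℝ)..1, ∫ x : Torus n, F' (x + Pi.single i (s : UnitAddCircle)) := by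
    simp only [intervalIntegral.integral_of_le zero_le_one]
    refine integral_integral_swap ?_
    refine Integrable.of_bound ?_ B (Eventually.of_forall fun z => hB _)
    refine (h.continuous.comp ?_).aestronglyMeasurable
    exact continuous_fst.add
      ((continuous_single i).comp ((AddCircle.continuous_mk' 1).comp continuous_snd))
  simp only [key, integral_zero, integral_add_right_eq_self F'] at hswap
  simpa using hswap.symm

/-- Integration by parts on the torus. -/
theorem integral_mul_eq_neg (hF : HasPartial i F F') (hG : HasPartial i G G') (hFc : Continuous F)
    (hGc : Continuous G) : ∫ x, F x * G' x = -∫ x, F' x * G x := by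
  have h := (hF.mul hG hFc hGc).integral_eq_zero
  have h2 := integral_add (hF.continuous.mul hGc).integrable_torus
    (hFc.mul hG.continuous).integrable_torus
  simp only [Pi.mul_apply] at h2
  linarith

end HasPartial

namespace IsSmoothOnTorus

variable {n : ℕ} {ψ : Torus n → ℝ}

theorem continuous (h : IsSmoothOnTorus ψ) : Continuous ψ := by
  rw [isQuotientMap_torusMk.continuous_iff]
  exact (isSmoothOnTorus_iff.1 h).continuous

theorem hasPartial (h : IsSmoothOnTorus ψ) (i : Fin n) :
    HasPartial i ψ (fun x => torusGrad ψ x i) := by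
  have hs := isSmoothOnTorus_iff.1 h
  have hd : ∀ X : Fin n → ℝ,
      HasDerivAt (fun s : ℝ => ψ (torusMk X + Pi.single i (s : UnitAddCircle)))
        (fderiv ℝ (fun X : Fin n → ℝ => ψ (torusMk X)) X (Pi.single i 1)) 0 := by
    intro X
    simp only [torusMk_add_single]
    have h1 : HasFDerivAt (fun X : Fin n → ℝ => ψ (torusMk X))
        (fderiv ℝ (fun X : Fin n → ℝ => ψ (torusMk X)) X)
        (X + (0 : ℝ) • (Pi.single i (1 : ℝ) : Fin n → ℝ)) := by
      simpa using (hs.differentiable (by simp) X).hasFDerivAt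
    have h2 : HasDerivAt (fun s : ℝ => X + s • (Pi.single i (1 : ℝ) : Fin n → ℝ))
        (Pi.single i 1) 0 := by
      simpa using ((hasDerivAt_id (0 : ℝ)).smul_const (Pi.single i (1 : ℝ) : Fin n → ℝ)).const_add X
    exact h1.comp_hasDerivAt (0 : ℝ) h2
  have he : ∀ X : Fin n → ℝ, torusGrad ψ (torusMk X) i =
      fderiv ℝ (fun X : Fin n → ℝ => ψ (torusMk X)) X (Pi.single i 1) := fun X => (hd X).deriv
  refine ⟨?_, fun x => ?_⟩
  · rw [isQuotientMap_torusMk.continuous_iff]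
    have : Continuous fun X => fderiv ℝ (fun X : Fin n → ℝ => ψ (torusMk X)) X (Pi.single i 1) :=
      (hs.continuous_fderiv (by simp)).clm_apply continuous_const
    exact this.congr fun X => (he X).symm
  · obtain ⟨X, rfl⟩ := torusMk_surjective x
    rw [he]
    exact hd X

theorem const_sub (h : IsSmoothOnTorus ψ) (x : Torus n) : IsSmoothOnTorus fun y => ψ (x - y) := by
  obtain ⟨X, rfl⟩ := torusMk_surjective x
  rw [isSmoothOnTorus_iff]
  simp only [torusMk_sub]
  exact (isSmoothOnTorus_iff.1 h).comp (contDiff_const.sub contDiff_id)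

end IsSmoothOnTorus

/-! ### Convolution -/

/-- Convolution on the torus. -/
noncomputable def torusConv {n : ℕ} (K F : Torus n → ℝ) (x : Torus n) : ℝ := ∫ y, K (x - y) * F y

section Conv

variable {n : ℕ} {i : Fin n} {K K' F F' : Torus n → ℝ}

theorem torusConv_eq (K F : Torus n → ℝ) (x : Torus n) :
    torusConv K F x = ∫ y, K y * F (x - y) := by
  rw [torusConv, ← integral_sub_left_eq_self (fun y => K (x - y) * F y) volume x]
  simp

theorem integrable_kernel_mul (hK : Continuous K) (hF : Integrable F volume) (x : Torus n) :
    Integrable (fun y => K (x - y) * F y) volume := by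
  obtain ⟨B, hB⟩ := hK.exists_torus_bound
  exact hF.bdd_mul (c := B) (hK.comp (continuous_const.sub continuous_id)).aestronglyMeasurable
    (Eventually.of_forall fun y => hB _)

theorem torusConv_bound {B : ℝ} (hB : ∀ x, |K x| ≤ B) (hF : Integrable F volume) (x : Torus n) :
    |torusConv K F x| ≤ B * ∫ y, |F y| := by
  rw [← integral_const_mul]
  change ‖∫ y, K (x - y) * F y‖ ≤ _
  refine (norm_integral_le_integral_norm _).trans ?_
  refine integral_mono_of_nonneg (Eventually.of_forall fun y => norm_nonneg _)
    (hF.abs.const_mul B) (Eventually.of_forall fun y => ?_)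
  simp only [norm_mul, Real.norm_eq_abs]
  gcongr
  exact hB _

theorem continuous_torusConv (hK : Continuous K) (hF : Integrable F volume) :
    Continuous (torusConv K F) := by
  obtain ⟨B, hB⟩ := hK.exists_torus_bound
  change Continuous fun x => ∫ y, K (x - y) * F y
  refine continuous_of_dominated (bound := fun y => B * |F y|) (fun x => ?_) (fun x => ?_)
    (hF.abs.const_mul B) (Eventually.of_forall fun y => ?_)
  · exact (integrable_kernel_mul hK hF x).aestronglyMeasurable
  · refine Eventually.of_forall fun y => ?_
    rw [norm_mul]
    exact mul_le_mul_of_nonneg_right (hB _) (norm_nonneg _)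
  · exact (hK.comp (continuous_id.sub continuous_const)).mul continuous_const

theorem HasPartial.torusConv (hK : HasPartial i K K') (hKc : Continuous K)
    (hF : Integrable F volume) : HasPartial i (torusConv K F) (torusConv K' F) where
  continuous := continuous_torusConv hK.continuous hF
  hasDerivAt_zero x := by
    obtain ⟨B, hB⟩ := hK.continuous.exists_torus_bound
    have := hasDerivAt_integral_of_dominated_loc_of_deriv_le (μ := (volume : Measure (Torus n)))
      (F := fun (s : ℝ) y => K (x + Pi.single i (s : UnitAddCircle) - y) * F y)
      (F' := fun (s : ℝ) y => K' (x + Pi.single i (s : UnitAddCircle) - y) * F y)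
      (x₀ := 0) (s := univ) (bound := fun y => B * |F y|) univ_mem
      (Eventually.of_forall fun s => (integrable_kernel_mul hKc hF _).aestronglyMeasurable)
      (integrable_kernel_mul hKc hF _)
      (integrable_kernel_mul hK.continuous hF _).aestronglyMeasurable
      (Eventually.of_forall fun y s _ => by
        rw [norm_mul]
        exact mul_le_mul_of_nonneg_right (hB _) (norm_nonneg _))
      (hF.abs.const_mul B)
      (Eventually.of_forall fun y s _ => by
        have := (hK.hasDerivAt (x - y) s).mul_const (F y)
        simpa only [add_sub_right_comm] using this)
    simpa [_root_.torusConv] using this.2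

/-- Convolving the weak gradient. -/
theorem IsWeakGradient.torusConv_partial {w : Torus n → ℝ} {v : Torus n → Vec n}
    (h : IsWeakGradient w v) (hK : IsSmoothOnTorus K) (i : Fin n) :
    torusConv (fun x => torusGrad K x i) w = torusConv K (fun x => v x i) := by
  funext x
  -- The test function `y ↦ K (x - y)` has gradient `-(∂ᵢK)(x - y)`, which cancels the sign in the
  -- definition of the weak gradient.
  have h1 := h _ (hK.const_sub x) i
  simp only [((hK.hasPartial i).const_sub x).torusGrad_eq] at h1
  simp only [torusConv]
  rw [← neg_inj]
  calc _ = ∫ y, w y * -torusGrad K (x - y) i := by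
        rw [← integral_neg]; exact integral_congr_ae (Eventually.of_forall fun y => by simp; ring)
    _ = _ := by rw [h1]; simp only [mul_comm]

end Conv

/-! ### An approximate identity on the torus -/

/-- The trigonometric polynomial `∏ (1 + cos 2πxᵢ) / 2`. -/
noncomputable def torusBump {n : ℕ} (x : Torus n) : ℝ := ∏ i, (1 + (fourier 1 (x i) : ℂ).re) / 2

theorem fourier_one_re_mem (a : UnitAddCircle) : (1 + (fourier 1 a : ℂ).re) / 2 ∈ Icc (0 : ℝ) 1 := by
  have h := Complex.abs_re_le_norm (fourier 1 a : ℂ)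
  have h1 : ‖(fourier 1 a : ℂ)‖ = 1 := by rw [fourier_apply]; exact Circle.norm_coe _
  rw [h1, abs_le] at h
  constructor <;> linarith [h.1, h.2]

theorem fourier_one_re_lt {a : UnitAddCircle} (ha : a ≠ 0) : (1 + (fourier 1 a : ℂ).re) / 2 < 1 := by
  have h1 : ‖(fourier 1 a : ℂ)‖ = 1 := by rw [fourier_apply]; exact Circle.norm_coe _
  have h := (Complex.abs_re_le_norm (fourier 1 a : ℂ))
  rw [h1, abs_le] at h
  by_contra hcon
  have hre : (fourier 1 a : ℂ).re = 1 := by linarith [h.2]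
  have hsq := Complex.sq_norm (fourier 1 a : ℂ)
  rw [h1, Complex.normSq_apply, hre] at hsq
  have him : (fourier 1 a : ℂ).im = 0 := by nlinarith
  have : (fourier 1 a : ℂ) = 1 := Complex.ext (by simpa using hre) (by simpa using him)
  rw [fourier_one] at this
  refine ha (AddCircle.injective_toCircle (T := 1) one_ne_zero ?_)
  ext
  simpa using this

theorem torusBump_nonneg {n : ℕ} (x : Torus n) : 0 ≤ torusBump x :=
  Finset.prod_nonneg fun i _ => (fourier_one_re_mem (x i)).1

@[simp] theorem torusBump_zero {n : ℕ} : torusBump (0 : Torus n) = 1 := by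
  simp [torusBump]

/-- A unique strict maximum is what makes the normalised powers concentrate at `0`. -/
theorem torusBump_lt {n : ℕ} {x : Torus n} (hx : x ≠ 0) : torusBump x < torusBump (0 : Torus n) := by
  obtain ⟨i, hi⟩ := Function.ne_iff.1 hx
  rw [torusBump_zero, torusBump, ← Finset.mul_prod_erase _ _ (Finset.mem_univ i)]
  calc _ ≤ (1 + (fourier 1 (x i) : ℂ).re) / 2 * 1 := by
        refine mul_le_mul_of_nonneg_left ?_ (fourier_one_re_mem (x i)).1
        exact Finset.prod_le_one (fun j _ => (fourier_one_re_mem (x j)).1)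
          fun j _ => (fourier_one_re_mem (x j)).2
    _ < 1 := by rw [mul_one]; exact fourier_one_re_lt hi

theorem isSmoothOnTorus_torusBump {n : ℕ} : IsSmoothOnTorus (torusBump (n := n)) := by
  have : (fun X : Fin n → ℝ => torusBump fun i => (X i : UnitAddCircle)) =
      fun X => ∏ i, (1 + Real.cos (2 * Real.pi * X i)) / 2 := by
    funext X
    refine Finset.prod_congr rfl fun i _ => ?_
    rw [fourier_coe_apply]
    have : (2 * Real.pi * Complex.I * (1 : ℤ) * (X i : ℝ) / ((1 : ℝ) : ℂ) : ℂ) =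
        ((2 * Real.pi * X i : ℝ) : ℂ) * Complex.I := by push_cast; ring
    rw [this, Complex.exp_ofReal_mul_I_re]
  rw [IsSmoothOnTorus, this]
  refine contDiff_prod fun i _ => ?_
  refine (contDiff_const.add (Real.contDiff_cos.comp ?_)).div_const _
  exact contDiff_const.mul (contDiff_apply ℝ ℝ i)

theorem torusBump_neg {n : ℕ} (x : Torus n) : torusBump (-x) = torusBump x := by
  simp only [torusBump]
  refine Finset.prod_congr rfl fun i _ => ?_
  have : (fourier 1 ((-x) i) : ℂ) = (starRingEnd ℂ) (fourier 1 (x i) : ℂ) := by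
    rw [← fourier_neg]
    simp [fourier_apply]
  rw [this, Complex.conj_re]

theorem integral_torusBump_pow_pos {n : ℕ} (N : ℕ) : 0 < ∫ x : Torus n, torusBump x ^ N :=
  (isSmoothOnTorus_torusBump.continuous.pow N).integral_pos_of_hasCompactSupport_nonneg_nonzero
    (HasCompactSupport.of_compactSpace _) (fun x => pow_nonneg (torusBump_nonneg x) N)
    (x := 0) (by simp)

/-- A sequence of smooth even probability densities on the torus concentrating at `0`. -/
noncomputable def torusKernel (n N : ℕ) (x : Torus n) : ℝ :=
  (∫ y : Torus n, torusBump y ^ N)⁻¹ * torusBump x ^ N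

section Kernel

variable {n : ℕ} (N : ℕ)

theorem isSmoothOnTorus_torusKernel : IsSmoothOnTorus (torusKernel n N) :=
  contDiff_const.mul (ContDiff.pow isSmoothOnTorus_torusBump N)

theorem torusKernel_nonneg (x : Torus n) : 0 ≤ torusKernel n N x :=
  mul_nonneg (inv_nonneg.2 (integral_torusBump_pow_pos N).le) (pow_nonneg (torusBump_nonneg x) N)

/-- Evenness lets the kernel change sides under an integral: in `drift_nonneg` the mollification is
moved from the field to the test function. -/
theorem torusKernel_neg (x : Torus n) : torusKernel n N (-x) = torusKernel n N x := by
  simp only [torusKernel, torusBump_neg]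

theorem torusKernel_sub_comm (x y : Torus n) : torusKernel n N (x - y) = torusKernel n N (y - x) := by
  rw [← torusKernel_neg, neg_sub]

theorem continuous_torusKernel : Continuous (torusKernel n N) :=
  (isSmoothOnTorus_torusKernel N).continuous

theorem integral_torusKernel : ∫ x, torusKernel n N x = 1 := by
  simp only [torusKernel, integral_const_mul]
  exact inv_mul_cancel₀ (integral_torusBump_pow_pos N).ne'

/-- Laplace's method: normalised powers of a nonnegative continuous function with a unique maximum
form a peak sequence. -/
theorem tendsto_integral_torusKernel_mul {g : Torus n → ℝ} (hg : Continuous g) :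
    Tendsto (fun N => ∫ y, torusKernel n N y * g y) atTop (𝓝 (g 0)) := by
  have := tendsto_setIntegral_pow_smul_of_unique_maximum_of_isCompact_of_continuousOn
    (μ := (volume : Measure (Torus n))) (x₀ := 0) (g := g)
    isCompact_univ (c := torusBump) isSmoothOnTorus_torusBump.continuous.continuousOn
    (fun y _ hy => torusBump_lt hy) (fun y _ => torusBump_nonneg y) (by simp) (by simp)
    hg.continuousOn
  simp only [Measure.restrict_univ] at this
  refine this.congr fun N => ?_
  simp only [torusKernel, smul_eq_mul, mul_assoc, integral_const_mul]

theorem lintegral_torusKernel : ∫⁻ x, ENNReal.ofReal (torusKernel n N x) = 1 := by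
  rw [← ofReal_integral_eq_lintegral_ofReal (continuous_torusKernel N).integrable_torus
    (Eventually.of_forall (torusKernel_nonneg N)), integral_torusKernel, ENNReal.ofReal_one]

end Kernel

/-- Translations act continuously on `L^p` of the torus. -/
theorem continuous_eLpNorm_translate_sub {n : ℕ} {p : ℝ≥0∞} (hp : 1 ≤ p) (hp' : p ≠ ⊤)
    {F : Torus n → ℝ} (hF : MemLp F p volume) :
    Continuous fun y : Torus n => (eLpNorm (fun x => F (x - y) - F x) p volume).toReal := by
  have : Fact (1 ≤ p) := ⟨hp⟩
  have : Fact (p ≠ ⊤) := ⟨hp'⟩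
  have : ContinuousVAdd (Torus n)ᵈᵃᵃ (Lp ℝ p (volume : Measure (Torus n))) :=
    Lp.instContinuousVAddDomAddAct
  -- The action on `Lp` is precomposition with `x ↦ -y + x`, whose continuity for `p < ∞` is known.
  have h1 : Continuous fun y : Torus n => ‖(DomAddAct.mk (-y) +ᵥ hF.toLp F) - hF.toLp F‖ := by
    refine (Continuous.sub ?_ continuous_const).norm
    exact (DomAddAct.continuous_mk.comp continuous_neg).vadd continuous_const
  refine h1.congr fun y => ?_
  rw [Lp.norm_def]
  congr 1
  refine eLpNorm_congr_ae ?_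
  have h2 := DomAddAct.vadd_Lp_ae_eq (DomAddAct.mk (-y)) (hF.toLp F)
  have h3 : (fun x => (hF.toLp F : Torus n → ℝ) (-y + x)) =ᵐ[volume] fun x => F (-y + x) :=
    (measurePreserving_add_left volume (-y)).quasiMeasurePreserving.ae_eq_comp hF.coeFn_toLp
  filter_upwards [h2, h3, hF.coeFn_toLp, Lp.coeFn_sub (DomAddAct.mk (-y) +ᵥ hF.toLp F) (hF.toLp F)]
    with x a b c d
  rw [d, Pi.sub_apply, a, c]
  simp only [DomAddAct.mk] at *
  rw [sub_eq_neg_add x y, ← b]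
  rfl

section Approx

variable {n : ℕ} {F : Torus n → ℝ} {p : ℝ≥0∞}

theorem integrable_torusKernel_mul_translate (N : ℕ) (hF : Integrable F volume) (x : Torus n) :
    Integrable (fun y => torusKernel n N y * F (x - y)) volume := by
  obtain ⟨B, hB⟩ := (continuous_torusKernel (n := n) N).exists_torus_bound
  exact (hF.comp_sub_left x).bdd_mul (c := B) (continuous_torusKernel N).aestronglyMeasurable
    (Eventually.of_forall fun y => hB _)

/-- Jensen's inequality for the probability measure with density the kernel, in the form of
monotonicity of `L^p` norms in `p`. The constant `c` is free: `c = F x` gives convergence, `c = 0`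
the contraction property. -/
theorem enorm_torusConv_sub_rpow_le (hp : 1 ≤ p) (hp' : p ≠ ⊤) (N : ℕ) (hF : MemLp F p volume)
    (x : Torus n) (c : ℝ) :
    ‖torusConv (torusKernel n N) F x - c‖ₑ ^ p.toReal ≤
      ∫⁻ y, ENNReal.ofReal (torusKernel n N y) * ‖F (x - y) - c‖ₑ ^ p.toReal := by
  have hp0 : p ≠ 0 := (zero_lt_one.trans_le hp).ne'
  have hpr : 0 < p.toReal := ENNReal.toReal_pos hp0 hp'
  have hFi : Integrable F volume := hF.integrable hp
  set ν : Measure (Torus n) :=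
    volume.withDensity fun y => ENNReal.ofReal (torusKernel n N y) with hν
  have hk : Measurable fun y => ENNReal.ofReal (torusKernel n N y) :=
    (continuous_torusKernel N).measurable.ennreal_ofReal
  have : IsProbabilityMeasure ν := ⟨by
    rw [hν, withDensity_apply _ MeasurableSet.univ, Measure.restrict_univ, lintegral_torusKernel]⟩
  have hm : AEStronglyMeasurable (fun y => F (x - y) - c) volume :=
    ((hFi.comp_sub_left x).aestronglyMeasurable).sub aestronglyMeasurable_const
  have hmν : AEStronglyMeasurable (fun y => F (x - y) - c) ν :=
    hm.mono_ac (withDensity_absolutelyContinuous _ _)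
  have e1 : torusConv (torusKernel n N) F x - c =
      ∫ y, torusKernel n N y * (F (x - y) - c) := by
    simp only [mul_sub]
    rw [integral_sub (integrable_torusKernel_mul_translate N hFi x)
      ((continuous_torusKernel N).integrable_torus.mul_const _), integral_mul_const,
      integral_torusKernel, one_mul, torusConv_eq]
  have e2 : ‖torusConv (torusKernel n N) F x - c‖ₑ ≤ eLpNorm (fun y => F (x - y) - c) 1 ν := by
    rw [e1, eLpNorm_one_eq_lintegral_enorm, hν, lintegral_withDensity_eq_lintegral_mul₀
      hk.aemeasurable hm.enorm]
    refine (enorm_integral_le_lintegral_enorm _).trans_eq (lintegral_congr fun y => ?_)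
    rw [enorm_mul, Real.enorm_eq_ofReal (torusKernel_nonneg N y)]
    rfl
  have e3 := e2.trans (eLpNorm_le_eLpNorm_of_exponent_le hp hmν)
  calc _ ≤ (eLpNorm (fun y => F (x - y) - c) p ν) ^ p.toReal := by gcongr
    _ = ∫⁻ y, ‖F (x - y) - c‖ₑ ^ p.toReal ∂ν := by
        rw [eLpNorm_eq_lintegral_rpow_enorm_toReal hp0 hp', ← ENNReal.rpow_mul,
          one_div_mul_cancel hpr.ne', ENNReal.rpow_one]
    _ = _ := by
        rw [hν, lintegral_withDensity_eq_lintegral_mul₀ hk.aemeasurable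
          (hm.enorm.pow_const _)]
        rfl

/-- Convolution with the kernels approximates the identity in `L^p`. -/
theorem tendsto_eLpNorm_torusConv_sub (hp : 1 ≤ p) (hp' : p ≠ ⊤) (hF : MemLp F p volume) :
    Tendsto (fun N => eLpNorm (fun x => torusConv (torusKernel n N) F x - F x) p volume)
      atTop (𝓝 0) := by
  have hp0 : p ≠ 0 := (zero_lt_one.trans_le hp).ne'
  have hpr : 0 < p.toReal := ENNReal.toReal_pos hp0 hp'
  have hfin : ∀ y, eLpNorm (fun x => F (x - y) - F x) p volume ≠ ⊤ := fun y =>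
    ((hF.comp_measurePreserving (measurePreserving_sub_right volume y)).sub hF).2.ne
  -- The `p`-th power of the modulus of continuity under translation. It is continuous and vanishes
  -- at `0`, so its integrals against the kernels tend to `0`; by Jensen and Fubini they dominate
  -- the error.
  set φ : Torus n → ℝ := fun y =>
    (eLpNorm (fun x => F (x - y) - F x) p volume).toReal ^ p.toReal with hφ
  have hφc : Continuous φ :=
    (continuous_eLpNorm_translate_sub hp hp' hF).rpow_const fun _ => Or.inr hpr.le
  have hlim := tendsto_integral_torusKernel_mul hφc
  have hφ0 : φ 0 = 0 := by simp [hφ, hpr.ne']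
  rw [hφ0] at hlim
  have hbound : ∀ N, eLpNorm (fun x => torusConv (torusKernel n N) F x - F x) p volume ≤
      ENNReal.ofReal (∫ y, torusKernel n N y * φ y) ^ (1 / p.toReal) := by
    intro N
    rw [eLpNorm_eq_lintegral_rpow_enorm_toReal hp0 hp']
    gcongr
    refine (lintegral_mono fun x => enorm_torusConv_sub_rpow_le hp hp' N hF x (F x)).trans ?_
    rw [lintegral_lintegral_swap]
    · rw [ofReal_integral_eq_lintegral_ofReal
        (show Continuous fun y => torusKernel n N y * φ y from
          (continuous_torusKernel N).mul hφc).integrable_torus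
        (Eventually.of_forall fun y => mul_nonneg (torusKernel_nonneg N y) (by positivity))]
      refine (lintegral_congr fun y => ?_).le
      rw [lintegral_const_mul'' _ ?_, ENNReal.ofReal_mul (torusKernel_nonneg N y), hφ]
      · congr 1
        rw [← ENNReal.ofReal_rpow_of_nonneg ENNReal.toReal_nonneg hpr.le,
          ENNReal.ofReal_toReal (hfin y), eLpNorm_eq_lintegral_rpow_enorm_toReal hp0 hp',
          ← ENNReal.rpow_mul, one_div_mul_cancel hpr.ne', ENNReal.rpow_one]
      · exact (((hF.comp_measurePreserving (measurePreserving_sub_right volume y)).sub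
          hF).1.enorm.pow_const _)
    · refine AEMeasurable.mul ?_ (AEMeasurable.pow_const ?_ _)
      · exact ((continuous_torusKernel N).measurable.comp measurable_snd).ennreal_ofReal.aemeasurable
      · refine AEStronglyMeasurable.enorm ?_
        exact (hF.1.comp_quasiMeasurePreserving
          (quasiMeasurePreserving_sub volume volume)).sub hF.1.comp_fst
  refine tendsto_of_tendsto_of_tendsto_of_le_of_le tendsto_const_nhds ?_ (fun _ => zero_le)
    hbound
  have := (ENNReal.tendsto_ofReal hlim).ennrpow_const (1 / p.toReal)
  rwa [ENNReal.ofReal_zero, ENNReal.zero_rpow_of_pos (by positivity)] at this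

/-- Convolution with the kernels is a contraction of `L^p`. -/
theorem eLpNorm_torusConv_le (hp : 1 ≤ p) (hp' : p ≠ ⊤) (N : ℕ) (hF : MemLp F p volume) :
    eLpNorm (torusConv (torusKernel n N) F) p volume ≤ eLpNorm F p volume := by
  have hp0 : p ≠ 0 := (zero_lt_one.trans_le hp).ne'
  rw [eLpNorm_eq_lintegral_rpow_enorm_toReal hp0 hp', eLpNorm_eq_lintegral_rpow_enorm_toReal hp0 hp']
  gcongr ?_ ^ _
  have h1 : ∀ x, ‖torusConv (torusKernel n N) F x‖ₑ ^ p.toReal ≤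
      ∫⁻ y, ENNReal.ofReal (torusKernel n N y) * ‖F (x - y)‖ₑ ^ p.toReal := fun x => by
    simpa using enorm_torusConv_sub_rpow_le hp hp' N hF x 0
  refine (lintegral_mono h1).trans ?_
  rw [lintegral_lintegral_swap]
  · have h2 : ∀ y, ∫⁻ x, ENNReal.ofReal (torusKernel n N y) * ‖F (x - y)‖ₑ ^ p.toReal =
        ENNReal.ofReal (torusKernel n N y) * ∫⁻ x, ‖F x‖ₑ ^ p.toReal := by
      intro y
      rw [lintegral_const_mul' _ _ ENNReal.ofReal_ne_top,
        lintegral_sub_right_eq_self (fun x => ‖F x‖ₑ ^ p.toReal) y]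
    simp only [h2]
    rw [lintegral_mul_const _ (continuous_torusKernel N).measurable.ennreal_ofReal,
      lintegral_torusKernel, one_mul]
  · refine AEMeasurable.mul ?_ (AEMeasurable.pow_const ?_ _)
    · exact ((continuous_torusKernel N).measurable.comp measurable_snd).ennreal_ofReal.aemeasurable
    · exact (hF.1.comp_quasiMeasurePreserving (quasiMeasurePreserving_sub volume volume)).enorm

end Approx

/-! ### Passing to the limit in products -/

theorem abs_sub_le_of_hasDerivAt_bound {β β' : ℝ → ℝ} (hβ : ∀ s, HasDerivAt β (β' s) s) {B : ℝ}
    (hB : ∀ s, |β' s| ≤ B) (a b : ℝ) : |β a - β b| ≤ B * |a - b| :=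
  Convex.norm_image_sub_le_of_norm_hasDerivWithin_le (f := β) (s := univ)
    (fun x _ => (hβ x).hasDerivWithinAt) (fun x _ => hB x) convex_univ (mem_univ b) (mem_univ a)

section Limits

variable {α : Type*} [MeasurableSpace α] {μ : Measure α}

/-- The nonlinear factor is bounded but converges only in measure. Along a further subsequence `c N
→ c₀` almost everywhere; then `β (c N) a₀` converges by domination and `β (c N) (a N - a₀)` is small
in `L¹`. Convergence along sub-subsequences is enough. -/
theorem tendsto_integral_comp_mul {a c : ℕ → α → ℝ} {a₀ c₀ : α → ℝ} {β : ℝ → ℝ} {B : ℝ}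
    (hβ : Continuous β) (hB : ∀ s, |β s| ≤ B) (ha : ∀ N, Integrable (a N) μ)
    (ha₀ : Integrable a₀ μ) (hc : ∀ N, AEStronglyMeasurable (c N) μ)
    (hc₀ : AEStronglyMeasurable c₀ μ)
    (hac : Tendsto (fun N => eLpNorm (fun x => a N x - a₀ x) 1 μ) atTop (𝓝 0))
    (hcc : Tendsto (fun N => eLpNorm (fun x => c N x - c₀ x) 1 μ) atTop (𝓝 0)) :
    Tendsto (fun N => ∫ x, β (c N x) * a N x ∂μ) atTop (𝓝 (∫ x, β (c₀ x) * a₀ x ∂μ)) := by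
  have hbm : ∀ {f : α → ℝ}, AEStronglyMeasurable f μ →
      AEStronglyMeasurable (fun x => β (f x)) μ := fun hf => hβ.comp_aestronglyMeasurable hf
  have hbi : ∀ {f g : α → ℝ}, AEStronglyMeasurable f μ → Integrable g μ →
      Integrable (fun x => β (f x) * g x) μ := fun hf hg =>
    hg.bdd_mul (c := B) (hbm hf) (Eventually.of_forall fun x => hB _)
  have hd : ∀ N, Integrable (fun x => a N x - a₀ x) μ := fun N => (ha N).sub ha₀
  refine tendsto_of_subseq_tendsto fun ns hns => ?_
  have hm : TendstoInMeasure μ (fun j => c (ns j)) atTop c₀ :=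
    tendstoInMeasure_of_tendsto_eLpNorm one_ne_zero (fun j => hc (ns j)) hc₀ (hcc.comp hns)
  obtain ⟨ms, hms, hae⟩ := hm.exists_seq_tendsto_ae
  refine ⟨ms, ?_⟩
  have h1 : Tendsto (fun j => ∫ x, β (c (ns (ms j)) x) * (a (ns (ms j)) x - a₀ x) ∂μ) atTop
      (𝓝 0) := by
    have hl : Tendsto (fun j => B * (eLpNorm (fun x => a (ns (ms j)) x - a₀ x) 1 μ).toReal) atTop
        (𝓝 0) := by
      have := ((ENNReal.tendsto_toReal ENNReal.zero_ne_top).comp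
        (hac.comp (hns.comp hms.tendsto_atTop))).const_mul B
      simpa using this
    refine squeeze_zero_norm (fun j => ?_) hl
    rw [eLpNorm_one_eq_lintegral_enorm,
      ← integral_norm_eq_lintegral_enorm (hd _).aestronglyMeasurable,
      ← integral_const_mul]
    refine (norm_integral_le_integral_norm _).trans ?_
    refine integral_mono_of_nonneg (Eventually.of_forall fun x => norm_nonneg _)
      ((hd _).norm.const_mul B) (Eventually.of_forall fun x => ?_)
    simp only [norm_mul]
    exact mul_le_mul_of_nonneg_right (hB _) (norm_nonneg _)
  have h2 : Tendsto (fun j => ∫ x, β (c (ns (ms j)) x) * a₀ x ∂μ) atTop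
      (𝓝 (∫ x, β (c₀ x) * a₀ x ∂μ)) := by
    refine tendsto_integral_of_dominated_convergence (fun x => B * |a₀ x|)
      (fun j => (hbi (hc _) ha₀).aestronglyMeasurable) (ha₀.abs.const_mul B)
      (fun j => Eventually.of_forall fun x => ?_) ?_
    · rw [norm_mul]
      exact mul_le_mul_of_nonneg_right (hB _) (norm_nonneg _)
    · filter_upwards [hae] with x hx
      exact (((hβ.tendsto _).comp hx)).mul_const _
  have h3 := h1.add h2
  rw [zero_add] at h3
  refine h3.congr fun j => ?_
  rw [← integral_add (hbi (hc _) (hd _)) (hbi (hc _) ha₀)]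
  refine integral_congr_ae (Eventually.of_forall fun x => ?_)
  simp only
  ring

/-- Write `f² - f₀² = (f - f₀)((f - f₀) + 2f₀)` and apply the Cauchy–Schwarz inequality. -/
theorem tendsto_eLpNorm_one_sq_sub {f : ℕ → α → ℝ} {f₀ : α → ℝ} (hf : ∀ N, MemLp (f N) 2 μ)
    (hf₀ : MemLp f₀ 2 μ)
    (h : Tendsto (fun N => eLpNorm (fun x => f N x - f₀ x) 2 μ) atTop (𝓝 0)) :
    Tendsto (fun N => eLpNorm (fun x => f N x ^ 2 - f₀ x ^ 2) 1 μ) atTop (𝓝 0) := by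
  have hb : ∀ N, eLpNorm (fun x => f N x ^ 2 - f₀ x ^ 2) 1 μ ≤
      eLpNorm (fun x => f N x - f₀ x) 2 μ *
        (eLpNorm (fun x => f N x - f₀ x) 2 μ + eLpNorm (fun x => 2 * f₀ x) 2 μ) := by
    intro N
    have e1 : (fun x => f N x ^ 2 - f₀ x ^ 2) =
        (fun x => f N x - f₀ x) • (fun x => f N x + f₀ x) := by
      funext x; simp only [Pi.smul_apply', smul_eq_mul]; ring
    have e2 : (fun x => f N x + f₀ x) = (fun x => f N x - f₀ x) + (fun x => 2 * f₀ x) := by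
      funext x; simp only [Pi.add_apply]; ring
    rw [e1]
    refine (eLpNorm_smul_le_mul_eLpNorm (p := 2) (q := 2) (r := 1) ((hf N).add hf₀).1
      ((hf N).sub hf₀).1).trans ?_
    refine mul_le_mul_right ?_ _
    change eLpNorm (fun x => f N x + f₀ x) 2 μ ≤ _
    rw [e2]
    exact eLpNorm_add_le ((hf N).sub hf₀).1 (hf₀.const_mul 2).1 (by norm_num)
  refine tendsto_of_tendsto_of_tendsto_of_le_of_le tendsto_const_nhds ?_ (fun _ => zero_le) hb
  have h2 := h.add_const (eLpNorm (fun x => 2 * f₀ x) 2 μ)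
  have := ENNReal.Tendsto.mul h (Or.inr ?_) h2 (Or.inr ENNReal.zero_ne_top)
  · simpa using this
  · rw [zero_add]; exact (hf₀.const_mul 2).2.ne

theorem tendsto_eLpNorm_of_le_mul {f : ℕ → α → ℝ} {g : ℕ → α → ℝ} (c : ℝ≥0) {p : ℝ≥0∞}
    (hfg : ∀ N x, |f N x| ≤ c * |g N x|)
    (h : Tendsto (fun N => eLpNorm (g N) p μ) atTop (𝓝 0)) :
    Tendsto (fun N => eLpNorm (f N) p μ) atTop (𝓝 0) := by
  have hb : ∀ N, eLpNorm (f N) p μ ≤ c * eLpNorm (g N) p μ := fun N =>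
    eLpNorm_le_nnreal_smul_eLpNorm_of_ae_le_mul (Eventually.of_forall fun x => hfg N x) p
  refine tendsto_of_tendsto_of_tendsto_of_le_of_le tendsto_const_nhds ?_ (fun _ => zero_le) hb
  simpa using ENNReal.Tendsto.const_mul h (Or.inr ENNReal.coe_ne_top)

theorem tendsto_integral_of_tendsto_eLpNorm_one {f : ℕ → α → ℝ} {f₀ : α → ℝ}
    (hf : ∀ N, Integrable (f N) μ) (hf₀ : Integrable f₀ μ)
    (h : Tendsto (fun N => eLpNorm (fun x => f N x - f₀ x) 1 μ) atTop (𝓝 0)) :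
    Tendsto (fun N => ∫ x, f N x ∂μ) atTop (𝓝 (∫ x, f₀ x ∂μ)) :=
  tendsto_integral_of_L1' f₀ hf₀.aestronglyMeasurable (Eventually.of_forall hf) h

end Limits

/-! ### Weak gradients on one time slice: chain rule, diffusion and drift. -/

theorem inner_vec_eq_sum {n : ℕ} (x y : Vec n) : inner ℝ x y = ∑ i, x i * y i := by
  rw [PiLp.inner_apply]
  exact Finset.sum_congr rfl fun i _ => by simp [mul_comm]

theorem norm_sq_vec_eq_sum {n : ℕ} (x : Vec n) : ‖x‖ ^ 2 = ∑ i, x i ^ 2 := by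
  rw [EuclideanSpace.norm_sq_eq]
  simp

theorem MeasureTheory.MemLp.vec_apply {α : Type*} [MeasurableSpace α] {μ : Measure α} {n : ℕ} {p : ℝ≥0∞}
    {v : α → Vec n} (hv : MemLp v p μ) (i : Fin n) : MemLp (fun x => v x i) p μ := by
  refine hv.of_le ?_ (Eventually.of_forall fun x => PiLp.norm_apply_le (v x) i)
  exact (EuclideanSpace.proj (𝕜 := ℝ) i).continuous.comp_aestronglyMeasurable hv.1

section Slices

variable {n : ℕ} {w : Torus n → ℝ} {v : Torus n → Vec n}

theorem MeasureTheory.MemLp.torusConv {K F : Torus n → ℝ} (hK : Continuous K)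
    (hF : Integrable F volume) (p : ℝ≥0∞) : MemLp (_root_.torusConv K F) p volume := by
  have h := continuous_torusConv hK hF
  obtain ⟨B, hB⟩ := h.exists_torus_bound
  exact MemLp.of_bound h.aestronglyMeasurable B (Eventually.of_forall hB)

theorem tendsto_eLpNorm_comp_torusConv_sub {β β' : ℝ → ℝ} (hβ : ∀ s, HasDerivAt β (β' s) s)
    {B : ℝ} (hB : ∀ s, |β' s| ≤ B) (hw : Integrable w volume) :
    Tendsto (fun N => eLpNorm (fun x => β (torusConv (torusKernel n N) w x) - β (w x)) 1 volume)
      atTop (𝓝 0) := by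
  have hB0 : 0 ≤ B := (abs_nonneg _).trans (hB 0)
  refine tendsto_eLpNorm_of_le_mul ⟨B, hB0⟩
    (fun N x => abs_sub_le_of_hasDerivAt_bound hβ hB _ _)
    (tendsto_eLpNorm_torusConv_sub le_rfl ENNReal.one_ne_top (memLp_one_iff_integrable.2 hw))

theorem integrable_comp_of_bound_deriv {α : Type*} [MeasurableSpace α] {μ : Measure α}
    [IsFiniteMeasure μ] {w : α → ℝ} {β β' : ℝ → ℝ} (hβ : ∀ s, HasDerivAt β (β' s) s)
    {B : ℝ} (hB : ∀ s, |β' s| ≤ B) (hw : Integrable w μ) :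
    Integrable (fun x => β (w x)) μ := by
  have hc : Continuous β := continuous_iff_continuousAt.2 fun s => (hβ s).continuousAt
  refine ((hw.abs.const_mul B).add (integrable_const |β 0|)).mono'
    (hc.comp_aestronglyMeasurable hw.aestronglyMeasurable) (Eventually.of_forall fun x => ?_)
  have h1 := abs_sub_le_of_hasDerivAt_bound hβ hB (w x) 0
  rw [sub_zero] at h1
  have h2 := abs_add_le (β (w x) - β 0) (β 0)
  rw [sub_add_cancel] at h2
  simp only [Pi.add_apply, Real.norm_eq_abs]
  linarith

/-- The chain rule for weak gradients. -/
theorem IsWeakGradient.comp (h : IsWeakGradient w v) (hw : Integrable w volume)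
    (hv : MemLp v 1 volume) {β β' : ℝ → ℝ} (hβ : ∀ s, HasDerivAt β (β' s) s)
    (hβ' : Continuous β') {B : ℝ} (hB : ∀ s, |β' s| ≤ B) :
    IsWeakGradient (fun x => β (w x)) (fun x => β' (w x) • v x) := by
  intro ψ hψ i
  have hc : Continuous β := continuous_iff_continuousAt.2 fun s => (hβ s).continuousAt
  have hvi : Integrable (fun x => v x i) volume := memLp_one_iff_integrable.1 (hv.vec_apply i)
  have hψp := hψ.hasPartial i
  obtain ⟨C, hC⟩ := hψ.continuous.exists_torus_bound
  obtain ⟨D, hD⟩ := hψp.continuous.exists_torus_bound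
  have hC0 : 0 ≤ C := (abs_nonneg _).trans (hC 0)
  have hD0 : 0 ≤ D := (abs_nonneg _).trans (hD 0)
  set W : ℕ → Torus n → ℝ := fun N => torusConv (torusKernel n N) w with hW
  set U : ℕ → Torus n → ℝ := fun N => torusConv (torusKernel n N) (fun x => v x i) with hU
  have hWc : ∀ N, Continuous (W N) := fun N => continuous_torusConv (continuous_torusKernel N) hw
  have hUc : ∀ N, Continuous (U N) := fun N => continuous_torusConv (continuous_torusKernel N) hvi
  -- Mollification commutes with the weak gradient. The identity is therefore classical for every
  -- `N`, and only limits in `L¹` remain.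
  have hWp : ∀ N, HasPartial i (W N) (U N) := by
    intro N
    have := ((isSmoothOnTorus_torusKernel (n := n) N).hasPartial i).torusConv
      (continuous_torusKernel N) hw
    rwa [h.torusConv_partial (isSmoothOnTorus_torusKernel N) i] at this
  have hibp : ∀ N, ∫ x, β (W N x) * torusGrad ψ x i = -∫ x, β' (W N x) * (U N x * ψ x) := by
    intro N
    rw [HasPartial.integral_mul_eq_neg ((hWp N).comp hβ hβ' (hWc N)) hψp (hc.comp (hWc N))
      hψ.continuous]
    simp only [mul_assoc]
  have hl : Tendsto (fun N => ∫ x, β (W N x) * torusGrad ψ x i) atTop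
      (𝓝 (∫ x, β (w x) * torusGrad ψ x i)) := by
    refine tendsto_integral_of_tendsto_eLpNorm_one (fun N => ?_) ?_ ?_
    · exact ((hc.comp (hWc N)).mul hψp.continuous).integrable_torus
    · exact (integrable_comp_of_bound_deriv hβ hB hw).mul_bdd (c := D)
        hψp.continuous.aestronglyMeasurable (Eventually.of_forall hD)
    · refine tendsto_eLpNorm_of_le_mul ⟨D, hD0⟩ (fun N x => ?_)
        (tendsto_eLpNorm_comp_torusConv_sub hβ hB hw)
      rw [← sub_mul, abs_mul, mul_comm]
      exact mul_le_mul_of_nonneg_right (hD x) (abs_nonneg _)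
  have hr : Tendsto (fun N => ∫ x, β' (W N x) * (U N x * ψ x)) atTop
      (𝓝 (∫ x, β' (w x) * (v x i * ψ x))) := by
    refine tendsto_integral_comp_mul hβ' hB (fun N => ?_) ?_ (fun N => (hWc N).aestronglyMeasurable)
      hw.aestronglyMeasurable ?_ ?_
    · exact ((hUc N).mul hψ.continuous).integrable_torus
    · exact hvi.mul_bdd (c := C) hψ.continuous.aestronglyMeasurable (Eventually.of_forall hC)
    · refine tendsto_eLpNorm_of_le_mul ⟨C, hC0⟩ (fun N x => ?_)
        (tendsto_eLpNorm_torusConv_sub le_rfl ENNReal.one_ne_top (memLp_one_iff_integrable.2 hvi))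
      rw [← sub_mul, abs_mul, mul_comm]
      exact mul_le_mul_of_nonneg_right (hC x) (abs_nonneg _)
    · exact tendsto_eLpNorm_torusConv_sub le_rfl ENNReal.one_ne_top
        (memLp_one_iff_integrable.2 hw)
  have := tendsto_nhds_unique hl (hr.neg.congr fun N => (hibp N).symm)
  rw [this]
  simp only [PiLp.smul_apply, smul_eq_mul, mul_assoc]

/-- The diffusion term, tested with a function of the mollified solution. -/
theorem IsWeakGradient.integral_diffusion (h : IsWeakGradient w v) (hw : Integrable w volume)
    (hv : MemLp v 1 volume) {β β' : ℝ → ℝ} (hβ : ∀ s, HasDerivAt β (β' s) s)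
    (hβ' : Continuous β') (N : ℕ) (i : Fin n) :
    ∫ x, β (torusConv (torusKernel n N) w x) *
        torusConv (fun x => torusGrad (torusKernel n N) x i) (fun x => v x i) x =
      -∫ x, β' (torusConv (torusKernel n N) w x) *
        torusConv (torusKernel n N) (fun x => v x i) x ^ 2 := by
  have hc : Continuous β := continuous_iff_continuousAt.2 fun s => (hβ s).continuousAt
  have hvi : Integrable (fun x => v x i) volume := memLp_one_iff_integrable.1 (hv.vec_apply i)
  have hk := (isSmoothOnTorus_torusKernel (n := n) N).hasPartial i
  have hkc := continuous_torusKernel (n := n) N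
  have h1 := hk.torusConv hkc hw
  rw [h.torusConv_partial (isSmoothOnTorus_torusKernel N) i] at h1
  have h2 := hk.torusConv hkc hvi
  -- The second factor is the classical `i`-th derivative of the mollified gradient component, which
  -- is why this is an integration by parts.
  rw [HasPartial.integral_mul_eq_neg (h1.comp hβ hβ' (continuous_torusConv hkc hw)) h2
    (hc.comp (continuous_torusConv hkc hw)) (continuous_torusConv hkc hvi)]
  simp only [mul_assoc, sq]

/-- A bounded nonnegative Sobolev function is an admissible test function in `div V ≤ G`. -/
theorem IsWeakGradient.drift_nonneg {V : Torus n → Vec n} {G : Torus n → ℝ}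
    (hV : MemLp V 2 volume) (hG : Integrable G volume)
    (hVG : ∀ N, ∀ᵐ y : Torus n, 0 ≤ (∫ x, inner ℝ (V x)
      (torusGrad (fun x => torusKernel n N (y - x)) x)) + ∫ x, G x * torusKernel n N (y - x))
    (h : IsWeakGradient w v) {B : ℝ} (hwm : AEStronglyMeasurable w volume)
    (hw0 : ∀ x, 0 ≤ w x) (hwB : ∀ x, w x ≤ B) (hv : MemLp v 2 volume) :
    0 ≤ (∫ x, inner ℝ (V x) (v x)) + ∫ x, w x * G x := by
  have hwb : ∀ x, |w x| ≤ B := fun x => by rw [abs_of_nonneg (hw0 x)]; exact hwB x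
  have hB0 : 0 ≤ B := (abs_nonneg _).trans (hwb 0)
  have hwi : Integrable w volume := Integrable.of_bound hwm B (Eventually.of_forall hwb)
  have hVi : ∀ i, MemLp (fun x => V x i) 2 volume := fun i => hV.vec_apply i
  have hvi : ∀ i, MemLp (fun x => v x i) 2 volume := fun i => hv.vec_apply i
  have hVi1 : ∀ i, Integrable (fun x => V x i) volume := fun i => (hVi i).integrable (by norm_num)
  have hvi1 : ∀ i, Integrable (fun x => v x i) volume := fun i => (hvi i).integrable (by norm_num)
  have swap : ∀ {K : Torus n → ℝ} {F : Torus n → ℝ}, Continuous K → Integrable F volume →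
      ∫ y, w y * ∫ x, F x * K (y - x) = ∫ x, F x * ∫ y, K (y - x) * w y := by
    intro K F hK hF
    obtain ⟨C, hC⟩ := hK.exists_torus_bound
    have hint : Integrable (fun z : Torus n × Torus n => w z.1 * (F z.2 * K (z.1 - z.2)))
        (volume.prod volume) := by
      have h1 : Integrable (fun z : Torus n × Torus n => w z.1 * F z.2) (volume.prod volume) :=
        hwi.mul_prod hF
      have h2 := h1.mul_bdd (c := C) (g := fun z : Torus n × Torus n => K (z.1 - z.2))
        (hK.comp (continuous_fst.sub continuous_snd)).aestronglyMeasurable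
        (Eventually.of_forall fun z => hC _)
      simpa only [mul_assoc] using h2
    simp only [← integral_const_mul]
    rw [integral_integral_swap hint]
    refine integral_congr_ae (Eventually.of_forall fun x => ?_)
    refine integral_congr_ae (Eventually.of_forall fun y => ?_)
    simp only
    ring
  -- The hypothesis is an inequality for translates of the kernel. Multiplying by `w y ≥ 0` and
  -- integrating in `y` superposes them to the mollified `w`.
  have hN : ∀ N, 0 ≤ (∑ i, ∫ x, V x i * torusConv (torusKernel n N) (fun x => v x i) x) +
      ∫ x, torusConv (torusKernel n N) w x * G x := by
    intro N
    set k := torusKernel n N with hk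
    have hks : IsSmoothOnTorus k := isSmoothOnTorus_torusKernel N
    have hkp : ∀ i, HasPartial i k (fun x => torusGrad k x i) := fun i => hks.hasPartial i
    -- The kernel is even, so its derivatives are odd.
    have hodd : ∀ i x y, torusGrad k (y - x) i = -torusGrad k (x - y) i := by
      intro i x y
      have e : k = fun y => k (0 - y) := by
        funext y; rw [zero_sub, hk, torusKernel_neg]
      have h2 := ((hkp i).const_sub 0).torusGrad_eq (y - x)
      rw [← e] at h2
      rw [h2, zero_sub, neg_sub]
    have hgr : ∀ y x, inner ℝ (V x) (torusGrad (fun x => k (y - x)) x) =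
        ∑ i, V x i * -torusGrad k (y - x) i := by
      intro y x
      rw [inner_vec_eq_sum]
      exact Finset.sum_congr rfl fun i _ => by rw [((hkp i).const_sub y).torusGrad_eq]
    have hbint : ∀ {F : Torus n → ℝ} {K : Torus n → ℝ}, Integrable F volume → Continuous K →
        ∀ y, Integrable (fun x => F x * K (y - x)) volume := by
      intro F K hF hK y
      obtain ⟨C, hC⟩ := hK.exists_torus_bound
      exact hF.mul_bdd (c := C) (hK.comp (continuous_const.sub continuous_id)).aestronglyMeasurable
        (Eventually.of_forall fun x => hC _)
    have hnc : ∀ i, Continuous fun x => -torusGrad k x i := fun i => (hkp i).continuous.neg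
    have hpos : 0 ≤ ∫ y, w y * ((∑ i, ∫ x, V x i * -torusGrad k (y - x) i) +
        ∫ x, G x * k (y - x)) := by
      refine integral_nonneg_of_ae ?_
      filter_upwards [hVG N] with y hy
      simp only [← hk, hgr] at hy
      rw [integral_finsetSum _ fun i _ => hbint (hVi1 i) (hnc i) y] at hy
      exact mul_nonneg (hw0 y) hy
    have hcont : ∀ {F : Torus n → ℝ} {K : Torus n → ℝ}, Integrable F volume → Continuous K →
        Continuous fun y => ∫ x, F x * K (y - x) := by
      intro F K hF hK
      have := continuous_torusConv hK hF
      exact this.congr fun y => integral_congr_ae (Eventually.of_forall fun x => mul_comm _ _)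
    have hmi : ∀ {F : Torus n → ℝ}, Continuous F → Integrable (fun y => w y * F y) volume := by
      intro F hF
      obtain ⟨C, hC⟩ := hF.exists_torus_bound
      exact hwi.mul_bdd (c := C) hF.aestronglyMeasurable (Eventually.of_forall hC)
    simp only [mul_add, Finset.mul_sum] at hpos
    rw [integral_add (integrable_finsetSum _ fun i _ => hmi (hcont (hVi1 i) (hnc i)))
      (hmi (hcont hG hks.continuous)),
      integral_finsetSum _ fun i _ => hmi (hcont (hVi1 i) (hnc i)), swap hks.continuous hG] at hpos
    have hsw : ∀ i, ∫ y, w y * ∫ x, V x i * -torusGrad k (y - x) i =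
        ∫ x, V x i * ∫ y, torusGrad k (x - y) i * w y := by
      intro i
      rw [swap (hnc i) (hVi1 i)]
      refine integral_congr_ae (Eventually.of_forall fun x => ?_)
      have e : ∀ y, -torusGrad k (y - x) i = torusGrad k (x - y) i := fun y => by
        rw [hodd i x y, neg_neg]
      simp only [e]
    rw [Finset.sum_congr rfl fun i _ => hsw i] at hpos
    convert hpos using 2
    · refine Finset.sum_congr rfl fun i _ => ?_
      rw [← h.torusConv_partial hks i]
      rfl
    · refine integral_congr_ae (Eventually.of_forall fun x => ?_)
      simp only [mul_comm _ (G x), torusConv]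
      simp only [hk, torusKernel_sub_comm N x]
  have hlim1 : ∀ i, Tendsto
      (fun N => ∫ x, V x i * torusConv (torusKernel n N) (fun x => v x i) x) atTop
      (𝓝 (∫ x, V x i * v x i)) := by
    intro i
    have hcm : ∀ N, MemLp (torusConv (torusKernel n N) (fun x => v x i)) 2 volume := fun N =>
      MemLp.torusConv (continuous_torusKernel N) (hvi1 i) 2
    refine tendsto_integral_of_tendsto_eLpNorm_one
      (fun N => (hVi i).integrable_mul (hcm N)) ((hVi i).integrable_mul (hvi i)) ?_
    have ht := tendsto_eLpNorm_torusConv_sub (p := 2) (by norm_num) (by norm_num) (hvi i)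
    refine tendsto_of_tendsto_of_tendsto_of_le_of_le tendsto_const_nhds ?_ (fun _ => zero_le)
      (fun N => ?_) (h := fun N => eLpNorm (fun x => V x i) 2 volume *
        eLpNorm (fun x => torusConv (torusKernel n N) (fun x => v x i) x - v x i) 2 volume)
    · simpa using ENNReal.Tendsto.const_mul ht (Or.inr (hVi i).2.ne)
    · have e : (fun x => V x i * torusConv (torusKernel n N) (fun x => v x i) x - V x i * v x i) =
          (fun x => V x i) • fun x => torusConv (torusKernel n N) (fun x => v x i) x - v x i := by
        funext x; simp [mul_sub]
      rw [e]
      exact eLpNorm_smul_le_mul_eLpNorm ((hcm N).sub (hvi i)).1 (hVi i).1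
  have hlim2 : Tendsto (fun N => ∫ x, torusConv (torusKernel n N) w x * G x) atTop
      (𝓝 (∫ x, w x * G x)) := by
    -- As `G` is only integrable, convergence of the mollified `w` in `L¹` is not enough. All
    -- convolutions stay in `[-B, B]`, where this clamp is the identity, and the bounded factor
    -- makes `tendsto_integral_comp_mul` applicable.
    set β : ℝ → ℝ := fun s => max (-B) (min s B) with hβ
    have hβB : ∀ s, |β s| ≤ B := fun s =>
      abs_le.2 ⟨le_max_left _ _, max_le (by linarith) (min_le_right _ _)⟩
    have hβid : ∀ s, |s| ≤ B → β s = s := fun s hs => by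
      rw [hβ]; simp only; rw [min_eq_left (abs_le.1 hs).2, max_eq_right (abs_le.1 hs).1]
    have hcb : ∀ N x, |torusConv (torusKernel n N) w x| ≤ B := by
      intro N x
      rw [torusConv_eq]
      calc |∫ y, torusKernel n N y * w (x - y)| ≤ ∫ y, torusKernel n N y * B := by
            refine (norm_integral_le_integral_norm _).trans (integral_mono_of_nonneg
              (Eventually.of_forall fun y => norm_nonneg (torusKernel n N y * w (x - y)))
              ((continuous_torusKernel N).integrable_torus.mul_const B)
              (Eventually.of_forall fun y => ?_))
            simp only [norm_mul, Real.norm_eq_abs, abs_of_nonneg (torusKernel_nonneg N y)]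
            exact mul_le_mul_of_nonneg_left (hwb _) (torusKernel_nonneg N y)
        _ = B := by rw [integral_mul_const, integral_torusKernel, one_mul]
    have := tendsto_integral_comp_mul (μ := (volume : Measure (Torus n))) (β := β) (B := B)
      (a := fun _ => G) (a₀ := G) (c := fun N => torusConv (torusKernel n N) w) (c₀ := w)
      (by fun_prop) hβB (fun _ => hG) hG
      (fun N => (continuous_torusConv (continuous_torusKernel N) hwi).aestronglyMeasurable) hwm
      (by simp) (tendsto_eLpNorm_torusConv_sub le_rfl ENNReal.one_ne_top
        (memLp_one_iff_integrable.2 hwi))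
    simpa only [hβid _ (hcb _ _), hβid _ (hwb _)] using this
  have hfin := ge_of_tendsto' ((tendsto_finsetSum Finset.univ fun i _ => hlim1 i).add hlim2) hN
  have hprod : ∀ i, Integrable (fun x => V x i * v x i) volume := fun i =>
    (hVi i).integrable_mul (hvi i)
  simp only [inner_vec_eq_sum]
  rwa [integral_finsetSum _ fun i _ => hprod i]

end Slices

/-! ### Absolutely continuous functions of one variable -/

theorem LipschitzOnWith.comp_absolutelyContinuousOnInterval {Φ f : ℝ → ℝ} {K : ℝ≥0} {s : Set ℝ}
    {a b : ℝ} (hΦ : LipschitzOnWith K Φ s) (hf : AbsolutelyContinuousOnInterval f a b)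
    (hs : MapsTo f (uIcc a b) s) : AbsolutelyContinuousOnInterval (fun t => Φ (f t)) a b := by
  rw [absolutelyContinuousOnInterval_iff] at hf ⊢
  intro ε hε
  -- `K + 1` in place of `K` covers the Lipschitz constant `0`.
  obtain ⟨δ, hδ, h⟩ := hf (ε / (K + 1)) (by positivity)
  refine ⟨δ, hδ, fun E hE hE' => ?_⟩
  have h1 := h E hE hE'
  have h2 : ∑ i ∈ Finset.range E.1, dist (Φ (f (E.2 i).1)) (Φ (f (E.2 i).2)) ≤
      (K + 1) * ∑ i ∈ Finset.range E.1, dist (f (E.2 i).1) (f (E.2 i).2) := by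
    rw [Finset.mul_sum]
    refine Finset.sum_le_sum fun i hi => ?_
    have hm := hE.1 i hi
    refine (hΦ.dist_le_mul _ (hs hm.1) _ (hs hm.2)).trans ?_
    gcongr
    linarith
  refine h2.trans_lt ?_
  rw [lt_div_iff₀ (by positivity)] at h1
  linarith

/-- The chain rule for primitives of integrable functions, in integrated form. -/
theorem integral_deriv_comp_eq_sub {Φ Φ' y F : ℝ → ℝ} {a b B : ℝ} (hab : a ≤ b)
    (hF : IntervalIntegrable F volume a b) (hy : ∀ t ∈ Icc a b, y t = y a + ∫ s in a..t, F s)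
    (hΦ : ∀ s, HasDerivAt Φ (Φ' s) s) (hB : ∀ s, |Φ' s| ≤ B) :
    ∫ t in a..b, Φ' (y t) * F t = Φ (y b) - Φ (y a) := by
  set Y : ℝ → ℝ := fun t => y a + ∫ s in a..t, F s with hY
  have hB0 : 0 ≤ B := (abs_nonneg _).trans (hB 0)
  have hYac : AbsolutelyContinuousOnInterval Y a b := by
    have h1 := hF.absolutelyContinuousOnInterval_intervalIntegral (c := a) (by simp)
    have h2 : AbsolutelyContinuousOnInterval (fun _ : ℝ => y a) a b :=
      (LipschitzWith.const (y a)).lipschitzOnWith.absolutelyContinuousOnInterval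
    exact h2.add h1
  have hL : LipschitzOnWith ⟨B, hB0⟩ Φ univ := LipschitzOnWith.of_dist_le_mul fun s _ t _ =>
    abs_sub_le_of_hasDerivAt_bound hΦ hB s t
  have hΦY := hL.comp_absolutelyContinuousOnInterval hYac (mapsTo_univ _ _)
  have h1 := hΦY.integral_deriv_eq_sub
  have hYa : Y a = y a := by simp [hY]
  have hYb : Y b = y b := (hy b (right_mem_Icc.2 hab)).symm
  rw [hYa, hYb] at h1
  rw [← h1]
  -- The composition is absolutely continuous, so its derivative is needed almost everywhere only;
  -- there the primitive has derivative `F`.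
  refine intervalIntegral.integral_congr_ae ?_
  filter_upwards [hF.ae_hasDerivAt_integral] with t ht htm
  have htm' : t ∈ uIcc a b := uIoc_subset_uIcc htm
  have hd : HasDerivAt Y (F t) t := by
    exact (ht htm' a (by simp)).const_add (y a)
  have := ((hΦ (Y t)).comp t hd).deriv
  rw [uIcc_of_le hab] at htm'
  rw [hy t htm']
  exact this.symm

/-- The estimate runs backwards from `T`, with `y' = -F`. Put `A t = ∫ a` from `t₀` to `t` and
differentiate `e^{A/p} y^{1/p}`: the terms with `a` cancel and what remains is at least `-(1/p)
e^{A/p} b ≥ -e^{A T} b`. Integrating over `[t₀, T]` gives the claim because `A t₀ = 0`. The lower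
bound `δ` keeps `s ↦ s^{1/p}` Lipschitz on the range of `y`, so that the product is absolutely
continuous. -/
theorem gronwall_rpow {p : ℝ} (hp : 1 ≤ p) {t₀ T δ : ℝ} (hT : t₀ ≤ T) {a b F y : ℝ → ℝ}
    (ha : IntervalIntegrable a volume t₀ T) (hb : IntervalIntegrable b volume t₀ T)
    (hF : IntervalIntegrable F volume t₀ T) (ha0 : ∀ t, 0 ≤ a t) (hb0 : ∀ t, 0 ≤ b t)
    (hF0 : ∀ t, 0 ≤ F t) (hδ : 0 < δ) (hyT : δ ≤ y T)
    (hy : ∀ t ∈ Icc t₀ T, y t = y T + ∫ s in t..T, F s)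
    (hFle : ∀ᵐ t, t ∈ Icc t₀ T → F t ≤ a t * y t + b t * y t ^ (1 - 1 / p)) :
    y t₀ ^ (1 / p) ≤ Real.exp (∫ s in t₀..T, a s) * (y T ^ (1 / p) + ∫ s in t₀..T, b s) := by
  have hp0 : 0 < p := by linarith
  have hsub : ∀ {f : ℝ → ℝ}, IntervalIntegrable f volume t₀ T → ∀ t ∈ Icc t₀ T,
      IntervalIntegrable f volume t₀ t ∧ IntervalIntegrable f volume t T := by
    intro f hf t ht
    exact ⟨hf.mono_set (by rw [uIcc_of_le ht.1, uIcc_of_le hT]; exact Icc_subset_Icc_right ht.2),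
      hf.mono_set (by rw [uIcc_of_le ht.2, uIcc_of_le hT]; exact Icc_subset_Icc_left ht.1)⟩
  set Y : ℝ → ℝ := fun t => y t₀ - ∫ s in t₀..t, F s with hY
  have hYy : ∀ t ∈ Icc t₀ T, Y t = y t := by
    intro t ht
    have h1 := hy t₀ (left_mem_Icc.2 hT)
    have h2 := hy t ht
    have h3 := intervalIntegral.integral_add_adjacent_intervals (hsub hF t ht).1 (hsub hF t ht).2
    simp only [hY]
    linarith
  have hyδ : ∀ t ∈ Icc t₀ T, δ ≤ y t := by
    intro t ht
    rw [hy t ht]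
    have : 0 ≤ ∫ s in t..T, F s := intervalIntegral.integral_nonneg ht.2 fun s _ => hF0 s
    linarith
  set A : ℝ → ℝ := fun t => ∫ s in t₀..t, a s with hA
  have hAac : AbsolutelyContinuousOnInterval A t₀ T :=
    ha.absolutelyContinuousOnInterval_intervalIntegral (by simp)
  have hYac : AbsolutelyContinuousOnInterval Y t₀ T := by
    have h2 : AbsolutelyContinuousOnInterval (fun _ : ℝ => y t₀) t₀ T :=
      (LipschitzWith.const (y t₀)).lipschitzOnWith.absolutelyContinuousOnInterval
    exact h2.sub (hF.absolutelyContinuousOnInterval_intervalIntegral (by simp))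
  obtain ⟨M, hM⟩ := hYac.exists_bound
  obtain ⟨N, hN⟩ := hAac.exists_bound
  rw [uIcc_of_le hT] at hM hN
  obtain ⟨K₁, hK₁⟩ : ∃ K, LipschitzOnWith K (fun s : ℝ => s ^ (1 / p)) (Icc δ M) := by
    refine ContDiffOn.exists_lipschitzOnWith (n := 1) ?_ (by norm_num) (convex_Icc _ _) isCompact_Icc
    exact contDiffOn_id.rpow_const_of_ne fun s hs => (hδ.trans_le hs.1).ne'
  obtain ⟨K₂, hK₂⟩ : ∃ K, LipschitzOnWith K (fun s : ℝ => Real.exp (s / p)) (Icc (-N) N) := by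
    refine ContDiffOn.exists_lipschitzOnWith (n := 1) ?_ (by norm_num) (convex_Icc _ _) isCompact_Icc
    exact (Real.contDiff_exp.comp (contDiff_id.div_const p)).contDiffOn
  have hZac := hK₁.comp_absolutelyContinuousOnInterval hYac (by
    rw [uIcc_of_le hT]
    exact fun t ht => ⟨(hYy t ht) ▸ hyδ t ht, (le_abs_self _).trans (hM t ht)⟩)
  have hEac := hK₂.comp_absolutelyContinuousOnInterval hAac (by
    rw [uIcc_of_le hT]
    exact fun t ht => ⟨neg_le_of_abs_le (hN t ht), (le_abs_self _).trans (hN t ht)⟩)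
  have hQac := hEac.mul hZac
  have hftc := hQac.integral_deriv_eq_sub
  have hA0 : A t₀ = 0 := by simp [hA]
  have hApos : ∀ t ∈ Icc t₀ T, A t ≤ A T := by
    intro t ht
    have h3 := intervalIntegral.integral_add_adjacent_intervals (hsub ha t ht).1 (hsub ha t ht).2
    have : 0 ≤ ∫ s in t..T, a s := intervalIntegral.integral_nonneg ht.2 fun s _ => ha0 s
    simp only [hA]
    linarith
  have hAT : 0 ≤ A T := intervalIntegral.integral_nonneg hT fun s _ => ha0 s
  have hlow : -(Real.exp (A T) * ∫ s in t₀..T, b s) ≤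
      ∫ t in t₀..T, deriv ((fun t => Real.exp (A t / p)) * fun t => Y t ^ (1 / p)) t := by
    rw [← intervalIntegral.integral_const_mul, ← intervalIntegral.integral_neg]
    refine intervalIntegral.integral_mono_ae_restrict hT (hb.const_mul _).neg
      hQac.intervalIntegrable_deriv ?_
    rw [EventuallyLE, ae_restrict_iff' measurableSet_Icc]
    filter_upwards [hF.ae_hasDerivAt_integral, ha.ae_hasDerivAt_integral, hFle] with t h1 h2 h3 ht
    have htu : t ∈ uIcc t₀ T := by rwa [uIcc_of_le hT]
    have hdY : HasDerivAt Y (-F t) t := by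
      simpa using (h1 htu t₀ (by simp)).const_sub (y t₀)
    have hdA : HasDerivAt A (a t) t := h2 htu t₀ (by simp)
    have hYt : 0 < Y t := by rw [hYy t ht]; exact hδ.trans_le (hyδ t ht)
    have hd := ((hdA.div_const p).exp).mul (hdY.rpow_const (p := 1 / p) (Or.inl hYt.ne'))
    rw [hd.deriv]
    have hF' := h3 ht
    rw [← hYy t ht] at hF'
    have e1 : Y t ^ (1 / p) = Y t * Y t ^ (1 / p - 1) := by
      rw [Real.rpow_sub_one hYt.ne']; field_simp
    have e2 : Y t ^ (1 - 1 / p) * Y t ^ (1 / p - 1) = 1 := by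
      rw [← Real.rpow_add hYt]; simp
    have hw : 0 < Y t ^ (1 / p - 1) := Real.rpow_pos_of_pos hYt _
    have h4 : F t * Y t ^ (1 / p - 1) ≤ a t * Y t ^ (1 / p) + b t := by
      calc F t * Y t ^ (1 / p - 1)
          ≤ (a t * Y t + b t * Y t ^ (1 - 1 / p)) * Y t ^ (1 / p - 1) := by gcongr
        _ = a t * (Y t * Y t ^ (1 / p - 1)) + b t * (Y t ^ (1 - 1 / p) * Y t ^ (1 / p - 1)) := by
            ring
        _ = _ := by rw [← e1, e2, mul_one]
    have hE : Real.exp (A t / p) ≤ Real.exp (A T) := by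
      refine Real.exp_le_exp.2 ?_
      rw [div_le_iff₀ hp0]
      have := hApos t ht
      nlinarith
    have hE0 := Real.exp_pos (A t / p)
    have hpi : 1 / p ≤ 1 := by rw [div_le_one hp0]; exact hp
    have hpi0 : 0 < 1 / p := by positivity
    calc -(Real.exp (A T) * b t) ≤ -(Real.exp (A t / p) * b t) := by
          have := mul_le_mul_of_nonneg_right hE (hb0 t); linarith
      _ ≤ -(1 / p * (Real.exp (A t / p) * b t)) := by
          have : 0 ≤ Real.exp (A t / p) * b t := mul_nonneg hE0.le (hb0 t)
          nlinarith
      _ ≤ Real.exp (A t / p) * (1 / p) * (a t * Y t ^ (1 / p) - F t * Y t ^ (1 / p - 1)) := by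
          have : 0 ≤ Real.exp (A t / p) * (1 / p) := by positivity
          nlinarith
      _ = _ := by ring
  rw [hftc] at hlow
  simp only [Pi.mul_apply, hA0, zero_div, Real.exp_zero, one_mul] at hlow
  rw [hYy t₀ (left_mem_Icc.2 hT), hYy T (right_mem_Icc.2 hT)] at hlow
  have h5 : Real.exp (A T / p) * y T ^ (1 / p) ≤ Real.exp (A T) * y T ^ (1 / p) := by
    refine mul_le_mul_of_nonneg_right (Real.exp_le_exp.2 (div_le_self hAT hp)) ?_
    exact Real.rpow_nonneg (hδ.le.trans hyT) _
  have : ∫ s in t₀..T, a s = A T := rfl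
  rw [this, mul_add]
  linarith

/-! ### Testing with functions of time -/

/-- A smooth approximation of the indicator function of `(a, ∞)`. -/
noncomputable def smoothStep (a : ℝ) (j : ℕ) (t : ℝ) : ℝ :=
  Real.smoothTransition ((j + 1 : ℝ) * (t - a))

theorem contDiff_smoothStep (a : ℝ) (j : ℕ) : ContDiff ℝ ∞ (smoothStep a j) :=
  Real.smoothTransition.contDiff.comp (contDiff_const.mul (contDiff_id.sub contDiff_const))

theorem smoothStep_of_le {a t : ℝ} (j : ℕ) (h : t ≤ a) : smoothStep a j t = 0 :=
  Real.smoothTransition.zero_of_nonpos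
    (mul_nonpos_of_nonneg_of_nonpos (by positivity) (by linarith))

theorem smoothStep_of_ge {a t : ℝ} (j : ℕ) (h : a + 1 / (j + 1 : ℝ) ≤ t) : smoothStep a j t = 1 := by
  refine Real.smoothTransition.one_of_one_le ?_
  have hj : (0 : ℝ) < j + 1 := by positivity
  have := mul_le_mul_of_nonneg_left (show 1 / (j + 1 : ℝ) ≤ t - a by linarith) hj.le
  rwa [mul_one_div_cancel hj.ne'] at this

theorem tendsto_smoothStep_of_gt {a t : ℝ} (h : a < t) :
    Tendsto (fun j => smoothStep a j t) atTop (𝓝 1) := by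
  have h1 : Tendsto (fun j : ℕ => a + 1 / ((j : ℝ) + 1)) atTop (𝓝 (a + 0)) :=
    tendsto_one_div_add_atTop_nhds_zero_nat.const_add a
  rw [add_zero] at h1
  refine tendsto_const_nhds.congr' ?_
  filter_upwards [h1.eventually_lt_const h] with j hj using (smoothStep_of_ge j hj.le).symm

theorem smoothStep_antitone {a b : ℝ} (hab : a ≤ b) (j : ℕ) (t : ℝ) :
    smoothStep b j t ≤ smoothStep a j t :=
  Real.smoothTransition.monotone (mul_le_mul_of_nonneg_left (by linarith) (by positivity))

/-- A smooth approximation of the indicator function of `(a, b]`. -/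
noncomputable def smoothIndicator (a b : ℝ) (j : ℕ) (t : ℝ) : ℝ := smoothStep a j t - smoothStep b j t

section SmoothIndicator

variable {a b : ℝ}

theorem contDiff_smoothIndicator (a b : ℝ) (j : ℕ) : ContDiff ℝ ∞ (smoothIndicator a b j) :=
  (contDiff_smoothStep a j).sub (contDiff_smoothStep b j)

theorem smoothIndicator_nonneg (hab : a ≤ b) (j : ℕ) (t : ℝ) : 0 ≤ smoothIndicator a b j t :=
  sub_nonneg.2 (smoothStep_antitone hab j t)

theorem smoothIndicator_le_one (j : ℕ) (t : ℝ) : smoothIndicator a b j t ≤ 1 := by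
  have h1 := Real.smoothTransition.le_one ((j + 1 : ℝ) * (t - a))
  have h2 := Real.smoothTransition.nonneg ((j + 1 : ℝ) * (t - b))
  simp only [smoothIndicator, smoothStep]
  linarith

theorem smoothIndicator_eq_zero (hab : a ≤ b) {j : ℕ} {t : ℝ}
    (ht : t ∉ Icc a (b + 1 / (j + 1 : ℝ))) : smoothIndicator a b j t = 0 := by
  rw [mem_Icc, not_and_or, not_le, not_le] at ht
  rw [smoothIndicator]
  rcases ht with h | h
  · rw [smoothStep_of_le j h.le, smoothStep_of_le j (h.le.trans hab), sub_zero]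
  · rw [smoothStep_of_ge j h.le, smoothStep_of_ge j (by linarith), sub_self]

theorem tendsto_smoothIndicator (hab : a ≤ b) (t : ℝ) :
    Tendsto (fun j => smoothIndicator a b j t) atTop (𝓝 ((Ioc a b).indicator 1 t)) := by
  rcases le_or_gt t a with h | h
  · rw [indicator_of_notMem (fun h' => absurd h'.1 (not_lt.2 h))]
    refine tendsto_const_nhds.congr fun j => ?_
    rw [smoothIndicator, smoothStep_of_le j h, smoothStep_of_le j (h.trans hab), sub_zero]
  · rcases le_or_gt t b with h' | h'
    · rw [indicator_of_mem (show t ∈ Ioc a b from ⟨h, h'⟩), Pi.one_apply]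
      refine (tendsto_smoothStep_of_gt h).congr fun j => ?_
      rw [smoothIndicator, smoothStep_of_le j h', sub_zero]
    · rw [indicator_of_notMem (fun h'' => absurd h''.2 (not_le.2 h'))]
      have := (tendsto_smoothStep_of_gt h).sub (tendsto_smoothStep_of_gt h')
      rwa [sub_self] at this

/-- A cutoff function supported in a compact subinterval of `(0, T)`. -/
def IsTimeCutoff (T : ℝ) (χ : ℝ → ℝ) : Prop :=
  ContDiff ℝ ∞ χ ∧ ∃ a b : ℝ, 0 < a ∧ b < T ∧ ∀ t, t ∉ Icc a b → χ t = 0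

theorem eventually_isTimeCutoff {T : ℝ} (ha : 0 < a) (hab : a ≤ b) (hb : b < T) :
    ∀ᶠ j in atTop, IsTimeCutoff T (smoothIndicator a b j) := by
  have h1 : Tendsto (fun j : ℕ => b + 1 / ((j : ℝ) + 1)) atTop (𝓝 (b + 0)) :=
    tendsto_one_div_add_atTop_nhds_zero_nat.const_add b
  rw [add_zero] at h1
  filter_upwards [h1.eventually_lt_const hb] with j hj
  exact ⟨contDiff_smoothIndicator a b j, a, _, ha, hj, fun t ht => smoothIndicator_eq_zero hab ht⟩

theorem tendsto_integral_smoothIndicator_mul {T : ℝ} {F : ℝ → ℝ}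
    (hF : IntegrableOn F (Ioo 0 T)) (ha : 0 ≤ a) (hab : a ≤ b) (hb : b < T) :
    Tendsto (fun j => ∫ t in Ioo 0 T, smoothIndicator a b j t * F t) atTop
      (𝓝 (∫ t in a..b, F t)) := by
  have e : ∫ t in a..b, F t = ∫ t in Ioo 0 T, (Ioc a b).indicator 1 t * F t := by
    rw [intervalIntegral.integral_of_le hab]
    have h1 : ∀ t, (Ioc a b).indicator (1 : ℝ → ℝ) t * F t = (Ioc a b).indicator F t := by
      intro t
      by_cases ht : t ∈ Ioc a b <;> simp [ht]
    simp only [h1]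
    rw [setIntegral_indicator measurableSet_Ioc, inter_eq_right.2]
    exact fun t ht => ⟨ha.trans_lt ht.1, ht.2.trans_lt hb⟩
  rw [e]
  refine tendsto_integral_of_dominated_convergence (fun t => |F t|) (fun j => ?_) hF.abs
    (fun j => Eventually.of_forall fun t => ?_) (Eventually.of_forall fun t =>
      (tendsto_smoothIndicator hab t).mul_const _)
  · exact (contDiff_smoothIndicator a b j).continuous.aestronglyMeasurable.mul hF.1
  · rw [norm_mul, Real.norm_eq_abs, abs_of_nonneg (smoothIndicator_nonneg hab j t)]
    exact mul_le_of_le_one_left (abs_nonneg _) (smoothIndicator_le_one j t)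

/-- The derivative of the step is a one-sided approximate identity on `(a, a + 1/(j+1)]`. The
substitution `t = a + s/(j+1)` turns the integral into one of `S' s * y (a + s/(j+1))` over `[0,
1]`, where `S'` has total mass one. -/
theorem tendsto_integral_deriv_smoothStep_mul {T : ℝ} {y : ℝ → ℝ} (hy : ContinuousOn y (Icc 0 T))
    (ha : 0 < a) (hb : a < T) :
    Tendsto (fun j => ∫ t in Ioo 0 T, deriv (smoothStep a j) t * y t) atTop (𝓝 (y a)) := by
  set S' : ℝ → ℝ := deriv Real.smoothTransition with hS'
  have hS'c : Continuous S' :=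
    (Real.smoothTransition.contDiff (n := 1)).continuous_deriv le_rfl
  have hderiv : ∀ j t, deriv (smoothStep a j) t = (j + 1 : ℝ) * S' ((j + 1 : ℝ) * (t - a)) := by
    intro j t
    have h1 : HasDerivAt Real.smoothTransition (S' ((j + 1 : ℝ) * (t - a))) ((j + 1 : ℝ) * (t - a)) :=
      ((Real.smoothTransition.contDiff (n := 1)).differentiable (by norm_num) _).hasDerivAt
    have h2 : HasDerivAt (fun t : ℝ => (j + 1 : ℝ) * (t - a)) ((j + 1 : ℝ) * 1) t :=
      ((hasDerivAt_id t).sub_const a).const_mul _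
    have := (h1.comp t h2).deriv
    simp only [Function.comp_def, mul_one] at this
    rw [mul_comm, ← this]
    rfl
  -- The half-open interval matches the domain of an interval integral; the value at the left end
  -- vanishes by continuity.
  have hS'0 : ∀ s, s ∉ Ioc (0 : ℝ) 1 → S' s = 0 := by
    have hz : ∀ s < 0, S' s = 0 := fun s hs => by
      have : Real.smoothTransition =ᶠ[𝓝 s] fun _ => 0 := by
        filter_upwards [Iio_mem_nhds hs] with r hr
        exact Real.smoothTransition.zero_of_nonpos (le_of_lt hr)
      rw [hS', this.deriv_eq, deriv_const]
    have ho : ∀ s, 1 < s → S' s = 0 := fun s hs => by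
      have : Real.smoothTransition =ᶠ[𝓝 s] fun _ => 1 := by
        filter_upwards [Ioi_mem_nhds hs] with r hr
        exact Real.smoothTransition.one_of_one_le (le_of_lt hr)
      rw [hS', this.deriv_eq, deriv_const]
    have h00 : S' 0 = 0 := by
      have h1 : Tendsto S' (𝓝[<] 0) (𝓝 (S' 0)) := (hS'c.tendsto 0).mono_left nhdsWithin_le_nhds
      have h2 : Tendsto S' (𝓝[<] 0) (𝓝 0) := tendsto_const_nhds.congr' (by
        filter_upwards [self_mem_nhdsWithin] with s hs using (hz s hs).symm)
      exact tendsto_nhds_unique h1 h2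
    intro s hs
    rw [mem_Ioc, not_and_or, not_lt, not_le] at hs
    rcases hs with hs | hs
    · rcases hs.lt_or_eq with hs | rfl
      · exact hz s hs
      · exact h00
    · exact ho s hs
  have hint : ∫ s in (0 : ℝ)..1, S' s = 1 := by
    rw [intervalIntegral.integral_deriv_eq_sub
      (fun s _ => (Real.smoothTransition.contDiff (n := 1)).differentiable (by norm_num) s)
      (hS'c.intervalIntegrable _ _)]
    simp
  have h1 : Tendsto (fun j : ℕ => a + 1 / ((j : ℝ) + 1)) atTop (𝓝 (a + 0)) :=
    tendsto_one_div_add_atTop_nhds_zero_nat.const_add a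
  rw [add_zero] at h1
  have hev := h1.eventually_lt_const hb
  have hconv : ∀ᶠ j : ℕ in atTop, ∫ s in (0 : ℝ)..1, S' s * y (a + s / (j + 1 : ℝ)) =
      ∫ t in Ioo 0 T, deriv (smoothStep a j) t * y t := by
    filter_upwards [hev] with j hj
    have hj0 : (0 : ℝ) < j + 1 := by positivity
    have e1 : ∫ t in Ioo 0 T, deriv (smoothStep a j) t * y t =
        ∫ t in a..a + 1 / (j + 1 : ℝ), deriv (smoothStep a j) t * y t := by
      rw [intervalIntegral.integral_of_le (by simp; positivity)]
      refine setIntegral_eq_of_subset_of_forall_sdiff_eq_zero measurableSet_Ioo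
        (fun t ht => ⟨ha.trans ht.1, ht.2.trans_lt hj⟩) fun t ht => ?_
      rw [hderiv, hS'0, mul_zero, zero_mul]
      intro hmem
      refine ht.2 ⟨?_, ?_⟩
      · by_contra hcon
        exact absurd hmem.1 (not_lt.2 (mul_nonpos_of_nonneg_of_nonpos hj0.le (by linarith)))
      · have := (le_div_iff₀' hj0).2 hmem.2
        linarith
    rw [e1]
    have e2 : ∀ t, deriv (smoothStep a j) t * y t =
        (j + 1 : ℝ) * (S' ((j + 1 : ℝ) * (t - a)) * y t) := fun t => by rw [hderiv]; ring
    simp only [e2]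
    have e3 := intervalIntegral.integral_comp_add_div (a := 0) (b := 1)
      (fun t => S' ((j + 1 : ℝ) * (t - a)) * y t) hj0.ne' a
    rw [intervalIntegral.integral_const_mul, ← smul_eq_mul]
    rw [zero_div, add_zero] at e3
    rw [← e3]
    refine intervalIntegral.integral_congr fun s _ => ?_
    simp only [add_sub_cancel_left, mul_div_cancel₀ s hj0.ne']
  refine Tendsto.congr' hconv ?_
  obtain ⟨M, hM⟩ := isCompact_Icc.exists_bound_of_continuousOn hy
  have hmem : ∀ᶠ j : ℕ in atTop, ∀ s ∈ Icc (0 : ℝ) 1, a + s / (j + 1 : ℝ) ∈ Icc 0 T := by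
    filter_upwards [hev] with j hj s hs
    have hj0 : (0 : ℝ) < j + 1 := by positivity
    have h2 : s / (j + 1 : ℝ) ≤ 1 / (j + 1 : ℝ) := by gcongr; exact hs.2
    have h3 : 0 ≤ s / (j + 1 : ℝ) := div_nonneg hs.1 hj0.le
    exact ⟨by linarith, by linarith⟩
  have hlim : Tendsto (fun j : ℕ => ∫ s in (0 : ℝ)..1, S' s * y (a + s / (j + 1 : ℝ))) atTop
      (𝓝 (∫ s in (0 : ℝ)..1, S' s * y a)) := by
    refine intervalIntegral.tendsto_integral_filter_of_dominated_convergence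
      (fun s => |S' s| * M) ?_ ?_ ?_ ?_
    · filter_upwards [hmem] with j hj
      refine ContinuousOn.aestronglyMeasurable ?_ measurableSet_uIoc
      refine hS'c.continuousOn.mul (hy.comp (by fun_prop) fun s hs => hj s ?_)
      rw [uIoc_of_le zero_le_one] at hs
      exact Ioc_subset_Icc_self hs
    · filter_upwards [hmem] with j hj
      refine Eventually.of_forall fun s hs => ?_
      rw [uIoc_of_le zero_le_one] at hs
      rw [norm_mul]
      exact mul_le_mul_of_nonneg_left (hM _ (hj s (Ioc_subset_Icc_self hs))) (norm_nonneg _)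
    · exact (hS'c.abs.mul continuous_const).intervalIntegrable _ _
    · refine Eventually.of_forall fun s hs => ?_
      rw [uIoc_of_le zero_le_one] at hs
      refine Tendsto.const_mul _ ?_
      refine (hy a ⟨ha.le, hb.le⟩).tendsto.comp (tendsto_nhdsWithin_iff.2 ⟨?_, ?_⟩)
      · have h4 : Tendsto (fun j : ℕ => a + s * (1 / ((j : ℝ) + 1))) atTop (𝓝 (a + s * 0)) :=
          (tendsto_one_div_add_atTop_nhds_zero_nat.const_mul s).const_add a
        simpa [div_eq_mul_inv] using h4
      · filter_upwards [hmem] with j hj using hj s (Ioc_subset_Icc_self hs)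
  rwa [intervalIntegral.integral_mul_const, hint, one_mul] at hlim

/-- A continuous function with integrable distributional derivative `F` is a primitive of `F`. -/
theorem eq_add_integral_of_distributional_deriv {T : ℝ} {y F : ℝ → ℝ}
    (hy : ContinuousOn y (Icc 0 T)) (hF : IntegrableOn F (Ioo 0 T))
    (h : ∀ χ, IsTimeCutoff T χ →
      (∫ t in Ioo 0 T, deriv χ t * y t) + ∫ t in Ioo 0 T, χ t * F t = 0)
    {s t : ℝ} (hs : 0 ≤ s) (hst : s ≤ t) (ht : t ≤ T) : y t = y s + ∫ τ in s..t, F τ := by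
  -- In the limit, the derivative of the smooth indicator of `(a, b]` produces `y a - y b`.
  have hint : ∀ a b, 0 < a → a ≤ b → b < T → y b = y a + ∫ τ in a..b, F τ := by
    intro a b ha hab hb
    have h1 := tendsto_integral_deriv_smoothStep_mul hy ha (hab.trans_lt hb)
    have h2 := tendsto_integral_deriv_smoothStep_mul hy (ha.trans_le hab) hb
    have h3 := tendsto_integral_smoothIndicator_mul hF ha.le hab hb
    have hder : ∀ c j, IntegrableOn (fun t => deriv (smoothStep c j) t * y t) (Ioo 0 T) := by
      intro c j
      have hc : Continuous (deriv (smoothStep c j)) :=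
        (contDiff_smoothStep c j).continuous_deriv (by simp)
      exact ((hc.continuousOn.mul hy).integrableOn_compact isCompact_Icc).mono_set
        Ioo_subset_Icc_self
    have h4 : (fun _ => (0 : ℝ)) =ᶠ[atTop] fun j =>
        (∫ t in Ioo 0 T, deriv (smoothStep a j) t * y t) -
          (∫ t in Ioo 0 T, deriv (smoothStep b j) t * y t) +
          ∫ t in Ioo 0 T, smoothIndicator a b j t * F t := by
      filter_upwards [eventually_isTimeCutoff ha hab hb] with j hj
      refine (h _ hj).symm.trans ?_
      rw [← integral_sub (hder a j) (hder b j)]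
      congr 1
      refine integral_congr_ae (Eventually.of_forall fun t => ?_)
      have hd : deriv (smoothIndicator a b j) t =
          deriv (smoothStep a j) t - deriv (smoothStep b j) t :=
        deriv_sub ((contDiff_smoothStep a j).differentiable (by simp) t)
          ((contDiff_smoothStep b j).differentiable (by simp) t)
      simp only [hd]
      ring
    have h5 := tendsto_nhds_unique (tendsto_const_nhds.congr' h4) ((h1.sub h2).add h3)
    linarith
  rcases hst.eq_or_lt with rfl | hst
  · simp
  have hFi : IntervalIntegrable F volume s t := by
    rw [intervalIntegrable_iff_integrableOn_Ioo_of_le hst.le]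
    exact hF.mono_set (Ioo_subset_Ioo hs ht)
  set P : ℝ → ℝ := fun τ => ∫ r in s..τ, F r with hP
  have hPc : ContinuousOn P (Icc s t) := by
    have := intervalIntegral.continuousOn_primitive_interval' hFi (a := s) (by simp)
    rwa [uIcc_of_le hst.le] at this
  have hyc : ContinuousOn y (Icc s t) := hy.mono (Icc_subset_Icc hs ht)
  have hdc : ContinuousOn (fun τ => y τ - P τ) (Icc s t) := hyc.sub hPc
  set c := (s + t) / 2 with hc
  have hcs : s < c := by rw [hc]; linarith
  have hct : c < t := by rw [hc]; linarith
  have hconst : ∀ τ ∈ Ioo s t, y τ - P τ = y c - P c := by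
    have hsub : ∀ {a b}, a ∈ Icc s t → b ∈ Icc s t → IntervalIntegrable F volume a b :=
      fun ha hb => hFi.mono_set (by
        rw [uIcc_of_le hst.le]; exact uIcc_subset_Icc ha hb)
    have key : ∀ a ∈ Ioo s t, ∀ b ∈ Ioo s t, a ≤ b → y a - P a = y b - P b := by
      intro a ha b hb hab
      have h1 := hint a b (hs.trans_lt ha.1) hab (hb.2.trans_le ht)
      have h2 := intervalIntegral.integral_add_adjacent_intervals
        (hsub (left_mem_Icc.2 hst.le) (Ioo_subset_Icc_self ha))
        (hsub (Ioo_subset_Icc_self ha) (Ioo_subset_Icc_self hb))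
      simp only [hP]
      linarith
    intro τ hτ
    rcases le_total τ c with h' | h'
    · exact key τ hτ c ⟨hcs, hct⟩ h'
    · exact (key c ⟨hcs, hct⟩ τ hτ h').symm
  -- Cutoffs vanish near `0` and `T`, so these endpoints are reached only by continuity of `y` and
  -- of the primitive.
  have hall : ∀ τ ∈ Icc s t, y τ - P τ = y c - P c := by
    have hcl : Icc s t ⊆ closure (Ioo s t) := by rw [closure_Ioo hst.ne]
    intro τ hτ
    have := (EqOn.of_subset_closure (f := fun τ => y τ - P τ) (g := fun _ => y c - P c)
      hconst hdc continuousOn_const Ioo_subset_Icc_self hcl)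
    exact this hτ
  have h1 := hall s (left_mem_Icc.2 hst.le)
  have h2 := hall t (right_mem_Icc.2 hst.le)
  have h3 : P s = 0 := by simp [hP]
  simp only [← hP] at *
  have h4 : ∫ τ in s..t, F τ = P t := rfl
  rw [h4]
  linarith

/-- A nonnegative distribution given by an integrable function is nonnegative almost everywhere. -/
theorem ae_nonneg_of_forall_timeCutoff {T : ℝ} {F : ℝ → ℝ} (hF : IntegrableOn F (Ioo 0 T))
    (h : ∀ χ, IsTimeCutoff T χ → (∀ t, 0 ≤ χ t) → 0 ≤ ∫ t in Ioo 0 T, χ t * F t) :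
    ∀ᵐ t ∂(volume.restrict (Ioo 0 T)), 0 ≤ F t := by
  rcases le_or_gt T 0 with hT | hT
  · simp [Ioo_eq_empty (not_lt.2 hT)]
  have hint : ∀ a b, 0 < a → a ≤ b → b < T → 0 ≤ ∫ τ in a..b, F τ := by
    intro a b ha hab hb
    refine ge_of_tendsto (tendsto_integral_smoothIndicator_mul hF ha.le hab hb) ?_
    filter_upwards [eventually_isTimeCutoff ha hab hb] with j hj
    exact h _ hj (smoothIndicator_nonneg hab j)
  have hFi : IntervalIntegrable F volume 0 T := by
    rwa [intervalIntegrable_iff_integrableOn_Ioo_of_le hT.le]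
  rw [ae_restrict_iff' measurableSet_Ioo]
  filter_upwards [hFi.ae_hasDerivAt_integral] with t ht htm
  have hd := ht (by rw [uIcc_of_le hT.le]; exact Ioo_subset_Icc_self htm) t
    (by rw [uIcc_of_le hT.le]; exact Ioo_subset_Icc_self htm)
  -- At almost every `t` the value `F t` is the limit of right difference quotients of the
  -- primitive, and these are nonnegative.
  have hs := hd.tendsto_slope.mono_left (nhdsGT_le_nhdsNE t)
  refine ge_of_tendsto hs ?_
  filter_upwards [Ioo_mem_nhdsGT htm.2] with s hs
  rw [slope_def_field, intervalIntegral.integral_same, sub_zero]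
  exact div_nonneg (hint t s htm.1 hs.1.le hs.2) (by linarith [hs.1])

end SmoothIndicator

/-! ### The energy identity -/

/-- `w`, with weak spatial gradient `Dw`, solves `-∂ₜw - ε Δw + R = 0` on the cylinder, with `R`
integrable. -/
structure IsHeatSolution {n : ℕ} (ε T : ℝ) (w : ℝ → Torus n → ℝ) (Dw : ℝ → Torus n → Vec n)
    (R : ℝ → Torus n → ℝ) : Prop where
  memLp : MemLp (fun z : ℝ × Torus n => w z.1 z.2) 2 (cylMeasure n T)
  memLp_grad : MemLp (fun z : ℝ × Torus n => Dw z.1 z.2) 2 (cylMeasure n T)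
  weakGrad : ∀ᵐ t ∂(volume.restrict (Ioo 0 T)), IsWeakGradient (w t) (Dw t)
  memLp_slice : ∀ t ∈ Icc 0 T, MemLp (w t) 2 volume
  continuous : ∀ t ∈ Icc 0 T,
    Tendsto (fun s => eLpNorm (w s - w t) 2 volume) (𝓝[Icc 0 T] t) (𝓝 0)
  integrable : Integrable (fun z : ℝ × Torus n => R z.1 z.2) (cylMeasure n T)
  equation : ∀ φ : ℝ → Torus n → ℝ, IsTestFunction T φ →
    (∫ z, w z.1 z.2 * deriv (fun s => φ s z.2) z.1 ∂(cylMeasure n T))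
        + ε * (∫ z, inner ℝ (Dw z.1 z.2) (torusGrad (φ z.1) z.2) ∂(cylMeasure n T))
        + (∫ z, R z.1 z.2 * φ z.1 z.2 ∂(cylMeasure n T)) = 0

section Cylinder

variable {n : ℕ} {K : Torus n → ℝ} {ν : Measure ℝ} [IsFiniteMeasure ν]

theorem integrable_torusConv_prod (hK : Continuous K) {F : ℝ → Torus n → ℝ}
    (hF : Integrable (fun z : ℝ × Torus n => F z.1 z.2) (ν.prod volume)) :
    Integrable (fun z : ℝ × Torus n => torusConv K (F z.1) z.2) (ν.prod volume) := by
  obtain ⟨B, hB⟩ := hK.exists_torus_bound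
  -- Exchanging the two space variables shows that `F(t, y)` is integrable in `(t, x, y)`; Fubini
  -- then applies to the convolution integrand.
  have hmp : MeasurePreserving (fun z : (ℝ × Torus n) × Torus n => ((z.1.1, z.2), z.1.2))
      ((ν.prod volume).prod volume) ((ν.prod volume).prod volume) := by
    have h1 := measurePreserving_prodAssoc ν (volume : Measure (Torus n))
      (volume : Measure (Torus n))
    have h2 := (MeasurePreserving.id ν).prod (Measure.measurePreserving_swap
      (μ := (volume : Measure (Torus n))) (ν := (volume : Measure (Torus n))))
    exact (h1.symm _).comp (h2.comp h1)
  have hF1 : Integrable (fun z : (ℝ × Torus n) × Torus n => F z.1.1 z.2)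
      ((ν.prod volume).prod volume) := hmp.integrable_comp_of_integrable (hF.comp_fst volume)
  have hF2 : Integrable (fun z : (ℝ × Torus n) × Torus n => K (z.1.2 - z.2) * F z.1.1 z.2)
      ((ν.prod volume).prod volume) := hF1.bdd_mul (c := B)
    (hK.comp (by fun_prop)).aestronglyMeasurable (Eventually.of_forall fun z => hB _)
  exact hF2.integral_prod_left

/-- Testing the equation with `χ(t) K(x - y)` produces such integrals. For fixed `x` they become
one-dimensional pairings of `χ` with the mollified function at `x`. -/
theorem integrable_cutoff_mul_torusConv (hK : Continuous K) {F : ℝ → Torus n → ℝ}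
    (hF : Integrable (fun z : ℝ × Torus n => F z.1 z.2) (ν.prod volume)) {χ : ℝ → ℝ} {C : ℝ}
    (hχ : Continuous χ) (hC : ∀ t, |χ t| ≤ C) (x : Torus n) :
    Integrable (fun t => χ t * torusConv K (F t) x) ν ∧
    ∫ z : ℝ × Torus n, F z.1 z.2 * (χ z.1 * K (x - z.2)) ∂(ν.prod volume) =
      ∫ t, χ t * torusConv K (F t) x ∂ν := by
  obtain ⟨B, hB⟩ := hK.exists_torus_bound
  have hB0 : 0 ≤ B := (abs_nonneg _).trans (hB 0)
  have h1 : Integrable (fun z : ℝ × Torus n => F z.1 z.2 * (χ z.1 * K (x - z.2)))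
      (ν.prod volume) := by
    refine hF.mul_bdd (c := C * B) ?_ (Eventually.of_forall fun z => ?_)
    · exact ((hχ.comp continuous_fst).mul
        (hK.comp (continuous_const.sub continuous_snd))).aestronglyMeasurable
    · rw [norm_mul]
      exact mul_le_mul (hC _) (hB _) (norm_nonneg _) ((abs_nonneg _).trans (hC 0))
  have h2 : ∀ t, ∫ y, F t y * (χ t * K (x - y)) = χ t * torusConv K (F t) x := by
    intro t
    rw [torusConv, ← integral_const_mul]
    exact integral_congr_ae (Eventually.of_forall fun y => by ring)
  refine ⟨?_, ?_⟩
  · simpa only [h2] using h1.integral_prod_left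
  · rw [integral_prod _ h1]
    simp only [h2]

theorem IsTimeCutoff.exists_bound {T : ℝ} {χ : ℝ → ℝ} (hχ : IsTimeCutoff T χ) :
    ∃ C, ∀ t, |χ t| ≤ C := by
  obtain ⟨hs, a, b, -, -, h0⟩ := hχ
  exact hs.continuous.bounded_above_of_compact_support
    (HasCompactSupport.intro isCompact_Icc (fun t ht => h0 t ht))

theorem IsTimeCutoff.exists_bound_deriv {T : ℝ} {χ : ℝ → ℝ} (hχ : IsTimeCutoff T χ) :
    ∃ C, ∀ t, |deriv χ t| ≤ C := by
  obtain ⟨hs, a, b, -, -, h0⟩ := hχ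
  have hc : HasCompactSupport χ := HasCompactSupport.intro isCompact_Icc (fun t ht => h0 t ht)
  exact (hs.continuous_deriv (by simp)).bounded_above_of_compact_support hc.deriv

theorem IsTimeCutoff.isTestFunction {T : ℝ} {χ : ℝ → ℝ} (hχ : IsTimeCutoff T χ)
    (hK : IsSmoothOnTorus K) : IsTestFunction T fun t x => χ t * K x where
  smooth := (hχ.1.comp contDiff_fst).mul ((isSmoothOnTorus_iff.1 hK).comp contDiff_snd)
  support := by
    obtain ⟨-, a, b, ha, hb, h0⟩ := hχ
    exact ⟨a, b, ha, hb, fun t ht x => by rw [h0 t ht, zero_mul]⟩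

end Cylinder

namespace IsHeatSolution

variable {n : ℕ} {ε T : ℝ} {w : ℝ → Torus n → ℝ} {Dw : ℝ → Torus n → Vec n}
  {R : ℝ → Torus n → ℝ}

theorem integrable_fun (h : IsHeatSolution ε T w Dw R) :
    Integrable (fun z : ℝ × Torus n => w z.1 z.2) (cylMeasure n T) :=
  h.memLp.integrable (by norm_num)

theorem integrable_grad (h : IsHeatSolution ε T w Dw R) (i : Fin n) :
    Integrable (fun z : ℝ × Torus n => Dw z.1 z.2 i) (cylMeasure n T) :=
  (h.memLp_grad.vec_apply i).integrable (by norm_num)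

theorem integrable_slice (h : IsHeatSolution ε T w Dw R) {t : ℝ} (ht : t ∈ Icc 0 T) :
    Integrable (w t) volume := (h.memLp_slice t ht).integrable (by norm_num)

theorem continuousOn_torusConv (h : IsHeatSolution ε T w Dw R) {K : Torus n → ℝ}
    (hK : Continuous K) (x : Torus n) :
    ContinuousOn (fun t => torusConv K (w t) x) (Icc 0 T) := by
  obtain ⟨B, hB⟩ := hK.exists_torus_bound
  intro t ht
  rw [ContinuousWithinAt, tendsto_iff_norm_sub_tendsto_zero]
  have hlim : Tendsto (fun s => B * (eLpNorm (w s - w t) 2 volume).toReal) (𝓝[Icc 0 T] t)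
      (𝓝 0) := by
    have := ((ENNReal.tendsto_toReal ENNReal.zero_ne_top).comp (h.continuous t ht)).const_mul B
    simpa using this
  refine squeeze_zero' (Eventually.of_forall fun _ => norm_nonneg _) ?_ hlim
  filter_upwards [self_mem_nhdsWithin] with s hs
  have hsi := h.integrable_slice hs
  have hti := h.integrable_slice ht
  have e : torusConv K (w s) x - torusConv K (w t) x = torusConv K (w s - w t) x := by
    rw [torusConv, torusConv, ← integral_sub (integrable_kernel_mul hK hsi x)
      (integrable_kernel_mul hK hti x)]
    exact integral_congr_ae (Eventually.of_forall fun y => by simp only [Pi.sub_apply]; ring)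
  rw [e]
  refine (torusConv_bound hB (hsi.sub hti) x).trans ?_
  refine mul_le_mul_of_nonneg_left ?_ ((abs_nonneg _).trans (hB 0))
  have h2 := ((h.memLp_slice s hs).sub (h.memLp_slice t ht))
  calc ∫ y, |(w s - w t) y| = (eLpNorm (w s - w t) 1 volume).toReal := by
        rw [eLpNorm_one_eq_lintegral_enorm]
        exact integral_norm_eq_lintegral_enorm (hsi.sub hti).aestronglyMeasurable
    _ ≤ _ := ENNReal.toReal_mono h2.2.ne
        (eLpNorm_le_eLpNorm_of_exponent_le (by norm_num) h2.1)

/-- The time derivative of the mollified solution. -/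
noncomputable def mollifiedDeriv (ε : ℝ) (Dw : ℝ → Torus n → Vec n) (R : ℝ → Torus n → ℝ) (N : ℕ)
    (t : ℝ) (x : Torus n) : ℝ :=
  -ε * (∑ i, torusConv (fun x => torusGrad (torusKernel n N) x i) (fun x => Dw t x i) x) +
    torusConv (torusKernel n N) (R t) x

theorem continuous_torusGrad_torusKernel (N : ℕ) (i : Fin n) :
    Continuous fun x => torusGrad (torusKernel n N) x i :=
  ((isSmoothOnTorus_torusKernel N).hasPartial i).continuous

theorem integrable_mollifiedDeriv (h : IsHeatSolution ε T w Dw R) (N : ℕ) :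
    Integrable (fun z : ℝ × Torus n => mollifiedDeriv ε Dw R N z.1 z.2) (cylMeasure n T) := by
  refine (Integrable.const_mul ?_ _).add
    (integrable_torusConv_prod (continuous_torusKernel N) h.integrable)
  exact integrable_finsetSum _ fun i _ =>
    integrable_torusConv_prod (F := fun t x => Dw t x i) (continuous_torusGrad_torusKernel N i)
      (h.integrable_grad i)

/-- For a fixed `x`, the test functions `χ(t) K(x - y)` turn the partial differential equation into
a distributional equation in `t` alone. Since the mollified `w` is continuous in time up to the
endpoints, it is a primitive of its distributional derivative on all of `[0, T]`, for every `x` and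
without an exceptional set. -/
theorem torusConv_eq_add_integral (h : IsHeatSolution ε T w Dw R) (N : ℕ) (x : Torus n) {s t : ℝ}
    (hs : 0 ≤ s) (hst : s ≤ t) (ht : t ≤ T) :
    IntegrableOn (fun τ => mollifiedDeriv ε Dw R N τ x) (Ioo 0 T) ∧
    torusConv (torusKernel n N) (w t) x = torusConv (torusKernel n N) (w s) x +
      ∫ τ in s..t, mollifiedDeriv ε Dw R N τ x := by
  set k := torusKernel n N with hk
  have hks : IsSmoothOnTorus k := isSmoothOnTorus_torusKernel N
  have hkc : Continuous k := hks.continuous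
  have hgc : ∀ i, Continuous fun x => torusGrad k x i := continuous_torusGrad_torusKernel N
  have hone : Continuous fun _ : ℝ => (1 : ℝ) := continuous_const
  have hF : IntegrableOn (fun τ => mollifiedDeriv ε Dw R N τ x) (Ioo 0 T) := by
    have h1 : ∀ i, IntegrableOn (fun τ => torusConv (fun x => torusGrad k x i)
        (fun x => Dw τ x i) x) (Ioo 0 T) := fun i => by
      simpa only [one_mul] using! (integrable_cutoff_mul_torusConv (F := fun t x => Dw t x i)
        (hgc i) (h.integrable_grad i) hone (C := 1) (by simp) x).1
    have h2 : IntegrableOn (fun τ => torusConv k (R τ) x) (Ioo 0 T) := by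
      simpa only [one_mul] using!
        (integrable_cutoff_mul_torusConv hkc h.integrable hone (C := 1) (by simp) x).1
    exact ((integrable_finsetSum _ fun i _ => h1 i).const_mul _).add h2
  refine ⟨hF, ?_⟩
  refine eq_add_integral_of_distributional_deriv (h.continuousOn_torusConv hkc x) hF ?_ hs hst ht
  intro χ hχ
  obtain ⟨C, hC⟩ := hχ.exists_bound
  obtain ⟨C', hC'⟩ := hχ.exists_bound_deriv
  have hχc : Continuous χ := hχ.1.continuous
  have hχc' : Continuous (deriv χ) := hχ.1.continuous_deriv (by simp)
  have heq := h.equation _ (hχ.isTestFunction (hks.const_sub x))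
  have e1 : ∀ z : ℝ × Torus n, w z.1 z.2 * deriv (fun s => χ s * k (x - z.2)) z.1 =
      w z.1 z.2 * (deriv χ z.1 * k (x - z.2)) := by
    intro z
    rw [deriv_mul_const ((hχ.1.differentiable (by simp)) z.1)]
  have e2 : ∀ z : ℝ × Torus n, inner ℝ (Dw z.1 z.2) (torusGrad (fun y => χ z.1 * k (x - y)) z.2) =
      ∑ i, -(Dw z.1 z.2 i * (χ z.1 * torusGrad k (x - z.2) i)) := by
    intro z
    rw [inner_vec_eq_sum]
    refine Finset.sum_congr rfl fun i _ => ?_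
    have h1 := (((hks.hasPartial i).const_sub x).hasDerivAt_zero z.2).const_mul (χ z.1)
    have h2 : torusGrad (fun y => χ z.1 * k (x - y)) z.2 i = χ z.1 * -torusGrad k (x - z.2) i :=
      h1.deriv
    rw [h2]
    ring
  have hgi := fun i => integrable_cutoff_mul_torusConv (F := fun t x => Dw t x i) (hgc i)
    (h.integrable_grad i) hχc hC x
  have hRi := integrable_cutoff_mul_torusConv hkc h.integrable hχc hC x
  have hwi := integrable_cutoff_mul_torusConv hkc h.integrable_fun hχc' hC' x
  have hgcyl : ∀ i, Integrable (fun z : ℝ × Torus n =>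
      -(Dw z.1 z.2 i * (χ z.1 * torusGrad k (x - z.2) i))) (cylMeasure n T) := by
    intro i
    obtain ⟨B, hB⟩ := (hgc i).exists_torus_bound
    refine ((h.integrable_grad i).mul_bdd (c := C * B) ?_ (Eventually.of_forall fun z => ?_)).neg
    · exact ((hχc.comp continuous_fst).mul
        ((hgc i).comp (continuous_const.sub continuous_snd))).aestronglyMeasurable
    · rw [norm_mul]
      exact mul_le_mul (hC _) (hB _) (norm_nonneg _) ((abs_nonneg _).trans (hC 0))
  simp only [e1, e2] at heq
  rw [integral_finsetSum _ fun i _ => hgcyl i] at heq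
  simp only [integral_neg, cylMeasure] at heq
  rw [hwi.2, hRi.2, Finset.sum_congr rfl fun i _ => by rw [(hgi i).2]] at heq
  have e3 : ∫ τ in Ioo 0 T, χ τ * mollifiedDeriv ε Dw R N τ x =
      ε * (∑ i, -∫ τ in Ioo 0 T, χ τ * torusConv (fun x => torusGrad k x i)
        (fun x => Dw τ x i) x) + ∫ τ in Ioo 0 T, χ τ * torusConv k (R τ) x := by
    have e4 : ∀ τ, χ τ * mollifiedDeriv ε Dw R N τ x =
        -ε * (∑ i, χ τ * torusConv (fun x => torusGrad k x i) (fun x => Dw τ x i) x) +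
          χ τ * torusConv k (R τ) x := by
      intro τ
      rw [mollifiedDeriv, mul_add, ← Finset.mul_sum]
      ring
    simp only [e4]
    rw [integral_add ((integrable_finsetSum _ fun i _ => (hgi i).1).const_mul _) hRi.1,
      integral_const_mul, integral_finsetSum _ fun i _ => (hgi i).1, Finset.sum_neg_distrib]
    ring
  rw [e3, ← add_assoc]
  exact heq

/-- At each `x` this is the chain rule for an absolutely continuous function of time. It is
integrated over `x`, the order of integration is exchanged, and the diffusion is integrated by
parts. As `R` is only integrable, `Φ'` has to be bounded. -/
theorem energy_identity_mollified (h : IsHeatSolution ε T w Dw R) {Φ Φ' Φ'' : ℝ → ℝ} {B : ℝ}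
    (hΦ : ∀ s, HasDerivAt Φ (Φ' s) s) (hΦ' : ∀ s, HasDerivAt Φ' (Φ'' s) s)
    (hΦ'' : Continuous Φ'') (hB : ∀ s, |Φ' s| ≤ B) (N : ℕ) {s t : ℝ}
    (hs : 0 ≤ s) (hst : s ≤ t) (ht : t ≤ T) :
    (∫ x, Φ (torusConv (torusKernel n N) (w t) x)) - ∫ x, Φ (torusConv (torusKernel n N) (w s) x) =
      ∫ τ in s..t, (ε * (∑ i, ∫ x, Φ'' (torusConv (torusKernel n N) (w τ) x) *
          torusConv (torusKernel n N) (fun x => Dw τ x i) x ^ 2) +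
        ∫ x, Φ' (torusConv (torusKernel n N) (w τ) x) * torusConv (torusKernel n N) (R τ) x) := by
  set k := torusKernel n N with hk
  have hkc : Continuous k := continuous_torusKernel N
  have hgc : ∀ i, Continuous fun x => torusGrad k x i := continuous_torusGrad_torusKernel N
  have hΦc : Continuous Φ := continuous_iff_continuousAt.2 fun s => (hΦ s).continuousAt
  have hΦ'c : Continuous Φ' := continuous_iff_continuousAt.2 fun s => (hΦ' s).continuousAt
  have hsI : s ∈ Icc 0 T := ⟨hs, hst.trans ht⟩
  have htI : t ∈ Icc 0 T := ⟨hs.trans hst, ht⟩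
  have hcont : ∀ τ ∈ Icc 0 T, Continuous (torusConv k (w τ)) := fun τ hτ =>
    continuous_torusConv hkc (h.integrable_slice hτ)
  have hΦi : ∀ τ ∈ Icc 0 T, Integrable (fun x => Φ (torusConv k (w τ) x)) volume := fun τ hτ =>
    (hΦc.comp (hcont τ hτ)).integrable_torus
  rw [← integral_sub (hΦi t htI) (hΦi s hsI)]
  have e1 : ∀ x, Φ (torusConv k (w t) x) - Φ (torusConv k (w s) x) =
      ∫ τ in s..t, Φ' (torusConv k (w τ) x) * mollifiedDeriv ε Dw R N τ x := by
    intro x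
    obtain ⟨hF, -⟩ := h.torusConv_eq_add_integral N x hs hst ht
    refine (integral_deriv_comp_eq_sub (y := fun τ => torusConv k (w τ) x) hst ?_
      (fun τ hτ => ?_) hΦ hB).symm
    · rw [intervalIntegrable_iff_integrableOn_Ioo_of_le hst]
      exact hF.mono_set (Ioo_subset_Ioo hs ht)
    · exact (h.torusConv_eq_add_integral N x hs hτ.1 (hτ.2.trans ht)).2
  simp only [e1]
  have hle : (volume.restrict (Ioo s t) : Measure ℝ) ≤ volume.restrict (Ioo 0 T) :=
    Measure.restrict_mono (Ioo_subset_Ioo hs ht) le_rfl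
  have hle2 : ((volume.restrict (Ioo s t)).prod (volume : Measure (Torus n))) ≤ cylMeasure n T :=
    Measure.prod_mono hle le_rfl
  have hint : Integrable (fun z : ℝ × Torus n =>
      Φ' (torusConv k (w z.1) z.2) * mollifiedDeriv ε Dw R N z.1 z.2)
      ((volume.restrict (Ioo s t)).prod volume) := by
    refine Integrable.mono_measure ?_ hle2
    refine (h.integrable_mollifiedDeriv N).bdd_mul (c := B) ?_ (Eventually.of_forall fun z => hB _)
    exact hΦ'c.comp_aestronglyMeasurable
      (integrable_torusConv_prod hkc h.integrable_fun).aestronglyMeasurable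
  simp only [intervalIntegral.integral_of_le hst, integral_Ioc_eq_integral_Ioo]
  rw [← integral_integral_swap (f := fun τ x => Φ' (torusConv k (w τ) x) *
    mollifiedDeriv ε Dw R N τ x) hint]
  refine integral_congr_ae ?_
  have hDs : ∀ᵐ τ ∂(volume.restrict (Ioo 0 T)), MemLp (Dw τ) 1 volume := by
    have h1 : Integrable (fun z : ℝ × Torus n => Dw z.1 z.2) (cylMeasure n T) :=
      h.memLp_grad.integrable (by norm_num)
    filter_upwards [h1.prod_right_ae] with τ hτ using memLp_one_iff_integrable.2 hτ
  have hae := ae_mono hle (h.weakGrad.and (hDs.and h.integrable.prod_right_ae))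
  filter_upwards [hae, ae_restrict_mem measurableSet_Ioo] with τ hτ hτm
  obtain ⟨hwg, hD1, hRi⟩ := hτ
  have hτI : τ ∈ Icc 0 T := ⟨hs.trans hτm.1.le, hτm.2.le.trans ht⟩
  have hwi := h.integrable_slice hτI
  have hc := hcont τ hτI
  have hDi : ∀ i, Integrable (fun x => Dw τ x i) volume := fun i =>
    memLp_one_iff_integrable.1 (hD1.vec_apply i)
  have hi1 : ∀ i, Integrable (fun x => Φ' (torusConv k (w τ) x) *
      torusConv (fun x => torusGrad k x i) (fun x => Dw τ x i) x) volume := fun i =>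
    ((hΦ'c.comp hc).mul (continuous_torusConv (hgc i) (hDi i))).integrable_torus
  have hi2 : Integrable (fun x => Φ' (torusConv k (w τ) x) * torusConv k (R τ) x) volume :=
    ((hΦ'c.comp hc).mul (continuous_torusConv hkc hRi)).integrable_torus
  have e2 : ∀ x, Φ' (torusConv k (w τ) x) * mollifiedDeriv ε Dw R N τ x =
      -ε * (∑ i, Φ' (torusConv k (w τ) x) *
        torusConv (fun x => torusGrad k x i) (fun x => Dw τ x i) x) +
      Φ' (torusConv k (w τ) x) * torusConv k (R τ) x := by
    intro x
    rw [mollifiedDeriv, mul_add, ← Finset.mul_sum]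
    ring
  simp only [e2]
  rw [integral_add ((integrable_finsetSum _ fun i _ => hi1 i).const_mul _) hi2,
    integral_const_mul, integral_finsetSum _ fun i _ => hi1 i]
  congr 1
  rw [neg_mul, ← mul_neg, ← Finset.sum_neg_distrib]
  congr 1
  refine Finset.sum_congr rfl fun i _ => ?_
  rw [hwg.integral_diffusion hwi hD1 hΦ' hΦ'' N i, neg_neg]

/-- The energy identity for functions with bounded first and second derivatives. -/
theorem energy_identity (h : IsHeatSolution ε T w Dw R) {Φ Φ' Φ'' : ℝ → ℝ} {B B' : ℝ}
    (hΦ : ∀ s, HasDerivAt Φ (Φ' s) s) (hΦ' : ∀ s, HasDerivAt Φ' (Φ'' s) s)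
    (hΦ'' : Continuous Φ'') (hB : ∀ s, |Φ' s| ≤ B) (hB' : ∀ s, |Φ'' s| ≤ B') {s t : ℝ}
    (hs : 0 ≤ s) (hst : s ≤ t) (ht : t ≤ T) :
    (∫ x, Φ (w t x)) - ∫ x, Φ (w s x) =
      ∫ τ in s..t, (ε * (∑ i, ∫ x, Φ'' (w τ x) * Dw τ x i ^ 2) + ∫ x, Φ' (w τ x) * R τ x) := by
  have hΦ'c : Continuous Φ' := continuous_iff_continuousAt.2 fun s => (hΦ' s).continuousAt
  have hsI : s ∈ Icc 0 T := ⟨hs, hst.trans ht⟩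
  have htI : t ∈ Icc 0 T := ⟨hs.trans hst, ht⟩
  have hB0 : 0 ≤ B := (abs_nonneg _).trans (hB 0)
  have hB'0 : 0 ≤ B' := (abs_nonneg _).trans (hB' 0)
  have hend : ∀ τ ∈ Icc 0 T, Tendsto (fun N => ∫ x, Φ (torusConv (torusKernel n N) (w τ) x)) atTop
      (𝓝 (∫ x, Φ (w τ x))) := by
    intro τ hτ
    have hwi := h.integrable_slice hτ
    refine tendsto_integral_of_tendsto_eLpNorm_one (fun N => ?_)
      (integrable_comp_of_bound_deriv hΦ hB hwi) (tendsto_eLpNorm_comp_torusConv_sub hΦ hB hwi)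
    exact integrable_comp_of_bound_deriv hΦ hB
      (continuous_torusConv (continuous_torusKernel N) hwi).integrable_torus
  have hle : (volume.restrict (Ioo s t) : Measure ℝ) ≤ volume.restrict (Ioo 0 T) :=
    Measure.restrict_mono (Ioo_subset_Ioo hs ht) le_rfl
  have hle2 : ((volume.restrict (Ioo s t)).prod (volume : Measure (Torus n))) ≤ cylMeasure n T :=
    Measure.prod_mono hle le_rfl
  have hDsq : ∀ i, Integrable (fun z : ℝ × Torus n => Dw z.1 z.2 i ^ 2) (cylMeasure n T) :=
    fun i => (h.memLp_grad.vec_apply i).integrable_sq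
  have hDs : ∀ᵐ τ ∂(volume.restrict (Ioo 0 T)), ∀ i, MemLp (fun x => Dw τ x i) 2 volume := by
    rw [ae_all_iff]
    intro i
    have h1 := (h.memLp_grad.vec_apply i).1.prodMk_left
    filter_upwards [(hDsq i).prod_right_ae, h1] with τ hτ hτ'
    exact (memLp_two_iff_integrable_sq hτ').2 hτ
  have hae := ae_mono hle (hDs.and h.integrable.prod_right_ae)
  have hlim : Tendsto (fun N => ∫ τ in s..t,
      (ε * (∑ i, ∫ x, Φ'' (torusConv (torusKernel n N) (w τ) x) *
          torusConv (torusKernel n N) (fun x => Dw τ x i) x ^ 2) +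
        ∫ x, Φ' (torusConv (torusKernel n N) (w τ) x) * torusConv (torusKernel n N) (R τ) x)) atTop
      (𝓝 (∫ τ in s..t, (ε * (∑ i, ∫ x, Φ'' (w τ x) * Dw τ x i ^ 2) +
        ∫ x, Φ' (w τ x) * R τ x))) := by
    simp only [intervalIntegral.integral_of_le hst, integral_Ioc_eq_integral_Ioo]
    -- The majorant does not depend on `N` because convolution with the kernels contracts both `L²`,
    -- for the squared gradient, and `L¹`, for `R`.
    refine tendsto_integral_of_dominated_convergence
      (fun τ => |ε| * (∑ i, B' * ∫ x, Dw τ x i ^ 2) + B * ∫ x, |R τ x|) (fun N => ?_) ?_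
      (fun N => ?_) ?_
    · refine AEStronglyMeasurable.mono_measure ?_ hle
      have hwm : AEStronglyMeasurable
          (fun z : ℝ × Torus n => torusConv (torusKernel n N) (w z.1) z.2) (cylMeasure n T) :=
        (integrable_torusConv_prod (continuous_torusKernel N) h.integrable_fun).1
      refine AEStronglyMeasurable.add (AEStronglyMeasurable.const_mul ?_ _) ?_
      · refine Finset.aestronglyMeasurable_fun_sum _ fun i _ => ?_
        refine AEStronglyMeasurable.integral_prod_right' (f := fun z : ℝ × Torus n =>
          Φ'' (torusConv (torusKernel n N) (w z.1) z.2) *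
            torusConv (torusKernel n N) (fun x => Dw z.1 x i) z.2 ^ 2) ?_
        exact (hΦ''.comp_aestronglyMeasurable hwm).mul ((integrable_torusConv_prod
          (F := fun t x => Dw t x i) (continuous_torusKernel N) (h.integrable_grad i)).1.pow 2)
      · refine AEStronglyMeasurable.integral_prod_right' (f := fun z : ℝ × Torus n =>
          Φ' (torusConv (torusKernel n N) (w z.1) z.2) *
            torusConv (torusKernel n N) (R z.1) z.2) ?_
        exact (hΦ'c.comp_aestronglyMeasurable hwm).mul (integrable_torusConv_prod
          (continuous_torusKernel N) h.integrable).1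
    · refine Integrable.mono_measure ?_ hle
      refine Integrable.add (Integrable.const_mul ?_ _) (Integrable.const_mul ?_ _)
      · exact integrable_finsetSum _ fun i _ => ((hDsq i).integral_prod_left).const_mul _
      · exact h.integrable.abs.integral_prod_left
    · filter_upwards [hae, ae_restrict_mem measurableSet_Ioo] with τ hτ hτm
      obtain ⟨hD, hRi⟩ := hτ
      have hτI : τ ∈ Icc 0 T := ⟨hs.trans hτm.1.le, hτm.2.le.trans ht⟩
      have hkc := continuous_torusKernel (n := n) N
      refine (norm_add_le _ _).trans (add_le_add ?_ ?_)
      · rw [norm_mul]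
        refine mul_le_mul_of_nonneg_left ?_ (abs_nonneg _)
        refine (norm_sum_le _ _).trans (Finset.sum_le_sum fun i _ => ?_)
        have hDi := (hD i).integrable (q := 2) (by norm_num)
        have hm := MemLp.torusConv hkc hDi 2
        have h1 : ∫ x, torusConv (torusKernel n N) (fun x => Dw τ x i) x ^ 2 ≤
            ∫ x, Dw τ x i ^ 2 := by
          have hc := ENNReal.toReal_mono (ENNReal.pow_ne_top (n := 2) (hD i).2.ne) (pow_le_pow_left'
            (eLpNorm_torusConv_le (p := 2) (by norm_num) (by norm_num) N (hD i)) 2)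
          have e : ∀ {f : Torus n → ℝ}, MemLp f 2 volume →
              (eLpNorm f 2 volume ^ 2).toReal = ∫ x, f x ^ 2 := by
            intro f hf
            have := hf.eLpNorm_eq_integral_rpow_norm (by norm_num) (by norm_num)
            rw [this, ← ENNReal.ofReal_pow (by positivity), ENNReal.toReal_ofReal (by positivity),
              ← Real.rpow_natCast, ← Real.rpow_mul (by positivity)]
            simp
          rwa [e hm, e (hD i)] at hc
        rw [← integral_const_mul]
        refine (norm_integral_le_integral_norm _).trans ?_
        calc _ ≤ ∫ x, B' * torusConv (torusKernel n N) (fun x => Dw τ x i) x ^ 2 := by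
              refine integral_mono_of_nonneg (Eventually.of_forall fun x => norm_nonneg _)
                (hm.integrable_sq.const_mul _) (Eventually.of_forall fun x => ?_)
              simp only [norm_mul, Real.norm_eq_abs, abs_of_nonneg (sq_nonneg
                (torusConv (torusKernel n N) (fun x => Dw τ x i) x))]
              exact mul_le_mul_of_nonneg_right (hB' _) (sq_nonneg _)
          _ ≤ _ := by
              rw [integral_const_mul, integral_const_mul]
              exact mul_le_mul_of_nonneg_left h1 hB'0
      · have hm := MemLp.torusConv hkc hRi 1
        have hmi := memLp_one_iff_integrable.1 hm
        have h1 : ∫ x, |torusConv (torusKernel n N) (R τ) x| ≤ ∫ x, |R τ x| := by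
          have hc := eLpNorm_torusConv_le (p := 1) le_rfl (by norm_num) N
            (memLp_one_iff_integrable.2 hRi)
          have := ENNReal.toReal_mono (memLp_one_iff_integrable.2 hRi).2.ne hc
          rw [eLpNorm_one_eq_lintegral_enorm, eLpNorm_one_eq_lintegral_enorm,
            ← integral_norm_eq_lintegral_enorm hmi.1, ← integral_norm_eq_lintegral_enorm hRi.1]
            at this
          exact this
        refine (norm_integral_le_integral_norm _).trans ?_
        calc _ ≤ ∫ x, B * |torusConv (torusKernel n N) (R τ) x| := by
              refine integral_mono_of_nonneg (Eventually.of_forall fun x => norm_nonneg _)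
                (hmi.abs.const_mul _) (Eventually.of_forall fun x => ?_)
              simp only [norm_mul, Real.norm_eq_abs]
              exact mul_le_mul_of_nonneg_right (hB _) (abs_nonneg _)
          _ ≤ _ := by
              rw [integral_const_mul]
              exact mul_le_mul_of_nonneg_left h1 hB0
    · filter_upwards [hae, ae_restrict_mem measurableSet_Ioo] with τ hτ hτm
      obtain ⟨hD, hRi⟩ := hτ
      have hτI : τ ∈ Icc 0 T := ⟨hs.trans hτm.1.le, hτm.2.le.trans ht⟩
      have hwi := h.integrable_slice hτI
      have hwm : ∀ N, AEStronglyMeasurable (torusConv (torusKernel n N) (w τ)) volume := fun N =>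
        (continuous_torusConv (continuous_torusKernel N) hwi).aestronglyMeasurable
      have hwl := tendsto_eLpNorm_torusConv_sub le_rfl ENNReal.one_ne_top
        (memLp_one_iff_integrable.2 hwi)
      refine Tendsto.add (Tendsto.const_mul _ (tendsto_finsetSum _ fun i _ => ?_)) ?_
      · have hm : ∀ N, MemLp (torusConv (torusKernel n N) (fun x => Dw τ x i)) 2 volume := fun N =>
          MemLp.torusConv (continuous_torusKernel N) ((hD i).integrable (by norm_num)) 2
        exact tendsto_integral_comp_mul hΦ'' hB' (fun N => (hm N).integrable_sq)
          (hD i).integrable_sq hwm hwi.1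
          (tendsto_eLpNorm_one_sq_sub hm (hD i)
            (tendsto_eLpNorm_torusConv_sub (by norm_num) (by norm_num) (hD i))) hwl
      · exact tendsto_integral_comp_mul hΦ'c hB
          (fun N => (continuous_torusConv (continuous_torusKernel N) hRi).integrable_torus)
          hRi hwm hwi.1 (tendsto_eLpNorm_torusConv_sub le_rfl ENNReal.one_ne_top
            (memLp_one_iff_integrable.2 hRi)) hwl
  exact tendsto_nhds_unique ((hend t htI).sub (hend s hsI)) (hlim.congr fun N =>
    (h.energy_identity_mollified hΦ hΦ' hΦ'' hB N hs hst ht).symm)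

end IsHeatSolution

/-! ### The energy inequality with drift -/

section Drift

variable {n : ℕ} {T : ℝ}

theorem integral_inner_torusGrad_kernel {V : Torus n → Vec n} (hV : ∀ i, Integrable (fun x => V x i) volume)
    {K : Torus n → ℝ} (hK : IsSmoothOnTorus K) (y : Torus n) :
    ∫ x, inner ℝ (V x) (torusGrad (fun x => K (y - x)) x) =
      -∑ i, torusConv (fun x => torusGrad K x i) (fun x => V x i) y := by
  have e : ∀ x, inner ℝ (V x) (torusGrad (fun x => K (y - x)) x) =
      ∑ i, -(torusGrad K (y - x) i * V x i) := by
    intro x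
    rw [inner_vec_eq_sum]
    refine Finset.sum_congr rfl fun i _ => ?_
    rw [((hK.hasPartial i).const_sub y).torusGrad_eq]
    ring
  have hi : ∀ i, Integrable (fun x => -(torusGrad K (y - x) i * V x i)) volume := fun i =>
    (integrable_kernel_mul (hK.hasPartial i).continuous (hV i) y).neg
  simp only [e]
  rw [integral_finsetSum _ fun i _ => hi i]
  simp only [integral_neg, Finset.sum_neg_distrib, torusConv]

/-- The distributional inequality `div V ≤ G`, on almost every time slice. -/
theorem DivLE.slice {V : ℝ → Torus n → Vec n} {G : ℝ → Torus n → ℝ} (h : DivLE T V G)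
    (hV : MemLp (fun z : ℝ × Torus n => V z.1 z.2) 2 (cylMeasure n T))
    (hG : Integrable (fun z : ℝ × Torus n => G z.1 z.2) (cylMeasure n T)) :
    ∀ᵐ t ∂(volume.restrict (Ioo 0 T)), ∀ N, ∀ᵐ y : Torus n, 0 ≤ (∫ x, inner ℝ (V t x)
      (torusGrad (fun x => torusKernel n N (y - x)) x)) + ∫ x, G t x * torusKernel n N (y - x) := by
  have hVi : ∀ i, Integrable (fun z : ℝ × Torus n => V z.1 z.2 i) (cylMeasure n T) := fun i =>
    (hV.vec_apply i).integrable (by norm_num)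
  have hVs : ∀ᵐ t ∂(volume.restrict (Ioo 0 T)), ∀ i, Integrable (fun x => V t x i) volume :=
    ae_all_iff.2 fun i => (hVi i).prod_right_ae
  rw [ae_all_iff]
  intro N
  set k := torusKernel n N with hk
  have hks : IsSmoothOnTorus k := isSmoothOnTorus_torusKernel N
  have hkc : Continuous k := hks.continuous
  have hgc : ∀ i, Continuous fun x => torusGrad k x i := fun i => (hks.hasPartial i).continuous
  set ψ : ℝ → Torus n → ℝ := fun t y =>
    -∑ i, torusConv (fun x => torusGrad k x i) (fun x => V t x i) y + torusConv k (G t) y with hψ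
  have hψi : Integrable (fun z : ℝ × Torus n => ψ z.1 z.2) (cylMeasure n T) := by
    refine Integrable.add (Integrable.neg (integrable_finsetSum _ fun i _ => ?_))
      (integrable_torusConv_prod hkc hG)
    exact integrable_torusConv_prod (F := fun t x => V t x i) (hgc i) (hVi i)
  have hone : Continuous fun _ : ℝ => (1 : ℝ) := continuous_const
  -- Testing with `χ(t) k(y - x)` for `χ ≥ 0` makes `ψ · y` a nonnegative distribution in time. The
  -- exceptional set of times still depends on `y`.
  have hy : ∀ y, ∀ᵐ t ∂(volume.restrict (Ioo 0 T)), 0 ≤ ψ t y := by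
    intro y
    refine ae_nonneg_of_forall_timeCutoff ?_ fun χ hχ hχ0 => ?_
    · refine Integrable.add (Integrable.neg (integrable_finsetSum _ fun i _ => ?_)) ?_
      · simpa only [one_mul] using! (integrable_cutoff_mul_torusConv (F := fun t x => V t x i)
          (hgc i) (hVi i) hone (C := 1) (by simp) y).1
      · simpa only [one_mul] using!
          (integrable_cutoff_mul_torusConv hkc hG hone (C := 1) (by simp) y).1
    · obtain ⟨C, hC⟩ := hχ.exists_bound
      have hχc : Continuous χ := hχ.1.continuous
      have hd := h _ (hχ.isTestFunction (hks.const_sub y))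
        fun t x => mul_nonneg (hχ0 t) (torusKernel_nonneg N _)
      have hVc := fun i => integrable_cutoff_mul_torusConv (F := fun t x => V t x i) (hgc i)
        (hVi i) hχc hC y
      have hGc := integrable_cutoff_mul_torusConv hkc hG hχc hC y
      have e2 : ∀ z : ℝ × Torus n, inner ℝ (V z.1 z.2)
          (torusGrad (fun x => χ z.1 * k (y - x)) z.2) =
          ∑ i, -(V z.1 z.2 i * (χ z.1 * torusGrad k (y - z.2) i)) := by
        intro z
        rw [inner_vec_eq_sum]
        refine Finset.sum_congr rfl fun i _ => ?_
        have h1 := (((hks.hasPartial i).const_sub y).hasDerivAt_zero z.2).const_mul (χ z.1)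
        have h2 : torusGrad (fun x => χ z.1 * k (y - x)) z.2 i =
          χ z.1 * -torusGrad k (y - z.2) i := h1.deriv
        rw [h2]
        ring
      have hgcyl : ∀ i, Integrable (fun z : ℝ × Torus n =>
          -(V z.1 z.2 i * (χ z.1 * torusGrad k (y - z.2) i))) (cylMeasure n T) := by
        intro i
        obtain ⟨B, hB⟩ := (hgc i).exists_torus_bound
        refine ((hVi i).mul_bdd (c := C * B) ?_ (Eventually.of_forall fun z => ?_)).neg
        · exact ((hχc.comp continuous_fst).mul
            ((hgc i).comp (continuous_const.sub continuous_snd))).aestronglyMeasurable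
        · rw [norm_mul]
          exact mul_le_mul (hC _) (hB _) (norm_nonneg _) ((abs_nonneg _).trans (hC 0))
      simp only [e2] at hd
      rw [integral_finsetSum _ fun i _ => hgcyl i] at hd
      simp only [integral_neg, cylMeasure] at hd
      rw [hGc.2, Finset.sum_congr rfl fun i _ => by rw [(hVc i).2]] at hd
      have e4 : ∀ τ, χ τ * ψ τ y =
          -(∑ i, χ τ * torusConv (fun x => torusGrad k x i) (fun x => V τ x i) y) +
            χ τ * torusConv k (G τ) y := by
        intro τ
        rw [hψ, mul_add, ← Finset.mul_sum]
        ring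
      simp only [e4]
      have hni : Integrable (fun τ => -∑ i, χ τ * torusConv (fun x => torusGrad k x i)
          (fun x => V τ x i) y) (volume.restrict (Ioo 0 T)) :=
        (integrable_finsetSum _ fun i _ => (hVc i).1).neg
      rw [integral_add hni hGc.1, integral_neg,
        integral_finsetSum _ fun i _ => (hVc i).1]
      rw [Finset.sum_neg_distrib] at hd
      linarith
  have hneg : AEMeasurable (fun z : ℝ × Torus n => ENNReal.ofReal (-ψ z.1 z.2))
      (cylMeasure n T) := hψi.neg.1.aemeasurable.ennreal_ofReal
  -- Tonelli for the negative part exchanges "every `y`, almost every `t`" for "almost every `t`,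
  -- almost every `y`".
  have hzero : ∫⁻ t in Ioo 0 T, ∫⁻ y, ENNReal.ofReal (-ψ t y) = 0 := by
    rw [lintegral_lintegral_swap (f := fun t y => ENNReal.ofReal (-ψ t y)) hneg]
    have : ∀ y, ∫⁻ t in Ioo 0 T, ENNReal.ofReal (-ψ t y) = 0 := by
      intro y
      rw [lintegral_congr_ae (g := fun _ => 0), lintegral_zero]
      filter_upwards [hy y] with t ht
      exact ENNReal.ofReal_of_nonpos (by linarith)
    simp only [this, lintegral_zero]
  rw [lintegral_eq_zero_iff' hneg.lintegral_prod_right'] at hzero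
  filter_upwards [hzero, hVs, hψi.prod_right_ae] with t ht hVt hψt
  simp only [Pi.zero_apply] at ht
  have hnt : AEMeasurable (fun y => ENNReal.ofReal (-ψ t y)) volume :=
    hψt.neg.1.aemeasurable.ennreal_ofReal
  rw [lintegral_eq_zero_iff' hnt] at ht
  filter_upwards [ht] with y hyt
  rw [integral_inner_torusGrad_kernel hVt hks]
  have : 0 ≤ ψ t y := by
    simp only [Pi.zero_apply, ENNReal.ofReal_eq_zero] at hyt
    linarith
  have e : ∫ x, G t x * k (y - x) = torusConv k (G t) y := by
    rw [torusConv]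
    exact integral_congr_ae (Eventually.of_forall fun x => mul_comm _ _)
  rw [e]
  exact this

end Drift

/-- The part of the cylinder between the times `s` and `t`. -/
noncomputable def slabMeasure (n : ℕ) (s t : ℝ) : Measure (ℝ × Torus n) :=
  (volume.restrict (Ioo s t)).prod volume

theorem slabMeasure_le {n : ℕ} {s t T : ℝ} (hs : 0 ≤ s) (ht : t ≤ T) :
    slabMeasure n s t ≤ cylMeasure n T :=
  Measure.prod_mono (Measure.restrict_mono (Ioo_subset_Ioo hs ht) le_rfl) le_rfl

namespace IsHeatSolution

variable {n : ℕ} {ε T : ℝ} {w : ℝ → Torus n → ℝ} {Dw : ℝ → Torus n → Vec n}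
  {R f G : ℝ → Torus n → ℝ} {V : ℝ → Torus n → Vec n}

/-- When `Φ` is bounded and nonnegative, `Φ(w)` is on almost every slice a bounded nonnegative
Sobolev function with weak gradient `Φ'(w) Dw`. Hence `drift_nonneg` bounds the drift `∫ V·Φ'(w)Dw`
from below by `-∫ Φ(w) G`, and this is inserted into the energy identity. -/
theorem energy_inequality_bounded (h : IsHeatSolution ε T w Dw R)
    (hV : MemLp (fun z : ℝ × Torus n => V z.1 z.2) 2 (cylMeasure n T))
    (hG : Integrable (fun z : ℝ × Torus n => G z.1 z.2) (cylMeasure n T))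
    (hVG : DivLE T V G)
    (hf : Integrable (fun z : ℝ × Torus n => f z.1 z.2) (cylMeasure n T))
    (hR : ∀ᵐ z ∂(cylMeasure n T), R z.1 z.2 = inner ℝ (V z.1 z.2) (Dw z.1 z.2) - f z.1 z.2)
    {Φ Φ' Φ'' : ℝ → ℝ} {B₀ B B' : ℝ}
    (hΦ : ∀ s, HasDerivAt Φ (Φ' s) s) (hΦ' : ∀ s, HasDerivAt Φ' (Φ'' s) s)
    (hΦ'' : Continuous Φ'') (h0 : ∀ s, 0 ≤ Φ s) (hB₀ : ∀ s, Φ s ≤ B₀) (hB : ∀ s, |Φ' s| ≤ B)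
    (hB' : ∀ s, |Φ'' s| ≤ B') {s t : ℝ} (hs : 0 ≤ s) (hst : s ≤ t) (ht : t ≤ T) :
    (∫ x, Φ (w s x)) + ε * ∫ z, Φ'' (w z.1 z.2) * ‖Dw z.1 z.2‖ ^ 2 ∂(slabMeasure n s t) ≤
      (∫ x, Φ (w t x)) + (∫ z, Φ (w z.1 z.2) * G z.1 z.2 ∂(slabMeasure n s t)) +
        ∫ z, |Φ' (w z.1 z.2)| * |f z.1 z.2| ∂(slabMeasure n s t) := by
  have hid := h.energy_identity hΦ hΦ' hΦ'' hB hB' hs hst ht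
  have hΦc : Continuous Φ := continuous_iff_continuousAt.2 fun s => (hΦ s).continuousAt
  have hΦ'c : Continuous Φ' := continuous_iff_continuousAt.2 fun s => (hΦ' s).continuousAt
  have hle : (volume.restrict (Ioo s t) : Measure ℝ) ≤ volume.restrict (Ioo 0 T) :=
    Measure.restrict_mono (Ioo_subset_Ioo hs ht) le_rfl
  have hle2 : slabMeasure n s t ≤ cylMeasure n T := slabMeasure_le hs ht
  have hwm : AEStronglyMeasurable (fun z : ℝ × Torus n => w z.1 z.2) (slabMeasure n s t) :=
    h.memLp.1.mono_measure hle2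
  have hDsq : Integrable (fun z : ℝ × Torus n => ‖Dw z.1 z.2‖ ^ 2) (slabMeasure n s t) :=
    ((memLp_two_iff_integrable_sq_norm h.memLp_grad.1).1 h.memLp_grad).mono_measure hle2
  have i1 : Integrable (fun z : ℝ × Torus n => Φ'' (w z.1 z.2) * ‖Dw z.1 z.2‖ ^ 2)
      (slabMeasure n s t) := hDsq.bdd_mul (c := B')
    (hΦ''.comp_aestronglyMeasurable hwm) (Eventually.of_forall fun z => hB' _)
  have i2 : Integrable (fun z : ℝ × Torus n => Φ (w z.1 z.2) * G z.1 z.2) (slabMeasure n s t) :=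
    (hG.mono_measure hle2).bdd_mul (c := B₀) (hΦc.comp_aestronglyMeasurable hwm)
      (Eventually.of_forall fun z => by rw [Real.norm_eq_abs, abs_of_nonneg (h0 _)]; exact hB₀ _)
  have i3 : Integrable (fun z : ℝ × Torus n => |Φ' (w z.1 z.2)| * |f z.1 z.2|)
      (slabMeasure n s t) := (hf.mono_measure hle2).abs.bdd_mul (c := B)
    (hΦ'c.abs.comp_aestronglyMeasurable hwm) (Eventually.of_forall fun z => by
      rw [Real.norm_eq_abs, abs_abs]; exact hB _)
  have i4 : Integrable (fun z : ℝ × Torus n => Φ' (w z.1 z.2) * R z.1 z.2)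
      (slabMeasure n s t) := (h.integrable.mono_measure hle2).bdd_mul (c := B)
    (hΦ'c.comp_aestronglyMeasurable hwm) (Eventually.of_forall fun z => hB _)
  have key : ε * (∫ z, Φ'' (w z.1 z.2) * ‖Dw z.1 z.2‖ ^ 2 ∂(slabMeasure n s t)) -
      (∫ z, Φ (w z.1 z.2) * G z.1 z.2 ∂(slabMeasure n s t)) -
      (∫ z, |Φ' (w z.1 z.2)| * |f z.1 z.2| ∂(slabMeasure n s t)) ≤
      ∫ τ in s..t, (ε * (∑ i, ∫ x, Φ'' (w τ x) * Dw τ x i ^ 2) + ∫ x, Φ' (w τ x) * R τ x) := by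
    have j12 : Integrable (fun τ => ε * (∫ x, Φ'' (w τ x) * ‖Dw τ x‖ ^ 2) -
        ∫ x, Φ (w τ x) * G τ x) (volume.restrict (Ioo s t)) :=
      (i1.integral_prod_left.const_mul _).sub i2.integral_prod_left
    have j123 : Integrable (fun τ => ε * (∫ x, Φ'' (w τ x) * ‖Dw τ x‖ ^ 2) -
        (∫ x, Φ (w τ x) * G τ x) - ∫ x, |Φ' (w τ x)| * |f τ x|) (volume.restrict (Ioo s t)) :=
      j12.sub i3.integral_prod_left
    rw [slabMeasure, integral_prod _ i1, integral_prod _ i2, integral_prod _ i3,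
      intervalIntegral.integral_of_le hst, integral_Ioc_eq_integral_Ioo, ← integral_const_mul,
      ← integral_sub (i1.integral_prod_left.const_mul _) i2.integral_prod_left,
      ← integral_sub j12 i3.integral_prod_left]
    have hDslice : ∀ᵐ τ ∂(volume.restrict (Ioo s t)),
        (∑ i, ∫ x, Φ'' (w τ x) * Dw τ x i ^ 2) = ∫ x, Φ'' (w τ x) * ‖Dw τ x‖ ^ 2 := by
      have hi : ∀ i, Integrable (fun z : ℝ × Torus n => Φ'' (w z.1 z.2) * Dw z.1 z.2 i ^ 2)
          (slabMeasure n s t) := fun i =>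
        ((h.memLp_grad.vec_apply i).integrable_sq.mono_measure hle2).bdd_mul (c := B')
          (hΦ''.comp_aestronglyMeasurable hwm) (Eventually.of_forall fun z => hB' _)
      filter_upwards [ae_all_iff.2 fun i => (hi i).prod_right_ae] with τ hτ
      rw [← integral_finsetSum _ fun i _ => hτ i]
      simp only [norm_sq_vec_eq_sum, Finset.mul_sum]
    have i5 : Integrable (fun τ => ε * (∑ i, ∫ x, Φ'' (w τ x) * Dw τ x i ^ 2) +
        ∫ x, Φ' (w τ x) * R τ x) (volume.restrict (Ioo s t)) := by
      refine Integrable.add (Integrable.const_mul ?_ _) i4.integral_prod_left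
      exact i1.integral_prod_left.congr (hDslice.mono fun τ hτ => hτ.symm)
    refine integral_mono_ae j123 i5 ?_
    have hVs : ∀ᵐ τ ∂(volume.restrict (Ioo 0 T)), MemLp (V τ) 2 volume := by
      have h1 := (memLp_two_iff_integrable_sq_norm hV.1).1 hV
      filter_upwards [h1.prod_right_ae, hV.1.prodMk_left] with τ h2 h3
      exact (memLp_two_iff_integrable_sq_norm h3).2 h2
    have hDs : ∀ᵐ τ ∂(volume.restrict (Ioo 0 T)), MemLp (Dw τ) 2 volume := by
      have h1 := (memLp_two_iff_integrable_sq_norm h.memLp_grad.1).1 h.memLp_grad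
      filter_upwards [h1.prod_right_ae, h.memLp_grad.1.prodMk_left] with τ h2 h3
      exact (memLp_two_iff_integrable_sq_norm h3).2 h2
    have hRs : ∀ᵐ τ ∂(volume.restrict (Ioo 0 T)), ∀ᵐ x : Torus n,
        R τ x = inner ℝ (V τ x) (Dw τ x) - f τ x := Measure.ae_ae_of_ae_prod hR
    filter_upwards [hDslice, ae_restrict_mem measurableSet_Ioo,
      ae_mono hle (hVs.and (hDs.and (hRs.and (h.weakGrad.and ((hVG.slice hV hG).and
        (hG.prod_right_ae.and hf.prod_right_ae))))))] with τ hτ hτm hτ'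
    obtain ⟨hVτ, hDτ, hRτ, hwg, hsl, hGτ, hfτ⟩ := hτ'
    have hτI : τ ∈ Icc 0 T := ⟨hs.trans hτm.1.le, hτm.2.le.trans ht⟩
    have hwi := h.integrable_slice hτI
    have hD1 : MemLp (Dw τ) 1 volume := hDτ.mono_exponent (by norm_num)
    have hzg := hwg.comp hwi hD1 hΦ hΦ'c hB
    have hzD : MemLp (fun x => Φ' (w τ x) • Dw τ x) 2 volume := by
      refine hDτ.of_le_mul (c := B)
        ((hΦ'c.comp_aestronglyMeasurable hwi.1).smul hDτ.1) (Eventually.of_forall fun x => ?_)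
      rw [norm_smul]
      exact mul_le_mul_of_nonneg_right (hB _) (norm_nonneg _)
    have hdr := IsWeakGradient.drift_nonneg hVτ hGτ hsl hzg
      (hΦc.comp_aestronglyMeasurable hwi.1) (fun x => h0 _) (fun x => hB₀ _) hzD
    have e1 : ∫ x, Φ' (w τ x) * R τ x =
        (∫ x, inner ℝ (V τ x) (Φ' (w τ x) • Dw τ x)) - ∫ x, Φ' (w τ x) * f τ x := by
      rw [← integral_sub]
      · refine integral_congr_ae ?_
        filter_upwards [hRτ] with x hx
        rw [hx, inner_smul_right, mul_sub]
      · refine (integrable_finsetSum Finset.univ fun i _ =>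
          (hVτ.vec_apply i).integrable_mul (hzD.vec_apply i)).congr
            (Eventually.of_forall fun x => ?_)
        simp only [inner_vec_eq_sum, Pi.mul_apply]
      · exact hfτ.bdd_mul (c := B) (hΦ'c.comp_aestronglyMeasurable hwi.1)
          (Eventually.of_forall fun x => hB _)
    have e2 : ∫ x, Φ' (w τ x) * f τ x ≤ ∫ x, |Φ' (w τ x)| * |f τ x| := by
      have h1 := norm_integral_le_integral_norm (μ := volume) fun x => Φ' (w τ x) * f τ x
      simp only [norm_mul, Real.norm_eq_abs] at h1
      exact (le_abs_self _).trans h1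
    simp only [hτ]
    linarith
  linarith

end IsHeatSolution

/-! ### Truncation by the arctangent -/

section Truncation

/-- A bounded smooth truncation of the identity at height `M`. -/
noncomputable def arctanTrunc (M s : ℝ) : ℝ := M * Real.arctan (s / M)

variable {M : ℝ}

theorem hasDerivAt_arctanTrunc (hM : 0 < M) (s : ℝ) :
    HasDerivAt (arctanTrunc M) (1 / (1 + (s / M) ^ 2)) s := by
  have := (((hasDerivAt_id s).div_const M).arctan).const_mul M
  refine this.congr_deriv ?_
  simp only [id]
  field_simp

theorem hasDerivAt_deriv_arctanTrunc (hM : 0 < M) (s : ℝ) :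
    HasDerivAt (fun s => 1 / (1 + (s / M) ^ 2)) (-(2 * (s / M) / (1 + (s / M) ^ 2) ^ 2) / M) s := by
  have h1 : (1 + (s / M) ^ 2) ≠ 0 := by positivity
  have h2 : HasDerivAt (fun s => 1 + (s / M) ^ 2) (2 * (s / M) * (1 / M)) s := by
    have := (((hasDerivAt_id s).div_const M).pow 2).const_add 1
    simpa using! this
  have := h2.inv h1
  simp only [one_div]
  refine this.congr_deriv ?_
  field_simp

theorem abs_arctan_le (x : ℝ) : |Real.arctan x| ≤ |x| := by
  have h := abs_sub_le_of_hasDerivAt_bound (β := Real.arctan) (B := 1) Real.hasDerivAt_arctan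
    (fun s => by
      rw [abs_of_nonneg (by positivity), div_le_one (by positivity)]
      nlinarith [sq_nonneg s]) x 0
  simpa using h

theorem abs_arctanTrunc_le (hM : 0 < M) (s : ℝ) : |arctanTrunc M s| ≤ |s| := by
  rw [arctanTrunc, abs_mul, abs_of_pos hM]
  calc M * |Real.arctan (s / M)| ≤ M * |s / M| := 
      mul_le_mul_of_nonneg_left (abs_arctan_le _) hM.le
    _ = |s| := by rw [abs_div, abs_of_pos hM]; field_simp

theorem abs_arctanTrunc_le_const (hM : 0 < M) (s : ℝ) : |arctanTrunc M s| ≤ 2 * M := by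
  rw [arctanTrunc, abs_mul, abs_of_pos hM]
  have h : |Real.arctan (s / M)| ≤ 2 := by
    rw [abs_le]
    constructor
    · linarith [Real.neg_pi_div_two_lt_arctan (s / M), Real.pi_le_four]
    · linarith [Real.arctan_lt_pi_div_two (s / M), Real.pi_le_four]
  nlinarith

theorem tendsto_div_natCast_add_one (s : ℝ) :
    Tendsto (fun j : ℕ => s / ((j : ℝ) + 1)) atTop (𝓝 0) := by
  simpa [div_eq_mul_inv] using (tendsto_one_div_add_atTop_nhds_zero_nat (𝕜 := ℝ)).const_mul s

/-- The truncation at height `j + 1` is the difference quotient at `0` of `r ↦ arctan (r s)` with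
increment `1/(j+1)`. -/
theorem tendsto_arctanTrunc (s : ℝ) :
    Tendsto (fun j : ℕ => arctanTrunc ((j : ℝ) + 1) s) atTop (𝓝 s) := by
  have h1 : HasDerivAt (fun r => Real.arctan (r * s)) s 0 := by
    have := ((hasDerivAt_id (0 : ℝ)).mul_const s).arctan
    simpa using this
  have h2 := h1.tendsto_slope_zero
  have h3 : Tendsto (fun j : ℕ => 1 / ((j : ℝ) + 1)) atTop (𝓝[≠] 0) :=
    tendsto_nhdsWithin_iff.2 ⟨tendsto_one_div_add_atTop_nhds_zero_nat,
      Eventually.of_forall fun j => (by positivity : (0 : ℝ) < 1 / ((j : ℝ) + 1)).ne'⟩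
  refine (h2.comp h3).congr fun j => ?_
  simp [arctanTrunc, div_eq_inv_mul]

end Truncation

namespace IsHeatSolution

variable {n : ℕ} {ε T : ℝ} {w : ℝ → Torus n → ℝ} {Dw : ℝ → Torus n → Vec n}
  {R f G : ℝ → Torus n → ℝ} {V : ℝ → Torus n → Vec n}

theorem integrable_comp_quadratic {α : Type*} [MeasurableSpace α] {μ : Measure α}
    [IsFiniteMeasure μ] {u : α → ℝ} (hu : MemLp u 2 μ) {Φ : ℝ → ℝ} (hΦ : Continuous Φ) {C : ℝ}
    (hC : ∀ s, |Φ s| ≤ C * (1 + s ^ 2)) : Integrable (fun x => Φ (u x)) μ := by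
  refine (((integrable_const (1 : ℝ)).add hu.integrable_sq).const_mul C).mono'
    (hΦ.comp_aestronglyMeasurable hu.1) (Eventually.of_forall fun x => ?_)
  exact hC _

theorem quadratic_bound {Φ Φ' Φ'' : ℝ → ℝ} {B : ℝ}
    (hΦ : ∀ s, HasDerivAt Φ (Φ' s) s) (hΦ' : ∀ s, HasDerivAt Φ' (Φ'' s) s)
    (hΦ'0 : Φ' 0 = 0) (hB : ∀ s, |Φ'' s| ≤ B) (s : ℝ) :
    |Φ' s| ≤ B * |s| ∧ |Φ s| ≤ (|Φ 0| + B) * (1 + s ^ 2) := by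
  have h1 : ∀ s, |Φ' s| ≤ B * |s| := fun s => by
    simpa [hΦ'0] using abs_sub_le_of_hasDerivAt_bound hΦ' hB s 0
  refine ⟨h1 s, ?_⟩
  have hB0 : 0 ≤ B := (abs_nonneg _).trans (hB 0)
  have h2 : |Φ s - Φ 0| ≤ B * |s| * |s - 0| := by
    refine Convex.norm_image_sub_le_of_norm_hasDerivWithin_le (f := Φ) (f' := Φ')
      (s := uIcc 0 s) (C := B * |s|)
      (fun x _ => (hΦ x).hasDerivWithinAt) (fun x hx => ?_) (convex_uIcc 0 s) left_mem_uIcc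
      right_mem_uIcc
    refine (h1 x).trans (mul_le_mul_of_nonneg_left ?_ hB0)
    simpa using abs_sub_left_of_mem_uIcc hx
  have h3 := abs_add_le (Φ s - Φ 0) (Φ 0)
  rw [sub_add_cancel] at h3
  rw [sub_zero, mul_assoc, abs_mul_abs_self] at h2
  nlinarith [abs_nonneg (Φ 0), sq_nonneg s, mul_nonneg (abs_nonneg (Φ 0)) (sq_nonneg s)]

/-- The energy inequality for even convex functions of at most quadratic growth. -/
theorem energy_inequality (h : IsHeatSolution ε T w Dw R)
    (hV : MemLp (fun z : ℝ × Torus n => V z.1 z.2) 2 (cylMeasure n T))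
    (hG : Integrable (fun z : ℝ × Torus n => G z.1 z.2) (cylMeasure n T))
    (hG0 : ∀ t x, 0 ≤ G t x) (hVG : DivLE T V G)
    (hf : Integrable (fun z : ℝ × Torus n => f z.1 z.2) (cylMeasure n T))
    (hR : ∀ᵐ z ∂(cylMeasure n T), R z.1 z.2 = inner ℝ (V z.1 z.2) (Dw z.1 z.2) - f z.1 z.2)
    {Φ Φ' Φ'' : ℝ → ℝ} {B : ℝ}
    (hΦ : ∀ s, HasDerivAt Φ (Φ' s) s) (hΦ' : ∀ s, HasDerivAt Φ' (Φ'' s) s)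
    (hΦ'' : Continuous Φ'') (h0 : ∀ s, 0 ≤ Φ s) (hΦ'0 : Φ' 0 = 0) (hB : ∀ s, |Φ'' s| ≤ B)
    (hmono : ∀ r s, |r| ≤ |s| → Φ r ≤ Φ s) (hmono' : ∀ r s, |r| ≤ |s| → |Φ' r| ≤ |Φ' s|)
    {s t : ℝ} (hs : 0 ≤ s) (hst : s ≤ t) (ht : t ≤ T)
    (hGi : Integrable (fun z : ℝ × Torus n => Φ (w z.1 z.2) * G z.1 z.2) (slabMeasure n s t))
    (hfi : Integrable (fun z : ℝ × Torus n => |Φ' (w z.1 z.2)| * |f z.1 z.2|)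
      (slabMeasure n s t)) :
    (∫ x, Φ (w s x)) + ε * ∫ z, Φ'' (w z.1 z.2) * ‖Dw z.1 z.2‖ ^ 2 ∂(slabMeasure n s t) ≤
      (∫ x, Φ (w t x)) + (∫ z, Φ (w z.1 z.2) * G z.1 z.2 ∂(slabMeasure n s t)) +
        ∫ z, |Φ' (w z.1 z.2)| * |f z.1 z.2| ∂(slabMeasure n s t) := by
  have hB0 : 0 ≤ B := (abs_nonneg _).trans (hB 0)
  have hΦc : Continuous Φ := continuous_iff_continuousAt.2 fun s => (hΦ s).continuousAt
  have hΦ'c : Continuous Φ' := continuous_iff_continuousAt.2 fun s => (hΦ' s).continuousAt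
  have hq := quadratic_bound hΦ hΦ' hΦ'0 hB
  have hle2 : slabMeasure n s t ≤ cylMeasure n T := slabMeasure_le hs ht
  have hwm : AEStronglyMeasurable (fun z : ℝ × Torus n => w z.1 z.2) (slabMeasure n s t) :=
    h.memLp.1.mono_measure hle2
  have hDsq : Integrable (fun z : ℝ × Torus n => ‖Dw z.1 z.2‖ ^ 2) (slabMeasure n s t) :=
    ((memLp_two_iff_integrable_sq_norm h.memLp_grad.1).1 h.memLp_grad).mono_measure hle2
  -- `Φ ∘ θ j` is bounded with two bounded derivatives, so the inequality for bounded functions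
  -- applies to it.
  set θ : ℕ → ℝ → ℝ := fun j => arctanTrunc ((j : ℝ) + 1) with hθ
  set θ' : ℕ → ℝ → ℝ := fun j r => 1 / (1 + (r / ((j : ℝ) + 1)) ^ 2) with hθ'
  set θ'' : ℕ → ℝ → ℝ := fun j r => -(2 * (r / ((j : ℝ) + 1)) /
    (1 + (r / ((j : ℝ) + 1)) ^ 2) ^ 2) / ((j : ℝ) + 1) with hθ''
  have hj : ∀ j : ℕ, (0 : ℝ) < (j : ℝ) + 1 := fun j => by positivity
  have hθd : ∀ j r, HasDerivAt (θ j) (θ' j r) r := fun j r => hasDerivAt_arctanTrunc (hj j) r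
  have hθd' : ∀ j r, HasDerivAt (θ' j) (θ'' j r) r := fun j r =>
    hasDerivAt_deriv_arctanTrunc (hj j) r
  have hθc : ∀ j, Continuous (θ j) := fun j =>
    continuous_iff_continuousAt.2 fun s => (hθd j s).continuousAt
  have hθc' : ∀ j, Continuous (θ' j) := fun j =>
    continuous_iff_continuousAt.2 fun s => (hθd' j s).continuousAt
  have hpos : ∀ (j : ℕ) (r : ℝ), 0 < 1 + (r / ((j : ℝ) + 1)) ^ 2 := fun j r => by positivity
  have hθc'' : ∀ j, Continuous (θ'' j) := by
    intro j
    refine Continuous.div_const (Continuous.neg (Continuous.div ?_ ?_ fun r => ?_)) _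
    · fun_prop
    · fun_prop
    · exact (pow_pos (hpos j r) 2).ne'
  have hθ'0 : ∀ j r, 0 ≤ θ' j r := fun j r => by simp only [hθ']; positivity
  have hθ'1 : ∀ j r, θ' j r ≤ 1 := fun j r => by
    simp only [hθ']
    rw [div_le_one (hpos j r)]
    nlinarith [sq_nonneg (r / ((j : ℝ) + 1))]
  have hθ''b : ∀ j r, |θ'' j r| ≤ 1 / ((j : ℝ) + 1) := by
    intro j r
    simp only [hθ'']
    rw [abs_div, abs_neg, abs_of_pos (hj j), abs_div, abs_of_pos (pow_pos (hpos j r) 2)]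
    gcongr
    rw [div_le_one (pow_pos (hpos j r) 2)]
    set x := r / ((j : ℝ) + 1)
    rw [abs_mul, abs_two]
    nlinarith [sq_nonneg (|x| - 1), sq_abs x, abs_nonneg x, sq_nonneg x]
  have hθle : ∀ j r, |θ j r| ≤ |r| := fun j r => abs_arctanTrunc_le (hj j) r
  have hθb : ∀ j r, |θ j r| ≤ 2 * ((j : ℝ) + 1) := fun j r => abs_arctanTrunc_le_const (hj j) r
  have hθl : ∀ r, Tendsto (fun j => θ j r) atTop (𝓝 r) := tendsto_arctanTrunc
  have hθ'l : ∀ r, Tendsto (fun j => θ' j r) atTop (𝓝 1) := by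
    intro r
    have h1 := ((tendsto_div_natCast_add_one r).pow 2).const_add 1
    have h2 := h1.inv₀ (by norm_num)
    simpa [hθ'] using h2
  have hθ''l : ∀ r, Tendsto (fun j => θ'' j r) atTop (𝓝 0) := fun r =>
    squeeze_zero_norm (fun j => hθ''b j r) tendsto_one_div_add_atTop_nhds_zero_nat
  have hd1 : ∀ j r, HasDerivAt (fun r => Φ (θ j r)) (Φ' (θ j r) * θ' j r) r := fun j r =>
    (hΦ (θ j r)).comp r (hθd j r)
  have hd2 : ∀ j r, HasDerivAt (fun r => Φ' (θ j r) * θ' j r)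
      (Φ'' (θ j r) * θ' j r * θ' j r + Φ' (θ j r) * θ'' j r) r := fun j r =>
    ((hΦ' (θ j r)).comp r (hθd j r)).mul (hθd' j r)
  have hb1 : ∀ j r, |Φ' (θ j r) * θ' j r| ≤ |Φ' r| := by
    intro j r
    rw [abs_mul, abs_of_nonneg (hθ'0 j r)]
    exact (mul_le_of_le_one_right (abs_nonneg _) (hθ'1 j r)).trans (hmono' _ _ (hθle j r))
  have hb1' : ∀ j r, |Φ' (θ j r) * θ' j r| ≤ B * (2 * ((j : ℝ) + 1)) := by
    intro j r
    rw [abs_mul, abs_of_nonneg (hθ'0 j r)]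
    refine (mul_le_of_le_one_right (abs_nonneg _) (hθ'1 j r)).trans ((hq _).1.trans ?_)
    exact mul_le_mul_of_nonneg_left (hθb j r) hB0
  -- The bound is uniform in `j`: `|Φ' (θ j r)|` grows at most like `2B(j+1)`, and `θ''` is at most
  -- `1/(j+1)`.
  have hb2 : ∀ j r, |Φ'' (θ j r) * θ' j r * θ' j r + Φ' (θ j r) * θ'' j r| ≤ 3 * B := by
    intro j r
    have e1 : |Φ'' (θ j r) * θ' j r * θ' j r| ≤ B := by
      rw [abs_mul, abs_mul, abs_of_nonneg (hθ'0 j r)]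
      have := mul_le_of_le_one_right (abs_nonneg (Φ'' (θ j r))) (hθ'1 j r)
      exact (mul_le_of_le_one_right (mul_nonneg (abs_nonneg _) (hθ'0 j r)) (hθ'1 j r)).trans
        (this.trans (hB _))
    have e2 : |Φ' (θ j r) * θ'' j r| ≤ 2 * B := by
      rw [abs_mul]
      calc |Φ' (θ j r)| * |θ'' j r| ≤ (B * (2 * ((j : ℝ) + 1))) * (1 / ((j : ℝ) + 1)) := by
            refine mul_le_mul ?_ (hθ''b j r) (abs_nonneg _) (by have := hj j; positivity)
            exact (hq _).1.trans (mul_le_mul_of_nonneg_left (hθb j r) hB0)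
        _ = 2 * B := by have := (hj j).ne'; field_simp
    linarith [abs_add_le (Φ'' (θ j r) * θ' j r * θ' j r) (Φ' (θ j r) * θ'' j r)]
  -- Since `|θ j r| ≤ |r|` and `θ' ≤ 1`, the monotonicity of `Φ` and `|Φ'|` replaces the truncated
  -- weight and source terms by their limits at once. Only the boundary and diffusion terms still
  -- depend on `j`.
  have hmain : ∀ j, (∫ x, Φ (θ j (w s x))) + ε * ∫ z, (Φ'' (θ j (w z.1 z.2)) *
        θ' j (w z.1 z.2) * θ' j (w z.1 z.2) + Φ' (θ j (w z.1 z.2)) * θ'' j (w z.1 z.2)) *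
        ‖Dw z.1 z.2‖ ^ 2 ∂(slabMeasure n s t) ≤
      (∫ x, Φ (θ j (w t x))) + (∫ z, Φ (w z.1 z.2) * G z.1 z.2 ∂(slabMeasure n s t)) +
        ∫ z, |Φ' (w z.1 z.2)| * |f z.1 z.2| ∂(slabMeasure n s t) := by
    intro j
    have := h.energy_inequality_bounded hV hG hVG hf hR (hd1 j) (hd2 j)
      ((((hΦ''.comp (hθc j)).mul (hθc' j)).mul (hθc' j)).add
        ((hΦ'c.comp (hθc j)).mul (hθc'' j))) (fun r => h0 _)
      (B₀ := Φ (2 * ((j : ℝ) + 1))) (fun r => hmono _ _ (by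
        rw [abs_of_pos (mul_pos two_pos (hj j))]; exact hθb j r)) (hb1' j) (hb2 j) hs hst ht
    refine this.trans ?_
    refine add_le_add (add_le_add le_rfl ?_) ?_
    · refine integral_mono_of_nonneg (Eventually.of_forall fun z => mul_nonneg (h0 _) (hG0 _ _))
        hGi (Eventually.of_forall fun z => ?_)
      exact mul_le_mul_of_nonneg_right (hmono _ _ (hθle j _)) (hG0 _ _)
    · refine integral_mono_of_nonneg (Eventually.of_forall fun z => by positivity)
        hfi (Eventually.of_forall fun z => ?_)
      exact mul_le_mul_of_nonneg_right (hb1 j _) (abs_nonneg _)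
  have hend : ∀ τ ∈ Icc 0 T, Tendsto (fun j => ∫ x, Φ (θ j (w τ x))) atTop
      (𝓝 (∫ x, Φ (w τ x))) := by
    intro τ hτ
    have hm := h.memLp_slice τ hτ
    refine tendsto_integral_of_dominated_convergence (fun x => Φ (w τ x))
      (fun j => (hΦc.comp (hθc j)).comp_aestronglyMeasurable hm.1)
      (integrable_comp_quadratic hm hΦc fun s => (hq s).2)
      (fun j => Eventually.of_forall fun x => ?_) (Eventually.of_forall fun x => ?_)
    · rw [Real.norm_eq_abs, abs_of_nonneg (h0 _)]
      exact hmono _ _ (hθle j _)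
    · exact (hΦc.tendsto _).comp (hθl _)
  have hdiff : Tendsto (fun j => ∫ z, (Φ'' (θ j (w z.1 z.2)) *
        θ' j (w z.1 z.2) * θ' j (w z.1 z.2) + Φ' (θ j (w z.1 z.2)) * θ'' j (w z.1 z.2)) *
        ‖Dw z.1 z.2‖ ^ 2 ∂(slabMeasure n s t)) atTop
      (𝓝 (∫ z, Φ'' (w z.1 z.2) * ‖Dw z.1 z.2‖ ^ 2 ∂(slabMeasure n s t))) := by
    refine tendsto_integral_of_dominated_convergence (fun z => 3 * B * ‖Dw z.1 z.2‖ ^ 2)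
      (fun j => ?_) (hDsq.const_mul _) (fun j => Eventually.of_forall fun z => ?_)
      (Eventually.of_forall fun z => ?_)
    · exact (((((hΦ''.comp (hθc j)).mul (hθc' j)).mul (hθc' j)).add
        ((hΦ'c.comp (hθc j)).mul (hθc'' j))).comp_aestronglyMeasurable hwm).mul hDsq.1
    · rw [norm_mul, norm_pow, norm_norm]
      exact mul_le_mul_of_nonneg_right (hb2 j _) (sq_nonneg _)
    · have h1 := ((((hΦ''.tendsto _).comp (hθl (w z.1 z.2))).mul (hθ'l (w z.1 z.2))).mul (hθ'l (w z.1 z.2))).add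
        (((hΦ'c.tendsto _).comp (hθl (w z.1 z.2))).mul (hθ''l (w z.1 z.2)))
      simp only [mul_one, mul_zero, add_zero] at h1
      exact h1.mul_const _
  have hsI : s ∈ Icc 0 T := ⟨hs, hst.trans ht⟩
  have htI : t ∈ Icc 0 T := ⟨hs.trans hst, ht⟩
  exact le_of_tendsto_of_tendsto' ((hend s hsI).add (hdiff.const_mul ε))
    (((hend t htI).add_const _).add_const _) hmain

end IsHeatSolution

/-! ### Fourier series on the torus -/

section Fourier

open UnitAddTorus

variable {n : ℕ}

theorem volume_unitAddCircle : (volume : Measure UnitAddCircle) = AddCircle.haarAddCircle := by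
  rw [AddCircle.volume_eq_smul_haarAddCircle]; simp

theorem volume_torus_eq_pi :
    (volume : Measure (Torus n)) = Measure.pi fun _ => AddCircle.haarAddCircle := by
  rw [volume_pi, volume_unitAddCircle]

/-- The Fourier coefficients of a function on the torus. -/
noncomputable def torusCoeff (f : Torus n → ℂ) (m : Fin n → ℤ) : ℂ := ∫ x, mFourier (-m) x * f x

theorem hasSum_sq_torusCoeff {f : Torus n → ℂ} (hf : MemLp f 2 volume) :
    HasSum (fun m => ‖torusCoeff f m‖ ^ 2) (∫ x, ‖f x‖ ^ 2) := by
  have hf' : MemLp f 2 (Measure.pi fun _ : Fin n => (AddCircle.haarAddCircle : Measure UnitAddCircle)) := by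
    rwa [← volume_torus_eq_pi]
  have h := hasSum_sq_mFourierCoeff (d := Fin n) (hf'.toLp f)
  have e1 : ∀ m, mFourierCoeff (hf'.toLp f) m = torusCoeff f m := by
    intro m
    rw [torusCoeff, volume_torus_eq_pi]
    refine integral_congr_ae ?_
    filter_upwards [hf'.coeFn_toLp] with x hx
    rw [hx, smul_eq_mul]
  have e2 : ∫ x, ‖f x‖ ^ 2 = ∫ x, ‖hf'.toLp f x‖ ^ 2
      ∂(Measure.pi fun _ : Fin n => (AddCircle.haarAddCircle : Measure UnitAddCircle)) := by
    rw [volume_torus_eq_pi]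
    refine integral_congr_ae ?_
    filter_upwards [hf'.coeFn_toLp] with x hx
    rw [hx]
  rw [e2]
  simp only [← e1]
  exact h

theorem norm_mFourier_apply (m : Fin n → ℤ) (x : Torus n) : ‖mFourier m x‖ = 1 := by
  simp only [mFourier, ContinuousMap.coe_mk, norm_prod, fourier_apply, Circle.norm_coe,
    Finset.prod_const_one]

theorem memLp_mFourier (m : Fin n → ℤ) (p : ℝ≥0∞) : MemLp (fun x : Torus n => mFourier m x) p volume :=
  MemLp.of_bound (mFourier m).continuous.aestronglyMeasurable 1
    (Eventually.of_forall fun x => (norm_mFourier_apply m x).le)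

theorem mFourier_add_single (m : Fin n → ℤ) (x : Torus n) (i : Fin n) (s : ℝ) :
    mFourier m (x + Pi.single i (s : UnitAddCircle)) =
      Complex.exp (s * (2 * Real.pi * Complex.I * m i)) * mFourier m x := by
  simp only [mFourier, ContinuousMap.coe_mk]
  rw [← Finset.mul_prod_erase _ _ (Finset.mem_univ i),
    ← Finset.mul_prod_erase _ (fun j => fourier (m j) (x j)) (Finset.mem_univ i), ← mul_assoc]
  congr 1
  · simp only [Pi.add_apply, Pi.single_eq_same]
    have : ∀ a b : UnitAddCircle, (fourier (m i) (a + b) : ℂ) = fourier (m i) b * fourier (m i) a := by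
      intro a b
      simp only [fourier_apply, smul_add, AddCircle.toCircle_add, Circle.coe_mul, mul_comm]
    rw [this, fourier_coe_apply]
    congr 2
    push_cast
    ring
  · refine Finset.prod_congr rfl fun j hj => ?_
    rw [Pi.add_apply, Pi.single_eq_of_ne (Finset.ne_of_mem_erase hj), add_zero]

/-- Translation by half a period, `1/(2 mᵢ)` in a direction with `mᵢ ≠ 0`, reverses the sign of the
character. -/
theorem integral_mFourier {m : Fin n → ℤ} (hm : m ≠ 0) : ∫ x : Torus n, mFourier m x = 0 := by
  obtain ⟨i, hi⟩ := Function.ne_iff.1 hm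
  have hi' : (m i : ℂ) ≠ 0 := by exact_mod_cast hi
  have h := integral_add_right_eq_self (μ := (volume : Measure (Torus n)))
    (fun x => mFourier m x) (Pi.single i ((1 / (2 * m i) : ℝ) : UnitAddCircle))
  simp only [mFourier_add_single] at h
  have e : ((1 / (2 * m i) : ℝ) : ℂ) * (2 * Real.pi * Complex.I * m i) = Real.pi * Complex.I := by
    push_cast
    field_simp
  rw [e, Complex.exp_pi_mul_I, integral_const_mul] at h
  linear_combination (-1 / 2 : ℂ) * h

theorem torusCoeff_mFourier (k m : Fin n → ℤ) :
    torusCoeff (fun x => mFourier k x) m = if m = k then 1 else 0 := by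
  have : torusCoeff (fun x => mFourier k x) m = ∫ x : Torus n, mFourier (-m + k) x := by
    simp only [torusCoeff, mFourier_add]
  rw [this]
  split_ifs with h
  · simp [h, mFourier_zero]
  · refine integral_mFourier fun h0 => h ?_
    rw [neg_add_eq_zero] at h0
    exact h0

theorem integrable_mFourier_mul (m : Fin n → ℤ) {f : Torus n → ℂ} (hf : Integrable f volume) :
    Integrable (fun x => mFourier m x * f x) volume :=
  hf.bdd_mul (c := 1) (mFourier m).continuous.aestronglyMeasurable
    (Eventually.of_forall fun x => (norm_mFourier_apply m x).le)

/-- The trigonometric polynomial with coefficients `c` on the finite set `S`. -/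
noncomputable def trigPoly (c : (Fin n → ℤ) → ℂ) (S : Finset (Fin n → ℤ)) (x : Torus n) : ℂ :=
  ∑ m ∈ S, c m * mFourier m x

theorem continuous_trigPoly (c : (Fin n → ℤ) → ℂ) (S : Finset (Fin n → ℤ)) :
    Continuous (trigPoly c S) := by
  unfold trigPoly
  exact continuous_finsetSum _ fun m _ => continuous_const.mul (mFourier m).continuous

theorem memLp_trigPoly (c : (Fin n → ℤ) → ℂ) (S : Finset (Fin n → ℤ)) (p : ℝ≥0∞) :
    MemLp (trigPoly c S) p volume := by
  unfold trigPoly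
  exact memLp_finsetSum _ fun m _ => (memLp_mFourier m p).const_mul _

theorem torusCoeff_trigPoly (c : (Fin n → ℤ) → ℂ) (S : Finset (Fin n → ℤ)) (m : Fin n → ℤ) :
    torusCoeff (trigPoly c S) m = if m ∈ S then c m else 0 := by
  simp only [torusCoeff, trigPoly, Finset.mul_sum]
  rw [integral_finsetSum]
  · have : ∀ k ∈ S, ∫ x, mFourier (-m) x * (c k * mFourier k x) = if m = k then c k else 0 := by
      intro k _
      have := torusCoeff_mFourier k m
      simp only [torusCoeff] at this
      simp only [mul_left_comm _ (c k)]
      rw [integral_const_mul, this]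
      simp
    rw [Finset.sum_congr rfl this, Finset.sum_ite_eq]
  · intro k _
    exact integrable_mFourier_mul _ (((memLp_mFourier k 1).const_mul _).integrable le_rfl)

theorem integral_norm_sq_trigPoly (c : (Fin n → ℤ) → ℂ) (S : Finset (Fin n → ℤ)) :
    ∫ x, ‖trigPoly c S x‖ ^ 2 = ∑ m ∈ S, ‖c m‖ ^ 2 := by
  refine (hasSum_sq_torusCoeff (memLp_trigPoly c S 2)).unique ?_
  have := hasSum_sum_of_ne_finset_zero (L := .unconditional _) (s := S)
    (f := fun m => ‖torusCoeff (trigPoly c S) m‖ ^ 2) fun m hm => by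
      simp [torusCoeff_trigPoly, hm]
  rwa [Finset.sum_congr rfl fun m hm => by rw [torusCoeff_trigPoly, if_pos hm]] at this

/-- Cauchy–Schwarz, with the number of frequencies as the price of passing from `L²` to the
supremum. On dyadic boxes this takes the place of a Sobolev embedding. -/
theorem norm_sq_trigPoly_le (c : (Fin n → ℤ) → ℂ) (S : Finset (Fin n → ℤ)) (x : Torus n) :
    ‖trigPoly c S x‖ ^ 2 ≤ S.card * ∑ m ∈ S, ‖c m‖ ^ 2 := by
  have h1 : ‖trigPoly c S x‖ ≤ ∑ m ∈ S, ‖c m‖ := by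
    refine (norm_sum_le _ _).trans_eq (Finset.sum_congr rfl fun m _ => ?_)
    rw [norm_mul, norm_mFourier_apply, mul_one]
  exact (pow_le_pow_left₀ (norm_nonneg _) h1 2).trans sq_sum_le_card_mul_sum_sq

/-- Parseval's identity for the remainder of a Fourier series. -/
theorem integral_norm_sq_sub_trigPoly {f : Torus n → ℂ} (hf : MemLp f 2 volume) (S : Finset (Fin n → ℤ)) :
    ∫ x, ‖f x - trigPoly (torusCoeff f) S x‖ ^ 2 =
      (∫ x, ‖f x‖ ^ 2) - ∑ m ∈ S, ‖torusCoeff f m‖ ^ 2 := by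
  have h := hasSum_sq_torusCoeff (hf.sub (memLp_trigPoly (torusCoeff f) S 2))
  have e : ∀ m, torusCoeff (f - trigPoly (torusCoeff f) S) m =
      torusCoeff f m - if m ∈ S then torusCoeff f m else 0 := by
    intro m
    rw [← torusCoeff_trigPoly]
    simp only [torusCoeff, Pi.sub_apply, mul_sub]
    rw [integral_sub]
    · exact integrable_mFourier_mul _ (hf.integrable one_le_two)
    · exact integrable_mFourier_mul _ ((memLp_trigPoly (torusCoeff f) S 2).integrable one_le_two)
  have h2 : HasSum (fun m => ‖torusCoeff f m‖ ^ 2 - if m ∈ S then ‖torusCoeff f m‖ ^ 2 else 0)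
      ((∫ x, ‖f x‖ ^ 2) - ∑ m ∈ S, ‖torusCoeff f m‖ ^ 2) := by
    refine (hasSum_sq_torusCoeff hf).sub ?_
    have := hasSum_sum_of_ne_finset_zero (L := .unconditional _) (s := S)
      (f := fun m => if m ∈ S then ‖torusCoeff f m‖ ^ 2 else 0) fun m hm => by simp [hm]
    rwa [Finset.sum_congr rfl fun m hm => if_pos hm] at this
  refine h.unique (h2.congr_fun fun m => ?_)
  rw [e]
  split_ifs <;> simp

theorem hasPartial_mFourier (m : Fin n → ℤ) (i : Fin n) (a : ℂ) :
    HasPartial i (fun x => (a * mFourier m x).re)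
      (fun x => (a * (2 * Real.pi * Complex.I * m i * mFourier m x)).re) where
  continuous := Complex.continuous_re.comp (continuous_const.mul
    (continuous_const.mul (mFourier m).continuous))
  hasDerivAt_zero x := by
    simp only [mFourier_add_single]
    have h1 : HasDerivAt (fun s : ℝ => (s : ℂ) * (2 * Real.pi * Complex.I * m i))
        (2 * Real.pi * Complex.I * m i) 0 := by
      simpa using (Complex.ofRealCLM.hasDerivAt (x := (0 : ℝ))).mul_const
        (2 * Real.pi * Complex.I * m i : ℂ)
    have h2 := ((h1.cexp.mul_const (mFourier m x)).const_mul a)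
    have h3 := Complex.reCLM.hasFDerivAt.comp_hasDerivAt (0 : ℝ) h2
    simpa using! h3

theorem isSmoothOnTorus_mFourier (m : Fin n → ℤ) (a : ℂ) :
    IsSmoothOnTorus fun x : Torus n => (a * mFourier m x).re := by
  have e : (fun X : Fin n → ℝ => (a * mFourier m fun i => (X i : UnitAddCircle)).re) =
      fun X => (a * ∏ i, Complex.exp (2 * Real.pi * Complex.I * m i * (X i : ℂ))).re := by
    funext X
    simp only [mFourier, ContinuousMap.coe_mk, fourier_coe_apply, Complex.ofReal_one, div_one]
  rw [IsSmoothOnTorus, e]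
  refine Complex.reCLM.contDiff.comp (contDiff_const.mul (contDiff_prod fun i _ => ?_))
  refine Complex.contDiff_exp.comp (contDiff_const.mul ?_)
  exact Complex.ofRealCLM.contDiff.comp (contDiff_apply ℝ ℝ i)

/-- The Fourier coefficients of the weak gradient. -/
theorem IsWeakGradient.torusCoeff_eq {v : Torus n → ℝ} {Dv : Torus n → Vec n}
    (h : IsWeakGradient v Dv) (hv : Integrable v volume) (hD : MemLp Dv 1 volume) (m : Fin n → ℤ)
    (i : Fin n) :
    torusCoeff (fun x => (Dv x i : ℂ)) m =
      2 * Real.pi * Complex.I * m i * torusCoeff (fun x => (v x : ℂ)) m := by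
  have hDi : Integrable (fun x => Dv x i) volume := (hD.vec_apply i).integrable le_rfl
  -- Test functions are real, so the real parts of `a e_{-m}` are used; `a = 1` and `a = -i` recover
  -- the real and imaginary parts of the coefficient.
  have key : ∀ a : ℂ, (a * torusCoeff (fun x => (Dv x i : ℂ)) m).re =
      (a * (2 * Real.pi * Complex.I * m i * torusCoeff (fun x => (v x : ℂ)) m)).re := by
    intro a
    have h0 := h _ (isSmoothOnTorus_mFourier (-m) a) i
    simp only [(hasPartial_mFourier (-m) i a).torusGrad_eq] at h0
    have e1 : (a * torusCoeff (fun x => (Dv x i : ℂ)) m).re =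
        ∫ x, Dv x i * (a * mFourier (-m) x).re := by
      rw [torusCoeff, ← integral_const_mul]
      have := integral_re (𝕜 := ℂ) (((integrable_mFourier_mul (-m) hDi.ofReal)).const_mul a)
      simp only [RCLike.re_to_complex] at this
      refine this.symm.trans (integral_congr_ae (Eventually.of_forall fun x => ?_))
      simp only [← mul_assoc]
      exact (Complex.re_mul_ofReal _ _).trans (mul_comm _ _)
    have e2 : (a * (2 * Real.pi * Complex.I * m i * torusCoeff (fun x => (v x : ℂ)) m)).re =
        -∫ x, v x * (a * (2 * Real.pi * Complex.I * (-m) i * mFourier (-m) x)).re := by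
      rw [torusCoeff, ← integral_const_mul, ← integral_const_mul, ← integral_neg]
      have := integral_re (𝕜 := ℂ) ((((integrable_mFourier_mul (-m) hv.ofReal)).const_mul
        (2 * Real.pi * Complex.I * m i)).const_mul a)
      simp only [RCLike.re_to_complex] at this
      refine this.symm.trans (integral_congr_ae (Eventually.of_forall fun x => ?_))
      simp only [← mul_assoc]
      refine (Complex.re_mul_ofReal _ _).trans ?_
      simp only [Pi.neg_apply, Int.cast_neg, mul_neg, neg_mul, Complex.neg_re,
        neg_neg]
      exact mul_comm _ _
    rw [e1, e2]
    linarith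
  have h1 := key 1
  have h2 := key (-Complex.I)
  simp only [one_mul] at h1
  refine Complex.ext h1 ?_
  simpa using h2

end Fourier

/-! ### Interpolation inequality with an `L^q` weight -/

section Interpolation

open UnitAddTorus

variable {n : ℕ}

theorem MeasureTheory.MemLp.integral_rpow_eq {α : Type*} [MeasurableSpace α] {μ : Measure α}
    {G : α → ℝ} {q : ℝ≥0∞} (hG : MemLp G q μ) (hq0 : q ≠ 0) (hq : q ≠ ⊤) (h0 : ∀ x, 0 ≤ G x) :
    ∫ x, G x ^ q.toReal ∂μ = (eLpNorm G q μ).toReal ^ q.toReal := by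
  have hqr : 0 < q.toReal := ENNReal.toReal_pos hq0 hq
  have h1 := hG.eLpNorm_eq_integral_rpow_norm hq0 hq
  have h2 : ∀ x, ‖G x‖ = G x := fun x => Real.norm_of_nonneg (h0 x)
  simp only [h2] at h1
  have h3 : 0 ≤ ∫ x, G x ^ q.toReal ∂μ := integral_nonneg fun x => Real.rpow_nonneg (h0 x) _
  rw [h1, ENNReal.toReal_ofReal (Real.rpow_nonneg h3 _), ← Real.rpow_mul h3,
    inv_mul_cancel₀ hqr.ne', Real.rpow_one]

/-- Interpolation of a weighted integral between the integral and the supremum. -/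
theorem integral_weight_mul_le {α : Type*} [MeasurableSpace α] {μ : Measure α}
    {G h : α → ℝ} {q : ℝ≥0∞} (hG : MemLp G q μ) (hq1 : 1 ≤ q) (hq : q ≠ ⊤) (hG0 : ∀ x, 0 ≤ G x)
    (hh : Integrable h μ) (hh0 : ∀ x, 0 ≤ h x) {N a : ℝ} (hN : 1 ≤ N)
    (hsup : ∀ x, h x ≤ N * a) (hint : ∫ x, h x ∂μ ≤ a) :
    ∫ x, G x * h x ∂μ ≤ 2 * (eLpNorm G q μ).toReal * N ^ q.toReal⁻¹ * a := by
  have hq0 : q ≠ 0 := (zero_lt_one.trans_le hq1).ne'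
  have hqr : 1 ≤ q.toReal := by
    simpa using (ENNReal.toReal_le_toReal ENNReal.one_ne_top hq).2 hq1
  have hN0 : 0 < N := one_pos.trans_le hN
  have ha : 0 ≤ a := (integral_nonneg hh0).trans hint
  have hI := hG.integral_rpow_eq hq0 hq hG0
  set Γ := (eLpNorm G q μ).toReal with hΓ
  -- A vanishing norm is separated because the level `l` chosen afterwards has to be positive.
  rcases (ENNReal.toReal_nonneg : 0 ≤ Γ).eq_or_lt with h0 | hpos
  · have hz : eLpNorm G q μ = 0 := by
      rcases (ENNReal.toReal_eq_zero_iff _).1 (hΓ.symm.trans h0.symm) with h | h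
      · exact h
      · exact absurd h hG.2.ne
    have hz' := (eLpNorm_eq_zero_iff hG.1 hq0).1 hz
    have : ∫ x, G x * h x ∂μ = 0 := by
      rw [← integral_zero α ℝ (μ := μ)]
      refine integral_congr_ae ?_
      filter_upwards [hz'] with x hx
      simp [hx]
    rw [this]; positivity
  -- Where `G ≤ l` the integral of `h` is used; where `G > l` one has `G ≤ l^{1-q} G^q` and uses the
  -- supremum of `h`. This level makes both contributions at most `l a`, whence the factor `2`.
  set l : ℝ := Γ * N ^ q.toReal⁻¹ with hl
  have hl0 : 0 < l := mul_pos hpos (Real.rpow_pos_of_pos hN0 _)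
  have hGq : Integrable (fun x => G x ^ q.toReal) μ := by
    have := hG.integrable_norm_rpow hq0 hq
    simpa only [Real.norm_of_nonneg (hG0 _)] using this
  have hpt : ∀ x, G x * h x ≤ l * h x + l ^ (1 - q.toReal) * (N * a) * G x ^ q.toReal := by
    intro x
    rcases le_total (G x) l with h1 | h1
    · have : 0 ≤ l ^ (1 - q.toReal) * (N * a) * G x ^ q.toReal :=
        mul_nonneg (mul_nonneg (Real.rpow_nonneg hl0.le _) (by positivity))
          (Real.rpow_nonneg (hG0 x) _)
      linarith [mul_le_mul_of_nonneg_right h1 (hh0 x)]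
    · have hGp : 0 < G x := hl0.trans_le h1
      have h2 : G x ≤ l ^ (1 - q.toReal) * G x ^ q.toReal := by
        calc G x = G x ^ (1 - q.toReal) * G x ^ q.toReal := by
              rw [← Real.rpow_add hGp, sub_add_cancel, Real.rpow_one]
          _ ≤ _ := mul_le_mul_of_nonneg_right
              (Real.rpow_le_rpow_of_nonpos hl0 h1 (by linarith)) (Real.rpow_nonneg hGp.le _)
      calc G x * h x ≤ (l ^ (1 - q.toReal) * G x ^ q.toReal) * (N * a) :=
            mul_le_mul h2 (hsup x) (hh0 x) (hGp.le.trans h2)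
        _ ≤ _ := by nlinarith [mul_nonneg hl0.le (hh0 x)]
  have hRi : Integrable (fun x => l * h x + l ^ (1 - q.toReal) * (N * a) * G x ^ q.toReal) μ :=
    (hh.const_mul _).add (hGq.const_mul _)
  have h1 : ∫ x, G x * h x ∂μ ≤ l * ∫ x, h x ∂μ + l ^ (1 - q.toReal) * (N * a) * Γ ^ q.toReal := by
    refine (integral_mono_of_nonneg (Eventually.of_forall fun x => mul_nonneg (hG0 x) (hh0 x)) hRi
      (Eventually.of_forall hpt)).trans_eq ?_
    rw [integral_add (hh.const_mul _) (hGq.const_mul _), integral_const_mul, integral_const_mul,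
      hI]
  have h2 : l ^ (1 - q.toReal) * (N * a) * Γ ^ q.toReal = l * a := by
    have e1 : l ^ q.toReal = Γ ^ q.toReal * N := by
      rw [hl, Real.mul_rpow hpos.le (Real.rpow_nonneg hN0.le _), ← Real.rpow_mul hN0.le,
        inv_mul_cancel₀ (by linarith), Real.rpow_one]
    rw [Real.rpow_sub hl0, Real.rpow_one, e1]
    have : Γ ^ q.toReal ≠ 0 := (Real.rpow_pos_of_pos hpos _).ne'
    field_simp
  calc _ ≤ l * a + l * a := by rw [h2] at h1; linarith [mul_le_mul_of_nonneg_left hint hl0.le]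
    _ = _ := by rw [hl]; ring

/-- The frequencies of size at most `2 ^ L`. -/
noncomputable def freqBox (n L : ℕ) : Finset (Fin n → ℤ) :=
  Fintype.piFinset fun _ => Finset.Icc (-(2 ^ L : ℤ)) (2 ^ L)

theorem freqBox_mono (n : ℕ) : Monotone (freqBox n) := by
  intro L M h
  have : (2 ^ L : ℤ) ≤ 2 ^ M := pow_le_pow_right₀ (by norm_num) h
  refine Fintype.piFinset_subset _ _ fun _ => Finset.Icc_subset_Icc (by linarith) this

theorem card_freqBox_le (n L : ℕ) : ((freqBox n L).card : ℝ) ≤ 2 ^ ((L + 2) * n) := by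
  have h : (freqBox n L).card = (2 * 2 ^ L + 1) ^ n := by
    rw [freqBox, Fintype.card_piFinset, Finset.prod_const, Finset.card_univ, Fintype.card_fin,
      Int.card_Icc]
    congr 1
    have : (2 ^ L + 1 - -2 ^ L : ℤ) = ((2 * 2 ^ L + 1 : ℕ) : ℤ) := by push_cast; ring
    rw [this, Int.toNat_natCast]
  rw [h, pow_mul]
  push_cast
  refine pow_le_pow_left₀ (by positivity) ?_ n
  have : (1 : ℝ) ≤ 2 ^ L := one_le_pow₀ (by norm_num)
  rw [pow_add]
  linarith

theorem tendsto_freqBox (n : ℕ) : Tendsto (freqBox n) atTop atTop := by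
  refine tendsto_atTop_finset_of_monotone (freqBox_mono n) fun m => ?_
  obtain ⟨L, hL⟩ := pow_unbounded_of_one_lt (∑ i, |m i|) (by norm_num : (1 : ℤ) < 2)
  refine ⟨L, Fintype.mem_piFinset.2 fun i => ?_⟩
  have : |m i| ≤ ∑ i, |m i| :=
    Finset.single_le_sum (f := fun i => |m i|) (fun i _ => abs_nonneg _) (Finset.mem_univ i)
  rw [Finset.mem_Icc, ← abs_le]
  linarith

variable {v : Torus n → ℝ} {Dv : Torus n → Vec n}

/-- The Fourier coefficients outside a box are controlled by the gradient. -/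
theorem IsWeakGradient.sum_sq_torusCoeff_le (h : IsWeakGradient v Dv) (hv : MemLp v 2 volume)
    (hD : MemLp Dv 2 volume) {L : ℕ} {S : Finset (Fin n → ℤ)} (hS : Disjoint S (freqBox n L)) :
    ∑ m ∈ S, ‖torusCoeff (fun x => (v x : ℂ)) m‖ ^ 2 ≤ (4 ^ L)⁻¹ * ∫ x, ‖Dv x‖ ^ 2 := by
  have h1 : ∀ i, HasSum (fun m : Fin n → ℤ =>
      (2 * Real.pi * m i) ^ 2 * ‖torusCoeff (fun x => (v x : ℂ)) m‖ ^ 2) (∫ x, Dv x i ^ 2) := by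
    intro i
    have := hasSum_sq_torusCoeff (f := fun x => (Dv x i : ℂ)) (hD.vec_apply i).ofReal
    simp only [Complex.norm_real, Real.norm_eq_abs, sq_abs, h.torusCoeff_eq
      (hv.integrable one_le_two) (hD.mono_exponent one_le_two)] at this
    refine this.congr_fun fun m => ?_
    have e : ‖(2 * Real.pi * Complex.I * m i : ℂ)‖ = |2 * Real.pi * m i| := by
      simp only [norm_mul, Complex.norm_I, Complex.norm_real, Complex.norm_intCast,
        Complex.norm_ofNat, mul_one, Real.norm_eq_abs, abs_mul, abs_two]
    rw [norm_mul, mul_pow ‖_‖, e, sq_abs]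
  have h2 : HasSum (fun m : Fin n → ℤ =>
      ∑ i, (2 * Real.pi * m i) ^ 2 * ‖torusCoeff (fun x => (v x : ℂ)) m‖ ^ 2)
      (∑ i, ∫ x, Dv x i ^ 2) := hasSum_sum fun i _ => h1 i
  have h3 : ∑ i, ∫ x, Dv x i ^ 2 = ∫ x, ‖Dv x‖ ^ 2 := by
    rw [← integral_finsetSum]
    · simp only [norm_sq_vec_eq_sum]
    · exact fun i _ => (hD.vec_apply i).integrable_sq
  rw [h3] at h2
  have h4 := sum_le_hasSum S (fun m _ => Finset.sum_nonneg fun i _ =>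
    mul_nonneg (sq_nonneg _) (sq_nonneg _)) h2
  rw [inv_mul_eq_div, le_div_iff₀ (by positivity), Finset.sum_mul]
  refine (Finset.sum_le_sum fun m hm => ?_).trans h4
  have hm' : m ∉ freqBox n L := Finset.disjoint_left.1 hS hm
  simp only [freqBox, Fintype.mem_piFinset, not_forall, Finset.mem_Icc, ← abs_le, not_le] at hm'
  obtain ⟨i, hi⟩ := hm'
  have hi' : (2 ^ L : ℝ) < |(m i : ℝ)| := by exact_mod_cast hi
  have h5 : (4 : ℝ) ^ L ≤ (2 * Real.pi * m i) ^ 2 := by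
    have e : (4 : ℝ) ^ L = (2 ^ L) ^ 2 := by rw [← pow_mul, mul_comm, pow_mul]; norm_num
    rw [e, ← sq_abs (2 * Real.pi * m i), abs_mul, abs_of_pos (by positivity : 0 < 2 * Real.pi)]
    refine pow_le_pow_left₀ (by positivity) ?_ 2
    nlinarith [Real.pi_gt_three, abs_nonneg (m i : ℝ)]
  rw [mul_comm]
  refine (mul_le_mul_of_nonneg_right h5 (sq_nonneg _)).trans ?_
  exact Finset.single_le_sum (f := fun i => (2 * Real.pi * m i) ^ 2 *
    ‖torusCoeff (fun x => (v x : ℂ)) m‖ ^ 2) (fun i _ => mul_nonneg (sq_nonneg _) (sq_nonneg _))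
    (Finset.mem_univ i)

/-- The exponent `α = n/(2q)` arises here: the `q`-th root of the number of frequencies is of order
`4^{αL}`, to be compared with the gain `4^{-L}` from the gradient. -/
theorem rpow_card_freqBox_le {q : ℝ} (hq : 0 < q) (L : ℕ) :
    (2 ^ ((L + 2) * n) : ℝ) ^ q⁻¹ = 4 ^ (n / (2 * q) * (L + 2)) := by
  have : (4 : ℝ) = 2 ^ (2 : ℝ) := by norm_num
  rw [this, ← Real.rpow_mul (by norm_num), ← Real.rpow_natCast, ← Real.rpow_mul (by norm_num)]
  congr 1
  push_cast
  field_simp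

theorem freqBox_sdiff_card_le {S : Finset (Fin n → ℤ)} {L : ℕ} (hS : S ⊆ freqBox n L) :
    (S.card : ℝ) ≤ 2 ^ ((L + 2) * n) :=
  (Nat.cast_le.2 (Finset.card_le_card hS)).trans (card_freqBox_le n L)

/-- A weighted `L²` bound for a trigonometric polynomial with frequencies in a box. -/
theorem integral_weight_trigPoly_le {G : Torus n → ℝ} {q : ℝ≥0∞} (hG : MemLp G q volume)
    (hq1 : 1 ≤ q) (hq : q ≠ ⊤) (hG0 : ∀ x, 0 ≤ G x) (c : (Fin n → ℤ) → ℂ)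
    {S : Finset (Fin n → ℤ)} {L : ℕ} (hS : S ⊆ freqBox n L) {a : ℝ} (ha : ∑ m ∈ S, ‖c m‖ ^ 2 ≤ a) :
    ∫ x, G x * ‖trigPoly c S x‖ ^ 2 ≤
      2 * (eLpNorm G q volume).toReal * 4 ^ (n / (2 * q.toReal) * ((L : ℝ) + 2)) * a := by
  have hqr : 0 < q.toReal := ENNReal.toReal_pos (zero_lt_one.trans_le hq1).ne' hq
  rw [← rpow_card_freqBox_le hqr]
  refine integral_weight_mul_le hG hq1 hq hG0
    ((memLp_trigPoly c S 2).integrable_norm_pow two_ne_zero) (fun x => sq_nonneg _)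
    (one_le_pow₀ (by norm_num)) (fun x => ?_) ?_
  · refine (norm_sq_trigPoly_le c S x).trans ?_
    exact mul_le_mul (freqBox_sdiff_card_le hS) ha
      (Finset.sum_nonneg fun _ _ => sq_nonneg _) (by positivity)
  · rw [integral_norm_sq_trigPoly]
    exact ha

theorem trigPoly_freqBox_add (c : (Fin n → ℤ) → ℂ) (J k : ℕ) (x : Torus n) :
    trigPoly c (freqBox n (J + k)) x = trigPoly c (freqBox n J) x +
      ∑ l ∈ Finset.range k, trigPoly c (freqBox n (J + l + 1) \ freqBox n (J + l)) x := by
  induction k with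
  | zero => simp
  | succ k ih =>
    rw [Finset.sum_range_succ, ← add_assoc (trigPoly c (freqBox n J) x), ← ih]
    simp only [trigPoly]
    exact (Finset.sum_sdiff (freqBox_mono n (Nat.le_succ (J + k)))).symm.trans (add_comm _ _)

theorem integrable_weight_trigPoly {G : Torus n → ℝ} (hG : Integrable G volume)
    (c : (Fin n → ℤ) → ℂ) (S : Finset (Fin n → ℤ)) :
    Integrable (fun x => G x * ‖trigPoly c S x‖ ^ 2) volume :=
  hG.mul_bdd (c := S.card * ∑ m ∈ S, ‖c m‖ ^ 2)
    ((continuous_trigPoly c S).norm.pow 2).aestronglyMeasurable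
    (Eventually.of_forall fun x => by
      rw [norm_pow, norm_norm]; exact norm_sq_trigPoly_le c S x)

theorem geom_sum_le {η : ℝ} (h0 : 0 ≤ η) (h1 : η < 1) (k : ℕ) :
    ∑ l ∈ Finset.range k, η ^ l ≤ (1 - η)⁻¹ := by
  rw [← tsum_geometric_of_lt_one h0 h1]
  exact (summable_geometric_of_lt_one h0 h1).sum_le_tsum _ fun _ _ => pow_nonneg h0 _

/-- Frequencies up to `2^J` are charged to `∫v²` at cost `4^{αJ}`. The block between `2^{J+l}` and
`2^{J+l+1}` is charged to the gradient at cost `4^{(α-1)(J+l)} = η^{2(J+l)}`. The blocks are summed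
by Cauchy–Schwarz with weights `η^l`: this consumes half of the decay in `l`, and two geometric
series bounded by `(1-η)⁻¹` remain. The estimate is uniform in `k`. -/
theorem IsWeakGradient.integral_weight_fourier_le (h : IsWeakGradient v Dv) (hv : MemLp v 2 volume)
    (hD : MemLp Dv 2 volume) {G : Torus n → ℝ} {q : ℝ≥0∞} (hG : MemLp G q volume)
    (hq1 : 1 ≤ q) (hq : q ≠ ⊤) (hG0 : ∀ x, 0 ≤ G x) {α η : ℝ} (hα : α = n / (2 * q.toReal))
    (hη : η = 2 ^ (α - 1)) (hα1 : α < 1) (J k : ℕ) :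
    ∫ x, G x * ‖trigPoly (torusCoeff fun x => (v x : ℂ)) (freqBox n (J + k)) x‖ ^ 2 ≤
      4 * (eLpNorm G q volume).toReal * (4 ^ (α * ((J : ℝ) + 2)) * (∫ x, v x ^ 2) +
        4 ^ (3 * α) * (1 - η)⁻¹ ^ 2 * η ^ (2 * J) * ∫ x, ‖Dv x‖ ^ 2) := by
  have hη0 : 0 < η := by rw [hη]; positivity
  have hη1 : η < 1 := by
    rw [hη]; exact Real.rpow_lt_one_of_one_lt_of_neg (by norm_num) (by linarith)
  have hS0 : 0 < (1 - η)⁻¹ := inv_pos.2 (by linarith)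
  have hGi : Integrable G volume := hG.integrable hq1
  set c := torusCoeff fun x => (v x : ℂ) with hc
  set Γ := (eLpNorm G q volume).toReal with hΓ
  have hΓ0 : 0 ≤ Γ := ENNReal.toReal_nonneg
  set D := ∫ x, ‖Dv x‖ ^ 2 with hDdef
  have hD0 : 0 ≤ D := integral_nonneg fun x => sq_nonneg _
  set B : ℕ → Finset (Fin n → ℤ) := fun l => freqBox n (J + l + 1) \ freqBox n (J + l) with hB
  have hlow : ∫ x, G x * ‖trigPoly c (freqBox n J) x‖ ^ 2 ≤
      2 * Γ * 4 ^ (α * ((J : ℝ) + 2)) * ∫ x, v x ^ 2 := by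
    rw [hα]
    refine integral_weight_trigPoly_le hG hq1 hq hG0 c subset_rfl ?_
    have := hasSum_sq_torusCoeff (f := fun x => (v x : ℂ)) hv.ofReal
    simp only [Complex.norm_real, Real.norm_eq_abs, sq_abs] at this
    exact sum_le_hasSum _ (fun m _ => sq_nonneg _) this
  have hhigh : ∀ l, ∫ x, G x * ‖trigPoly c (B l) x‖ ^ 2 ≤
      2 * Γ * 4 ^ (3 * α) * (η ^ (2 * J) * η ^ (2 * l)) * D := by
    intro l
    refine (integral_weight_trigPoly_le hG hq1 hq hG0 c Finset.sdiff_subset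
      (h.sum_sq_torusCoeff_le hv hD Finset.sdiff_disjoint)).trans_eq ?_
    rw [← hα]
    have e1 : (η ^ (2 * J) * η ^ (2 * l)) = 4 ^ (α * (J + l : ℕ)) * ((4 : ℝ) ^ (J + l))⁻¹ := by
      rw [← pow_add, ← mul_add, pow_mul, hη, ← Real.rpow_natCast _ 2, ← Real.rpow_mul (by norm_num),
        mul_comm (α - 1), Real.rpow_mul (by norm_num),
        show ((2 : ℝ) ^ ((2 : ℕ) : ℝ)) = 4 by norm_num, ← Real.rpow_natCast,
        ← Real.rpow_mul (by norm_num), ← Real.rpow_natCast 4, ← Real.rpow_neg (by norm_num),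
        ← Real.rpow_add (by norm_num)]
      congr 1
      ring
    -- The block lies in the box of index `J + l + 1`, and the count of that box contributes a
    -- further `2`; together they give `3α`.
    have e2 : (4 : ℝ) ^ (α * (((J + l + 1 : ℕ) : ℝ) + 2)) = 4 ^ (3 * α) * 4 ^ (α * (J + l : ℕ)) := by
      rw [← Real.rpow_add (by norm_num)]
      congr 1
      push_cast
      ring
    rw [e1, e2]
    ring
  have hpt : ∀ x, ‖trigPoly c (freqBox n (J + k)) x‖ ^ 2 ≤
      2 * ‖trigPoly c (freqBox n J) x‖ ^ 2 +
        2 * ((1 - η)⁻¹ * ∑ l ∈ Finset.range k, (η ^ l)⁻¹ * ‖trigPoly c (B l) x‖ ^ 2) := by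
    intro x
    have h1 : ‖trigPoly c (freqBox n (J + k)) x‖ ≤ ‖trigPoly c (freqBox n J) x‖ +
        ∑ l ∈ Finset.range k, ‖trigPoly c (B l) x‖ := by
      rw [trigPoly_freqBox_add]
      exact (norm_add_le _ _).trans (add_le_add le_rfl (norm_sum_le _ _))
    have h2 : (∑ l ∈ Finset.range k, ‖trigPoly c (B l) x‖) ^ 2 ≤
        (∑ l ∈ Finset.range k, η ^ l) *
          ∑ l ∈ Finset.range k, (η ^ l)⁻¹ * ‖trigPoly c (B l) x‖ ^ 2 := by
      refine Finset.sum_sq_le_sum_mul_sum_of_sq_le_mul _ (fun l _ => pow_nonneg hη0.le _)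
        (fun l _ => mul_nonneg (inv_nonneg.2 (pow_nonneg hη0.le _)) (sq_nonneg _)) fun l _ => ?_
      rw [← mul_assoc, mul_inv_cancel₀ (pow_pos hη0 _).ne', one_mul]
    have h3 := mul_le_mul_of_nonneg_right (geom_sum_le hη0.le hη1 k)
      (Finset.sum_nonneg fun l (_ : l ∈ Finset.range k) =>
        mul_nonneg (inv_nonneg.2 (pow_nonneg hη0.le l)) (sq_nonneg ‖trigPoly c (B l) x‖))
    have h4 := pow_le_pow_left₀ (norm_nonneg _) h1 2
    nlinarith [sq_nonneg (‖trigPoly c (freqBox n J) x‖ - ∑ l ∈ Finset.range k, ‖trigPoly c (B l) x‖)]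
  have hi := fun S => integrable_weight_trigPoly hGi c S
  have hsumi : Integrable (fun x => ∑ l ∈ Finset.range k,
      (η ^ l)⁻¹ * (G x * ‖trigPoly c (B l) x‖ ^ 2)) volume :=
    integrable_finsetSum _ fun l _ => (hi (B l)).const_mul _
  calc ∫ x, G x * ‖trigPoly c (freqBox n (J + k)) x‖ ^ 2
      ≤ ∫ x, (2 * (G x * ‖trigPoly c (freqBox n J) x‖ ^ 2) + 2 * (1 - η)⁻¹ *
          ∑ l ∈ Finset.range k, (η ^ l)⁻¹ * (G x * ‖trigPoly c (B l) x‖ ^ 2)) := by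
        refine integral_mono (hi _) (((hi _).const_mul 2).add (hsumi.const_mul _)) fun x => ?_
        refine (mul_le_mul_of_nonneg_left (hpt x) (hG0 x)).trans_eq ?_
        simp only [mul_add, Finset.mul_sum]
        refine congrArg₂ _ (by ring) (Finset.sum_congr rfl fun l _ => by ring)
    _ = 2 * (∫ x, G x * ‖trigPoly c (freqBox n J) x‖ ^ 2) + 2 * (1 - η)⁻¹ *
          ∑ l ∈ Finset.range k, (η ^ l)⁻¹ * ∫ x, G x * ‖trigPoly c (B l) x‖ ^ 2 := by
        rw [integral_add ((hi _).const_mul 2) (hsumi.const_mul _), integral_const_mul,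
          integral_const_mul, integral_finsetSum _ fun l _ => (hi (B l)).const_mul _]
        simp only [integral_const_mul]
    _ ≤ 2 * (2 * Γ * 4 ^ (α * ((J : ℝ) + 2)) * (∫ x, v x ^ 2)) + 2 * (1 - η)⁻¹ *
          ∑ l ∈ Finset.range k,
            (2 * Γ * 4 ^ (3 * α) * η ^ (2 * J) * D) * η ^ l := by
        refine add_le_add (mul_le_mul_of_nonneg_left hlow two_pos.le)
          (mul_le_mul_of_nonneg_left (Finset.sum_le_sum fun l _ => ?_) (by positivity))
        refine (mul_le_mul_of_nonneg_left (hhigh l) (by positivity)).trans_eq ?_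
        have : η ^ l ≠ 0 := (pow_pos hη0 _).ne'
        rw [two_mul l, pow_add]
        field_simp
    _ ≤ 2 * (2 * Γ * 4 ^ (α * ((J : ℝ) + 2)) * (∫ x, v x ^ 2)) + 2 * (1 - η)⁻¹ *
          ((2 * Γ * 4 ^ (3 * α) * η ^ (2 * J) * D) * (1 - η)⁻¹) := by
        rw [← Finset.mul_sum]
        gcongr
        exact geom_sum_le hη0.le hη1 k
    _ = _ := by ring

/-- Fatou's lemma along partial sums of the Fourier series that converge almost everywhere. The
integral is a `lintegral` because integrability of `G v²` is not known beforehand. -/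
theorem IsWeakGradient.lintegral_weight_le (h : IsWeakGradient v Dv) (hv : MemLp v 2 volume)
    (hD : MemLp Dv 2 volume) {G : Torus n → ℝ} {q : ℝ≥0∞} (hG : MemLp G q volume)
    (hq1 : 1 ≤ q) (hq : q ≠ ⊤) (hG0 : ∀ x, 0 ≤ G x) {α η : ℝ} (hα : α = n / (2 * q.toReal))
    (hη : η = 2 ^ (α - 1)) (hα1 : α < 1) (J : ℕ) :
    ∫⁻ x, ENNReal.ofReal (G x * v x ^ 2) ≤ ENNReal.ofReal (
      4 * (eLpNorm G q volume).toReal * (4 ^ (α * ((J : ℝ) + 2)) * (∫ x, v x ^ 2) +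
        4 ^ (3 * α) * (1 - η)⁻¹ ^ 2 * η ^ (2 * J) * ∫ x, ‖Dv x‖ ^ 2)) := by
  set c := torusCoeff fun x => (v x : ℂ) with hc
  set P : ℕ → Torus n → ℂ := fun k => trigPoly c (freqBox n (J + k)) with hP
  have hvc : MemLp (fun x => (v x : ℂ)) 2 volume := hv.ofReal
  have hconv : Tendsto (fun k => eLpNorm (P k - fun x => (v x : ℂ)) 2 volume) atTop (𝓝 0) := by
    have h1 : Tendsto (fun k => ∫ x, ‖(v x : ℂ) - P k x‖ ^ 2) atTop (𝓝 0) := by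
      have h2 := ((hasSum_sq_torusCoeff hvc).comp ((tendsto_freqBox n).comp
        (tendsto_add_atTop_nat J))).const_sub (∫ x, ‖(v x : ℂ)‖ ^ 2)
      rw [sub_self] at h2
      refine h2.congr fun k => ?_
      simp only [Function.comp, add_comm k J]
      exact (integral_norm_sq_sub_trigPoly hvc _).symm
    have h2 : ∀ k, eLpNorm (P k - fun x => (v x : ℂ)) 2 volume =
        ENNReal.ofReal ((∫ x, ‖(v x : ℂ) - P k x‖ ^ 2) ^ (2⁻¹ : ℝ)) := by
      intro k
      rw [eLpNorm_sub_comm]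
      have := (hvc.sub (memLp_trigPoly c (freqBox n (J + k)) 2)).eLpNorm_eq_integral_rpow_norm
        two_ne_zero ENNReal.ofNat_ne_top
      simpa using! this
    simp only [h2]
    have h3 := ENNReal.tendsto_ofReal (h1.rpow_const (p := 2⁻¹) (Or.inr (by norm_num)))
    simpa using h3
  have hmeas : TendstoInMeasure volume P atTop (fun x => (v x : ℂ)) :=
    tendstoInMeasure_of_tendsto_eLpNorm two_ne_zero
      (fun k => (memLp_trigPoly c _ 2).1) hvc.1 hconv
  obtain ⟨ns, -, hns⟩ := hmeas.exists_seq_tendsto_ae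
  have hGi := hG.integrable hq1
  calc ∫⁻ x, ENNReal.ofReal (G x * v x ^ 2)
      = ∫⁻ x, liminf (fun k => ENNReal.ofReal (G x * ‖P (ns k) x‖ ^ 2)) atTop := by
        refine lintegral_congr_ae ?_
        filter_upwards [hns] with x hx
        have h1 : Tendsto (fun k => ENNReal.ofReal (G x * ‖P (ns k) x‖ ^ 2)) atTop
            (𝓝 (ENNReal.ofReal (G x * v x ^ 2))) := by
          have := ENNReal.tendsto_ofReal ((hx.norm.pow 2).const_mul (G x))
          simpa using this
        exact h1.liminf_eq.symm
    _ ≤ liminf (fun k => ∫⁻ x, ENNReal.ofReal (G x * ‖P (ns k) x‖ ^ 2)) atTop :=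
        lintegral_liminf_le' fun k =>
          (integrable_weight_trigPoly hGi c _).1.aemeasurable.ennreal_ofReal
    _ ≤ _ := by
        refine liminf_le_of_le (by isBoundedDefault) fun b hb => ?_
        obtain ⟨k, hk⟩ := hb.exists
        refine hk.trans ?_
        rw [← ofReal_integral_eq_lintegral_ofReal (integrable_weight_trigPoly hGi c _)
          (Eventually.of_forall fun x => mul_nonneg (hG0 x) (sq_nonneg _))]
        exact ENNReal.ofReal_le_ofReal
          (h.integral_weight_fourier_le hv hD hG hq1 hq hG0 hα hη hα1 J (ns k))

/-- Smallness of the gradient term asks for `2^J ≥ Y = (cΓ/δ)^{1/(2(1-α))}`. At the least such scale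
the low frequencies cost about `Γ · 4^{αJ} ≈ Γ^{1 + α/(1-α)} = Γ^{1/(1-α)}`, up to a power of `c/δ`.
The maximum of `Y` with `1` covers small `Γ`. -/
theorem exists_dyadic_scale {α η c δ Γ : ℝ} (hα0 : 0 ≤ α) (hα1 : α < 1) (hη : η = 2 ^ (α - 1))
    (hc : 0 < c) (hδ : 0 < δ) (hΓ : 0 ≤ Γ) :
    ∃ J : ℕ, Γ * c * η ^ (2 * J) ≤ δ ∧ Γ * 4 ^ (α * ((J : ℝ) + 2)) ≤
      4 ^ (3 * α) * (1 + (c / δ) ^ (α / (1 - α))) * (1 + Γ ^ (1 - α)⁻¹) := by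
  have h1α : 0 < 1 - α := by linarith
  set Y : ℝ := (c * Γ / δ) ^ (2 * (1 - α))⁻¹ with hY
  have hY0 : 0 ≤ Y := by positivity
  set X : ℝ := max 1 Y with hX
  have hX1 : 1 ≤ X := le_max_left _ _
  have hX0 : 0 < X := one_pos.trans_le hX1
  -- With `J = j + 1` one has `X ≤ 2^J ≤ 2X`: the lower bound gives smallness, the upper one
  -- controls the cost.
  obtain ⟨j, hj1, hj2⟩ := exists_nat_pow_near hX1 (by norm_num : (1 : ℝ) < 2)
  have hJ1 : X ≤ 2 ^ (j + 1) := hj2.le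
  have hJ2 : (2 : ℝ) ^ (j + 1) ≤ 2 * X := by rw [pow_succ]; linarith
  have hpow0 : (0 : ℝ) < 2 ^ (j + 1) := by positivity
  refine ⟨j + 1, ?_, ?_⟩
  · have e1 : η ^ (2 * (j + 1)) = ((2 ^ (j + 1) : ℝ) ^ (2 * (1 - α)))⁻¹ := by
      rw [hη, ← Real.rpow_natCast _ (2 * (j + 1)), ← Real.rpow_mul (by norm_num),
        ← Real.rpow_natCast 2, ← Real.rpow_mul (by norm_num), ← Real.rpow_neg (by norm_num)]
      congr 1
      push_cast
      ring
    have h2 : c * Γ / δ ≤ (2 ^ (j + 1) : ℝ) ^ (2 * (1 - α)) := by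
      calc c * Γ / δ = Y ^ (2 * (1 - α)) := by
            rw [hY, ← Real.rpow_mul (by positivity), inv_mul_cancel₀ (by linarith), Real.rpow_one]
        _ ≤ _ := Real.rpow_le_rpow hY0 ((le_max_right _ _).trans hJ1) (by linarith)
    rw [e1, ← div_eq_mul_inv, div_le_iff₀ (Real.rpow_pos_of_pos hpow0 _)]
    rw [div_le_iff₀ hδ] at h2
    linarith
  · have e1 : (4 : ℝ) ^ (α * (((j + 1 : ℕ) : ℝ) + 2)) = 4 ^ (2 * α) * (2 ^ (j + 1)) ^ (2 * α) := by
      have h4 : (4 : ℝ) = 2 ^ (2 : ℝ) := by norm_num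
      rw [h4, ← Real.rpow_natCast 2, ← Real.rpow_mul (by norm_num), ← Real.rpow_mul (by norm_num),
        ← Real.rpow_mul (by norm_num), ← Real.rpow_add (by norm_num)]
      congr 1
      push_cast
      ring
    have h2 : ((2 : ℝ) ^ (j + 1)) ^ (2 * α) ≤ 4 ^ α * X ^ (2 * α) := by
      refine (Real.rpow_le_rpow hpow0.le hJ2 (by linarith)).trans_eq ?_
      rw [Real.mul_rpow (by norm_num) hX0.le, Real.rpow_mul (by norm_num)]
      norm_num
    have hYp : Y ^ (2 * α) = (c / δ) ^ (α / (1 - α)) * Γ ^ (α / (1 - α)) := by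
      rw [hY, ← Real.rpow_mul (by positivity), mul_div_right_comm,
        Real.mul_rpow (by positivity) hΓ]
      have : (2 * (1 - α))⁻¹ * (2 * α) = α / (1 - α) := by field_simp
      rw [this]
    have h3 : X ^ (2 * α) ≤ 1 + Y ^ (2 * α) := by
      rcases le_total 1 Y with h | h
      · rw [hX, max_eq_right h]; linarith
      · rw [hX, max_eq_left h, Real.one_rpow]
        linarith [Real.rpow_nonneg hY0 (2 * α)]
    have h5 : Γ * Γ ^ (α / (1 - α)) = Γ ^ (1 - α)⁻¹ := by
      rcases hΓ.eq_or_lt with h | h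
      · rw [← h, zero_mul, Real.zero_rpow (inv_ne_zero h1α.ne')]
      · nth_rewrite 1 [← Real.rpow_one Γ]
        rw [← Real.rpow_add h]
        congr 1
        field_simp
        ring
    have h6 : Γ ≤ 1 + Γ ^ (1 - α)⁻¹ := by
      rcases le_total Γ 1 with h | h
      · linarith [Real.rpow_nonneg hΓ (1 - α)⁻¹]
      · have : Γ ^ (1 : ℝ) ≤ Γ ^ (1 - α)⁻¹ := by
          refine Real.rpow_le_rpow_of_exponent_le h ?_
          rw [one_le_inv₀ h1α]; linarith
        rw [Real.rpow_one] at this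
        linarith
    have h7 : 0 ≤ (c / δ) ^ (α / (1 - α)) := by positivity
    have h8 : (4 : ℝ) ^ (3 * α) = 4 ^ (2 * α) * 4 ^ α := by
      rw [← Real.rpow_add (by norm_num)]; congr 1; ring
    calc Γ * 4 ^ (α * (((j + 1 : ℕ) : ℝ) + 2)) ≤
          Γ * (4 ^ (2 * α) * (4 ^ α * (1 + Y ^ (2 * α)))) := by
          rw [e1]
          gcongr
          exact h2.trans (mul_le_mul_of_nonneg_left h3 (by positivity))
      _ = 4 ^ (3 * α) * (Γ + (c / δ) ^ (α / (1 - α)) * Γ ^ (1 - α)⁻¹) := by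
          rw [hYp, h8, ← h5]; ring
      _ ≤ 4 ^ (3 * α) * ((1 + (c / δ) ^ (α / (1 - α))) * (1 + Γ ^ (1 - α)⁻¹)) := by
          gcongr
          nlinarith [Real.rpow_nonneg hΓ (1 - α)⁻¹]
      _ = _ := by ring

/-- An `L^q` weight with `q > n / 2` is form bounded with respect to the gradient, with relative
bound zero. -/
theorem exists_weight_interpolation {q : ℝ≥0∞} (hq1 : 1 ≤ q) {α : ℝ} (hα : α = n / (2 * q.toReal))
    (hα1 : α < 1) {δ : ℝ} (hδ : 0 < δ) :
    ∃ C : ℝ, 0 ≤ C ∧ ∀ (G v : Torus n → ℝ) (Dv : Torus n → Vec n), (∀ x, 0 ≤ G x) →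
      MemLp G q volume → MemLp v 2 volume → MemLp Dv 2 volume → IsWeakGradient v Dv →
      ∫⁻ x, ENNReal.ofReal (G x * v x ^ 2) ≤ ENNReal.ofReal (δ * (∫ x, ‖Dv x‖ ^ 2) +
        C * (1 + (eLpNorm G q volume).toReal ^ (1 - α)⁻¹) * ∫ x, v x ^ 2) := by
  rcases eq_or_ne q ⊤ with rfl | hq
  · refine ⟨1, zero_le_one, fun G v Dv hG0 hG hv hD h => ?_⟩
    -- `(⊤ : ℝ≥0∞).toReal = 0` and division by zero give `α = 0`, which is the correct value of
    -- `n/(2q)` at `q = ∞`.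
    have hα0 : α = 0 := by rw [hα]; simp
    set Γ := (eLpNorm G ⊤ volume).toReal with hΓ
    have hb : ∀ᵐ x, G x ≤ Γ := by
      filter_upwards [ae_le_eLpNormEssSup (f := G) (μ := volume)] with x hx
      rw [← eLpNorm_exponent_top] at hx
      have := ENNReal.toReal_mono hG.2.ne hx
      rw [toReal_enorm] at this
      exact (le_abs_self _).trans this
    calc ∫⁻ x, ENNReal.ofReal (G x * v x ^ 2) ≤ ∫⁻ x, ENNReal.ofReal (Γ * v x ^ 2) := by
          refine lintegral_mono_ae ?_
          filter_upwards [hb] with x hx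
          exact ENNReal.ofReal_le_ofReal (mul_le_mul_of_nonneg_right hx (sq_nonneg _))
      _ = ENNReal.ofReal (Γ * ∫ x, v x ^ 2) := by
          rw [← ofReal_integral_eq_lintegral_ofReal (hv.integrable_sq.const_mul Γ)
            (Eventually.of_forall fun x => mul_nonneg ENNReal.toReal_nonneg (sq_nonneg _)),
            integral_const_mul]
      _ ≤ _ := by
          refine ENNReal.ofReal_le_ofReal ?_
          have h1 : 0 ≤ ∫ x, ‖Dv x‖ ^ 2 := integral_nonneg fun x => sq_nonneg _
          have h2 : 0 ≤ ∫ x, v x ^ 2 := integral_nonneg fun x => sq_nonneg _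
          rw [hα0]
          simp only [sub_zero, inv_one, Real.rpow_one, one_mul]
          nlinarith [mul_nonneg hδ.le h1]
  · have hqr : 0 < q.toReal := ENNReal.toReal_pos (zero_lt_one.trans_le hq1).ne' hq
    have hα0 : 0 ≤ α := by rw [hα]; positivity
    set η : ℝ := 2 ^ (α - 1) with hη
    have hη1 : η < 1 := Real.rpow_lt_one_of_one_lt_of_neg (by norm_num) (by linarith)
    have hη2 : 0 < 1 - η := by linarith
    set c : ℝ := 4 * (4 ^ (3 * α) * (1 - η)⁻¹ ^ 2) with hc
    have hc0 : 0 < c := by positivity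
    refine ⟨4 * (4 ^ (3 * α) * (1 + (c / δ) ^ (α / (1 - α)))), by positivity,
      fun G v Dv hG0 hG hv hD h => ?_⟩
    obtain ⟨J, hJ1, hJ2⟩ := exists_dyadic_scale hα0 hα1 hη hc0 hδ
      (ENNReal.toReal_nonneg (a := eLpNorm G q volume))
    refine (h.lintegral_weight_le hv hD hG hq1 hq hG0 hα hη hα1 J).trans
      (ENNReal.ofReal_le_ofReal ?_)
    have h1 : 0 ≤ ∫ x, ‖Dv x‖ ^ 2 := integral_nonneg fun x => sq_nonneg _
    have h2 : 0 ≤ ∫ x, v x ^ 2 := integral_nonneg fun x => sq_nonneg _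
    have h3 := mul_le_mul_of_nonneg_right hJ1 h1
    have h4 := mul_le_mul_of_nonneg_right hJ2 h2
    rw [hc] at h3
    linarith

end Interpolation

/-! ### Smooth convex approximations of `|s| ^ p` -/

/-- An even convex function of at most quadratic growth that behaves like `|s| ^ p`, together with
its first two derivatives. -/
structure IsEnergyProfile (p A B : ℝ) (Φ Φ' Φ'' : ℝ → ℝ) : Prop where
  pos : ∀ s, 0 < Φ s
  hasDerivAt : ∀ s, HasDerivAt Φ (Φ' s) s
  hasDerivAt' : ∀ s, HasDerivAt Φ' (Φ'' s) s
  continuous'' : Continuous Φ''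
  deriv_zero : Φ' 0 = 0
  nonneg'' : ∀ s, 0 ≤ Φ'' s
  bound : ∀ s, |Φ'' s| ≤ B
  mono : ∀ r s, |r| ≤ |s| → Φ r ≤ Φ s
  mono' : ∀ r s, |r| ≤ |s| → |Φ' r| ≤ |Φ' s|
  sq_deriv_le : ∀ s, Φ' s ^ 2 ≤ A * (Φ s * Φ'' s)
  abs_deriv_le : ∀ s, |Φ' s| ≤ A * Φ s ^ (1 - 1 / p)

theorem le_of_even_of_monotoneOn {F : ℝ → ℝ} (he : ∀ s, F (-s) = F s) (hm : MonotoneOn F (Ici 0))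
    {r s : ℝ} (h : |r| ≤ |s|) : F r ≤ F s := by
  have ha : ∀ x, F |x| = F x := fun x => by
    rcases abs_cases x with ⟨h, _⟩ | ⟨h, _⟩ <;> rw [h]
    exact he x
  rw [← ha r, ← ha s]
  exact hm (abs_nonneg r) (abs_nonneg s) h

theorem monotoneOn_Ici_of_hasDerivAt {F F' : ℝ → ℝ} (h : ∀ s, HasDerivAt F (F' s) s)
    (h0 : ∀ s, 0 ≤ s → 0 ≤ F' s) : MonotoneOn F (Ici 0) := by
  refine monotoneOn_of_deriv_nonneg (convex_Ici 0)
    (fun s _ => (h s).continuousAt.continuousWithinAt)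
    (fun s _ => (h s).differentiableAt.differentiableWithinAt) fun s hs => ?_
  rw [interior_Ici] at hs
  rw [(h s).deriv]
  exact h0 s (le_of_lt hs)

/-- The function `y ^ b (1 + κ y) ^ (1 - b)` of `y = s ^ 2 + δ`. -/
noncomputable def powProfile (b κ δ s : ℝ) : ℝ :=
  (s ^ 2 + δ) ^ b * (1 + κ * (s ^ 2 + δ)) ^ (1 - b)

/-- The derivative of `powProfile`. -/
noncomputable def powProfile' (b κ δ s : ℝ) : ℝ :=
  2 * s * (b + κ * (s ^ 2 + δ)) * ((s ^ 2 + δ) ^ (b - 1) * (1 + κ * (s ^ 2 + δ)) ^ (-b))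

/-- The second derivative of `powProfile`. -/
noncomputable def powProfile'' (b κ δ s : ℝ) : ℝ :=
  2 * (b + κ * (s ^ 2 + δ)) * ((s ^ 2 + δ) ^ (b - 1) * (1 + κ * (s ^ 2 + δ)) ^ (-b)) +
    4 * s ^ 2 * (b * (b - 1)) * ((s ^ 2 + δ) ^ (b - 2) * (1 + κ * (s ^ 2 + δ)) ^ (-b - 1))

section Profile

variable {b κ δ : ℝ}

theorem hasDerivAt_powProfile (hδ : 0 < δ) (hκ : 0 ≤ κ) (s : ℝ) :
    HasDerivAt (powProfile b κ δ) (powProfile' b κ δ s) s := by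
  have hy : 0 < s ^ 2 + δ := by positivity
  have hz : 0 < 1 + κ * (s ^ 2 + δ) := by positivity
  have h1 : HasDerivAt (fun s : ℝ => s ^ 2 + δ) (2 * s) s := by
    simpa using! (hasDerivAt_pow 2 s).add_const δ
  have h2 : HasDerivAt (fun s : ℝ => 1 + κ * (s ^ 2 + δ)) (κ * (2 * s)) s :=
    (h1.const_mul κ).const_add 1
  refine ((h1.rpow_const (p := b) (Or.inl hy.ne')).mul
    (h2.rpow_const (p := 1 - b) (Or.inl hz.ne'))).congr_deriv ?_
  rw [powProfile']
  have e1 : (s ^ 2 + δ) ^ b = (s ^ 2 + δ) ^ (b - 1) * (s ^ 2 + δ) := by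
    rw [← Real.rpow_add_one hy.ne']; ring_nf
  have e2 : (1 + κ * (s ^ 2 + δ)) ^ (1 - b) =
      (1 + κ * (s ^ 2 + δ)) ^ (-b) * (1 + κ * (s ^ 2 + δ)) := by
    rw [← Real.rpow_add_one hz.ne']; ring_nf
  rw [e1, e2, show 1 - b - 1 = -b by ring]
  ring

theorem hasDerivAt_powProfile' (hδ : 0 < δ) (hκ : 0 ≤ κ) (s : ℝ) :
    HasDerivAt (powProfile' b κ δ) (powProfile'' b κ δ s) s := by
  have hy : 0 < s ^ 2 + δ := by positivity
  have hz : 0 < 1 + κ * (s ^ 2 + δ) := by positivity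
  have h1 : HasDerivAt (fun s : ℝ => s ^ 2 + δ) (2 * s) s := by
    simpa using! (hasDerivAt_pow 2 s).add_const δ
  have h2 : HasDerivAt (fun s : ℝ => 1 + κ * (s ^ 2 + δ)) (κ * (2 * s)) s :=
    (h1.const_mul κ).const_add 1
  have h3 : HasDerivAt (fun s : ℝ => 2 * s * (b + κ * (s ^ 2 + δ)))
      (2 * (b + κ * (s ^ 2 + δ)) + 2 * s * (κ * (2 * s))) s := by
    simpa using! ((hasDerivAt_id s).const_mul 2).mul ((h1.const_mul κ).const_add b)
  refine (h3.mul ((h1.rpow_const (p := b - 1) (Or.inl hy.ne')).mul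
    (h2.rpow_const (p := -b) (Or.inl hz.ne')))).congr_deriv ?_
  rw [powProfile'']
  have e1 : (s ^ 2 + δ) ^ (b - 1) = (s ^ 2 + δ) ^ (b - 2) * (s ^ 2 + δ) := by
    rw [← Real.rpow_add_one hy.ne']; ring_nf
  have e2 : (1 + κ * (s ^ 2 + δ)) ^ (-b) =
      (1 + κ * (s ^ 2 + δ)) ^ (-b - 1) * (1 + κ * (s ^ 2 + δ)) := by
    rw [← Real.rpow_add_one hz.ne']; ring_nf
  simp only [Pi.mul_apply]
  rw [show b - 1 - 1 = b - 2 by ring, e1, e2]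
  ring

theorem continuous_powProfile'' (hδ : 0 < δ) (hκ : 0 ≤ κ) : Continuous (powProfile'' b κ δ) := by
  have hy : ∀ s : ℝ, s ^ 2 + δ ≠ 0 := fun s => by positivity
  have hz : ∀ s : ℝ, 1 + κ * (s ^ 2 + δ) ≠ 0 := fun s => by positivity
  have c1 : Continuous fun s : ℝ => s ^ 2 + δ := by fun_prop
  have c2 : Continuous fun s : ℝ => 1 + κ * (s ^ 2 + δ) := by fun_prop
  have r1 : ∀ e : ℝ, Continuous fun s : ℝ => (s ^ 2 + δ) ^ e := fun e =>
    c1.rpow_const fun s => Or.inl (hy s)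
  have r2 : ∀ e : ℝ, Continuous fun s : ℝ => (1 + κ * (s ^ 2 + δ)) ^ e := fun e =>
    c2.rpow_const fun s => Or.inl (hz s)
  unfold powProfile''
  exact ((by fun_prop : Continuous fun s : ℝ => 2 * (b + κ * (s ^ 2 + δ))).mul
    ((r1 _).mul (r2 _))).add ((by fun_prop : Continuous fun s : ℝ => 4 * s ^ 2 * (b * (b - 1))).mul
    ((r1 _).mul (r2 _)))

/-- Normal form with the factor `P = y^{b-1}(1+κy)^{1-b}`, where `y = s² + δ`. The function is `P
y`, its first derivative is of order at most `|s| P` and the second is comparable to `P`, so that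
the inequalities of an energy profile reduce to comparisons of bounded ratios. -/
theorem powProfile_eq (hδ : 0 < δ) (s : ℝ) :
    powProfile b κ δ s =
      ((s ^ 2 + δ) ^ (b - 1) * (1 + κ * (s ^ 2 + δ)) ^ (1 - b)) * (s ^ 2 + δ) := by
  have hy : 0 < s ^ 2 + δ := by positivity
  rw [powProfile, mul_right_comm, ← Real.rpow_add_one hy.ne', sub_add_cancel]

theorem powProfile'_eq (hδ : 0 < δ) (hκ : 0 ≤ κ) (s : ℝ) :
    powProfile' b κ δ s = 2 * s * ((b + κ * (s ^ 2 + δ)) / (1 + κ * (s ^ 2 + δ))) *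
      ((s ^ 2 + δ) ^ (b - 1) * (1 + κ * (s ^ 2 + δ)) ^ (1 - b)) := by
  have hz : 0 < 1 + κ * (s ^ 2 + δ) := by positivity
  rw [powProfile', show 1 - b = -b + 1 by ring, Real.rpow_add_one hz.ne']
  field_simp

theorem powProfile''_eq (hδ : 0 < δ) (hκ : 0 ≤ κ) (s : ℝ) :
    powProfile'' b κ δ s = (2 * ((b + κ * (s ^ 2 + δ)) / (1 + κ * (s ^ 2 + δ))) +
      4 * (b * (b - 1)) * (s ^ 2 / (s ^ 2 + δ) * (1 / (1 + κ * (s ^ 2 + δ)) ^ 2))) *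
      ((s ^ 2 + δ) ^ (b - 1) * (1 + κ * (s ^ 2 + δ)) ^ (1 - b)) := by
  have hy : 0 < s ^ 2 + δ := by positivity
  have hz : 0 < 1 + κ * (s ^ 2 + δ) := by positivity
  have e1 : (s ^ 2 + δ) ^ (b - 1) = (s ^ 2 + δ) ^ (b - 2) * (s ^ 2 + δ) := by
    rw [← Real.rpow_add_one hy.ne']; ring_nf
  have e2 : (1 + κ * (s ^ 2 + δ)) ^ (-b) =
      (1 + κ * (s ^ 2 + δ)) ^ (-b - 1) * (1 + κ * (s ^ 2 + δ)) := by
    rw [← Real.rpow_add_one hz.ne']; ring_nf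
  have e3 : (1 + κ * (s ^ 2 + δ)) ^ (1 - b) =
      (1 + κ * (s ^ 2 + δ)) ^ (-b) * (1 + κ * (s ^ 2 + δ)) := by
    rw [← Real.rpow_add_one hz.ne']; ring_nf
  rw [powProfile'', e3, e2, e1]
  field_simp

theorem powProfile_ratio_le (hb : 0 < b) (hκ : 0 ≤ κ) {y : ℝ} (hy : 0 < y) :
    0 ≤ (b + κ * y) / (1 + κ * y) ∧ (b + κ * y) / (1 + κ * y) ≤ 1 + b := by
  have hz : 0 ≤ κ * y := by positivity
  refine ⟨by positivity, ?_⟩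
  rw [div_le_iff₀ (by linarith)]
  nlinarith

/-- For `b ≥ 1` the term with `b(b-1)` is nonnegative and the other ratio is at least `1`. For `b <
1` the choice `κ = 0` leaves `2b - 4b(1-b)s²/y ≥ 2b(2b-1)`, which is positive because `b > 1/2`,
that is, `p > 1`. -/
theorem powProfile''_lower (hb : 1 / 2 < b) (hδ : 0 < δ) (hκ : 0 ≤ κ) (hκb : b < 1 → κ = 0)
    (s : ℝ) : min 2 (2 * b * (2 * b - 1)) *
      ((s ^ 2 + δ) ^ (b - 1) * (1 + κ * (s ^ 2 + δ)) ^ (1 - b)) ≤ powProfile'' b κ δ s := by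
  rw [powProfile''_eq hδ hκ]
  have hy : 0 < s ^ 2 + δ := by positivity
  have hz : 0 < 1 + κ * (s ^ 2 + δ) := by positivity
  refine mul_le_mul_of_nonneg_right ?_ (by positivity)
  rcases lt_or_ge b 1 with h | h
  · refine (min_le_right _ _).trans ?_
    rw [hκb h]
    have : s ^ 2 / (s ^ 2 + δ) ≤ 1 := by rw [div_le_one hy]; linarith
    simp only [zero_mul, add_zero, div_one, one_pow, mul_one]
    nlinarith [mul_nonneg (by linarith : 0 ≤ b) (by linarith : 0 ≤ 1 - b)]
  · refine (min_le_left _ _).trans ?_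
    have h1 : 1 ≤ (b + κ * (s ^ 2 + δ)) / (1 + κ * (s ^ 2 + δ)) := by
      rw [one_le_div hz]; linarith
    have h2 : 0 ≤ 4 * (b * (b - 1)) *
        (s ^ 2 / (s ^ 2 + δ) * (1 / (1 + κ * (s ^ 2 + δ)) ^ 2)) :=
      mul_nonneg (by nlinarith) (by positivity)
    linarith

theorem powProfile''_upper (hb : 1 / 2 < b) (hδ : 0 < δ) (hκ : 0 ≤ κ) (s : ℝ) :
    |powProfile'' b κ δ s| ≤ (2 * (1 + b) + 4 * |b * (b - 1)|) *
      ((s ^ 2 + δ) ^ (b - 1) * (1 + κ * (s ^ 2 + δ)) ^ (1 - b)) := by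
  have hy : 0 < s ^ 2 + δ := by positivity
  have hz : 1 ≤ 1 + κ * (s ^ 2 + δ) := by
    have : 0 ≤ κ * (s ^ 2 + δ) := by positivity
    linarith
  have hz0 : 0 < 1 + κ * (s ^ 2 + δ) := by linarith
  rw [powProfile''_eq hδ hκ, abs_mul]
  rw [abs_of_nonneg (by positivity :
    0 ≤ (s ^ 2 + δ) ^ (b - 1) * (1 + κ * (s ^ 2 + δ)) ^ (1 - b))]
  refine mul_le_mul_of_nonneg_right ?_ (by positivity)
  obtain ⟨h1, h2⟩ := powProfile_ratio_le (by linarith) hκ hy (b := b)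
  have h3 : s ^ 2 / (s ^ 2 + δ) * (1 / (1 + κ * (s ^ 2 + δ)) ^ 2) ≤ 1 := by
    refine mul_le_one₀ (by rw [div_le_one hy]; linarith) (by positivity) ?_
    rw [div_le_one (by positivity)]
    exact one_le_pow₀ hz
  refine (abs_add_le _ _).trans (add_le_add ?_ ?_)
  · rw [abs_of_nonneg (by linarith)]; linarith
  · rw [abs_mul, abs_mul, abs_of_nonneg (by positivity : (0 : ℝ) ≤ 4), mul_assoc]
    refine mul_le_mul_of_nonneg_left ?_ (by norm_num)
    rw [abs_of_nonneg (by positivity :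
      0 ≤ s ^ 2 / (s ^ 2 + δ) * (1 / (1 + κ * (s ^ 2 + δ)) ^ 2))]
    exact mul_le_of_le_one_right (abs_nonneg _) h3

/-- For `b < 1` the bound comes from `y ≥ δ`, for `b > 1` from `y/(1+κy) ≤ 1/κ`. It may degenerate
as the parameters tend to `0`, which is harmless: it enters only the bound `B` on `Φ''`, on which
the final constants do not depend. -/
theorem exists_bound_powProfile (hδ : 0 < δ) (hκb : b < 1 → κ = 0)
    (hκb' : 1 < b → 0 < κ) : ∃ Q : ℝ, 0 ≤ Q ∧ ∀ s : ℝ,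
      (s ^ 2 + δ) ^ (b - 1) * (1 + κ * (s ^ 2 + δ)) ^ (1 - b) ≤ Q := by
  rcases lt_trichotomy b 1 with h | h | h
  · refine ⟨δ ^ (b - 1), by positivity, fun s => ?_⟩
    rw [hκb h]
    simp only [zero_mul, add_zero, Real.one_rpow, mul_one]
    exact Real.rpow_le_rpow_of_nonpos hδ (by nlinarith [sq_nonneg s]) (by linarith)
  · exact ⟨1, zero_le_one, fun s => by simp [h]⟩
  · have hκ0 := hκb' h
    refine ⟨(κ⁻¹) ^ (b - 1), by positivity, fun s => ?_⟩
    have hy : 0 < s ^ 2 + δ := by positivity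
    have hz : 0 < 1 + κ * (s ^ 2 + δ) := by positivity
    rw [show 1 - b = -(b - 1) by ring, Real.rpow_neg hz.le, ← div_eq_mul_inv,
      ← Real.div_rpow hy.le hz.le]
    refine Real.rpow_le_rpow (by positivity) ?_ (by linarith)
    rw [div_le_iff₀ hz, inv_mul_eq_div, le_div_iff₀ hκ0]
    linarith

/-- `δ > 0` makes the profile smooth and positive at `0`. For `p > 2` the parameter `κ > 0` reduces
the growth at infinity to quadratic; for `p < 2` the growth is already subquadratic and `κ = 0`
preserves convexity. With the factor `P` of the normal form, `Φ'² ≤ 4(1+b)² s² P²` and `ΦΦ'' ≥ c y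
P²`, so the constant `A` is free of `δ` and `κ`. -/
theorem isEnergyProfile_powProfile {p : ℝ} (hp : 1 < p) (hb : b = p / 2) (hδ : 0 < δ) (hκ : 0 ≤ κ)
    (hκb : b < 1 → κ = 0) (hκb' : 1 < b → 0 < κ) :
    ∃ B, IsEnergyProfile p (2 * (1 + b) + 4 * (1 + b) ^ 2 / min 2 (2 * b * (2 * b - 1))) B
      (powProfile b κ δ) (powProfile' b κ δ) (powProfile'' b κ δ) := by
  have hb2 : 1 / 2 < b := by rw [hb]; linarith
  have hb0 : 0 < b := by linarith
  have hc0 : 0 < min 2 (2 * b * (2 * b - 1)) :=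
    lt_min two_pos (mul_pos (by linarith) (by linarith))
  set c := min 2 (2 * b * (2 * b - 1)) with hc
  obtain ⟨Q, hQ0, hQ⟩ := exists_bound_powProfile hδ hκb hκb'
  have hy : ∀ s : ℝ, 0 < s ^ 2 + δ := fun s => by positivity
  have hz : ∀ s : ℝ, 0 < 1 + κ * (s ^ 2 + δ) := fun s => by have := hy s; positivity
  have hP : ∀ s : ℝ, 0 < (s ^ 2 + δ) ^ (b - 1) * (1 + κ * (s ^ 2 + δ)) ^ (1 - b) := fun s =>
    mul_pos (Real.rpow_pos_of_pos (hy s) _) (Real.rpow_pos_of_pos (hz s) _)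
  have hpos'' : ∀ s, 0 ≤ powProfile'' b κ δ s := fun s =>
    (mul_nonneg hc0.le (hP s).le).trans (powProfile''_lower hb2 hδ hκ hκb s)
  have hd0 : powProfile' b κ δ 0 = 0 := by simp [powProfile']
  have hm' : MonotoneOn (powProfile' b κ δ) (Ici 0) :=
    monotoneOn_Ici_of_hasDerivAt (hasDerivAt_powProfile' hδ hκ) fun s _ => hpos'' s
  have hn' : ∀ s, 0 ≤ s → 0 ≤ powProfile' b κ δ s := fun s hs => by
    have := hm' self_mem_Ici hs hs
    rwa [hd0] at this
  have habs : ∀ s, |powProfile' b κ δ s| ≤ 2 * |s| * (1 + b) *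
      ((s ^ 2 + δ) ^ (b - 1) * (1 + κ * (s ^ 2 + δ)) ^ (1 - b)) := by
    intro s
    obtain ⟨h1, h2⟩ := powProfile_ratio_le hb0 hκ (hy s) (b := b)
    rw [powProfile'_eq hδ hκ, abs_mul, abs_mul, abs_mul, abs_two, abs_of_pos (hP s),
      abs_of_nonneg h1]
    gcongr
  have hA1 : 0 ≤ 4 * (1 + b) ^ 2 / c := by positivity
  refine ⟨(2 * (1 + b) + 4 * |b * (b - 1)|) * Q, ?_, hasDerivAt_powProfile hδ hκ,
    hasDerivAt_powProfile' hδ hκ, continuous_powProfile'' hδ hκ, hd0, hpos'', fun s => ?_,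
    fun r s => ?_, fun r s => ?_, fun s => ?_, fun s => ?_⟩
  · intro s
    rw [powProfile_eq hδ]
    exact mul_pos (hP s) (hy s)
  · refine (powProfile''_upper hb2 hδ hκ s).trans (mul_le_mul_of_nonneg_left (hQ s) ?_)
    positivity
  · refine le_of_even_of_monotoneOn (fun s => by simp [powProfile]) ?_
    exact monotoneOn_Ici_of_hasDerivAt (hasDerivAt_powProfile hδ hκ) hn'
  · refine le_of_even_of_monotoneOn (F := fun s => |powProfile' b κ δ s|)
      (fun s => by simp [powProfile']) fun s hs t ht hst => ?_
    simp only [abs_of_nonneg (hn' s hs), abs_of_nonneg (hn' t ht)]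
    exact hm' hs ht hst
  · have h1 := pow_le_pow_left₀ (abs_nonneg _) (habs s) 2
    rw [sq_abs] at h1
    have h2 := powProfile''_lower hb2 hδ hκ hκb s
    rw [powProfile_eq hδ]
    set P := (s ^ 2 + δ) ^ (b - 1) * (1 + κ * (s ^ 2 + δ)) ^ (1 - b) with hPdef
    have hP' : 0 < P := hP s
    have h3 : (2 * |s| * (1 + b) * P) ^ 2 ≤ 4 * (1 + b) ^ 2 / c * (P * (s ^ 2 + δ) * (c * P)) := by
      have : 4 * (1 + b) ^ 2 / c * (P * (s ^ 2 + δ) * (c * P)) =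
          (2 * (1 + b) * P) ^ 2 * (s ^ 2 + δ) := by field_simp; ring
      rw [this]
      have e : (2 * |s| * (1 + b) * P) ^ 2 = (2 * (1 + b) * P) ^ 2 * s ^ 2 := by
        rw [← sq_abs s]; ring
      rw [e]
      gcongr
      linarith
    have h4 : 4 * (1 + b) ^ 2 / c * (P * (s ^ 2 + δ) * (c * P)) ≤
        (2 * (1 + b) + 4 * (1 + b) ^ 2 / c) * (P * (s ^ 2 + δ) * powProfile'' b κ δ s) := by
      have := hy s
      refine mul_le_mul (by linarith) (mul_le_mul_of_nonneg_left h2 (by positivity))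
        (by positivity) (by positivity)
    exact h1.trans (h3.trans h4)
  · have hΦy : powProfile b κ δ s ≤ (s ^ 2 + δ) ^ b := by
      rw [powProfile]
      refine mul_le_of_le_one_right (Real.rpow_nonneg (hy s).le _) ?_
      rcases lt_or_ge b 1 with h | h
      · rw [hκb h]; simp
      · refine Real.rpow_le_one_of_one_le_of_nonpos ?_ (by linarith)
        have := hy s
        have : 0 ≤ κ * (s ^ 2 + δ) := by positivity
        linarith
    have hΦ0 : 0 < powProfile b κ δ s := by
      rw [powProfile_eq hδ]
      exact mul_pos (hP s) (hy s)
    -- Since `Φ ≤ y^{p/2}`, both factors are at most `√y`. Multiplication by `P` then gives `|s| P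
    -- Φ^{1/p} ≤ Φ`, the bound on the first derivative.
    have h1 : |s| * powProfile b κ δ s ^ (1 / p) ≤ s ^ 2 + δ := by
      have e1 : powProfile b κ δ s ^ (1 / p) ≤ √(s ^ 2 + δ) := by
        refine (Real.rpow_le_rpow hΦ0.le hΦy (by positivity)).trans_eq ?_
        rw [← Real.rpow_mul (hy s).le, hb, Real.sqrt_eq_rpow]
        congr 1
        field_simp
      have e2 : |s| ≤ √(s ^ 2 + δ) := Real.abs_le_sqrt (by linarith)
      calc _ ≤ √(s ^ 2 + δ) * √(s ^ 2 + δ) := by gcongr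
        _ = _ := Real.mul_self_sqrt (hy s).le
    have h2 : powProfile b κ δ s ^ (1 - 1 / p) * powProfile b κ δ s ^ (1 / p) =
        powProfile b κ δ s := by
      rw [← Real.rpow_add hΦ0]; simp
    have hq0 : 0 < powProfile b κ δ s ^ (1 / p) := Real.rpow_pos_of_pos hΦ0 _
    have h3 : |s| * ((s ^ 2 + δ) ^ (b - 1) * (1 + κ * (s ^ 2 + δ)) ^ (1 - b)) ≤
        powProfile b κ δ s ^ (1 - 1 / p) := by
      refine le_of_mul_le_mul_right ?_ hq0
      rw [h2]
      nth_rewrite 2 [powProfile_eq hδ]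
      calc _ = ((s ^ 2 + δ) ^ (b - 1) * (1 + κ * (s ^ 2 + δ)) ^ (1 - b)) *
            (|s| * powProfile b κ δ s ^ (1 / p)) := by ring
        _ ≤ _ := mul_le_mul_of_nonneg_left h1 (hP s).le
    calc |powProfile' b κ δ s| ≤ 2 * (1 + b) *
          (|s| * ((s ^ 2 + δ) ^ (b - 1) * (1 + κ * (s ^ 2 + δ)) ^ (1 - b))) := by
          refine (habs s).trans_eq (by ring)
      _ ≤ 2 * (1 + b) * powProfile b κ δ s ^ (1 - 1 / p) := by gcongr
      _ ≤ _ := by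
          refine mul_le_mul_of_nonneg_right (by linarith) (Real.rpow_nonneg hΦ0.le _)

end Profile

/-! ### The `L^p` estimate for one profile -/

/-- Slicewise `lintegral` bounds yield integrability and the estimate together; the energy
inequality needs the former as a hypothesis. -/
theorem integral_slab_le_of_lintegral_slice_le {n : ℕ} {s t : ℝ} {g : ℝ × Torus n → ℝ} {k : ℝ → ℝ}
    (hg : AEStronglyMeasurable g (slabMeasure n s t)) (hg0 : ∀ z, 0 ≤ g z)
    (hk : IntegrableOn k (Ioo s t))
    (h : ∀ᵐ τ ∂(volume.restrict (Ioo s t)), 0 ≤ k τ ∧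
      ∫⁻ x, ENNReal.ofReal (g (τ, x)) ≤ ENNReal.ofReal (k τ)) :
    Integrable g (slabMeasure n s t) ∧ ∫ z, g z ∂(slabMeasure n s t) ≤ ∫ τ in Ioo s t, k τ := by
  have hk0 : 0 ≤ᵐ[volume.restrict (Ioo s t)] k := h.mono fun τ hτ => hτ.1
  have h1 : ∫⁻ z, ENNReal.ofReal (g z) ∂(slabMeasure n s t) ≤
      ENNReal.ofReal (∫ τ in Ioo s t, k τ) := by
    rw [ofReal_integral_eq_lintegral_ofReal hk hk0]
    refine (lintegral_prod_le _).trans (lintegral_mono_ae (h.mono fun τ hτ => hτ.2))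
  have hi : Integrable g (slabMeasure n s t) := by
    refine ⟨hg, ?_⟩
    rw [hasFiniteIntegral_iff_ofReal (Eventually.of_forall hg0)]
    exact h1.trans_lt ENNReal.ofReal_lt_top
  refine ⟨hi, ?_⟩
  rw [← ofReal_integral_eq_lintegral_ofReal hi (Eventually.of_forall hg0)] at h1
  exact (ENNReal.ofReal_le_ofReal_iff (integral_nonneg_of_ae hk0)).1 h1

/-- A weight `G` is form bounded with relative bound `δ` and remainder `a`. -/
def IsFormBound {n : ℕ} (G : Torus n → ℝ) (δ a : ℝ) : Prop :=
  ∀ (v : Torus n → ℝ) (Dv : Torus n → Vec n), MemLp v 2 volume → MemLp Dv 2 volume →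
    IsWeakGradient v Dv → ∫⁻ x, ENNReal.ofReal (G x * v x ^ 2) ≤
      ENNReal.ofReal (δ * (∫ x, ‖Dv x‖ ^ 2) + a * ∫ x, v x ^ 2)

namespace IsEnergyProfile

variable {n : ℕ} {p A B : ℝ} {Φ Φ' Φ'' : ℝ → ℝ}

theorem continuous (h : IsEnergyProfile p A B Φ Φ' Φ'') : Continuous Φ :=
  continuous_iff_continuousAt.2 fun s => (h.hasDerivAt s).continuousAt

theorem continuous' (h : IsEnergyProfile p A B Φ Φ' Φ'') : Continuous Φ' :=
  continuous_iff_continuousAt.2 fun s => (h.hasDerivAt' s).continuousAt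

theorem abs_le (h : IsEnergyProfile p A B Φ Φ' Φ'') (s : ℝ) :
    |Φ s| ≤ (|Φ 0| + B) * (1 + s ^ 2) :=
  (IsHeatSolution.quadratic_bound h.hasDerivAt h.hasDerivAt' h.deriv_zero h.bound s).2

theorem integrable (h : IsEnergyProfile p A B Φ Φ' Φ'') {α : Type*} [MeasurableSpace α]
    {μ : Measure α} [IsFiniteMeasure μ] {u : α → ℝ} (hu : MemLp u 2 μ) :
    Integrable (fun x => Φ (u x)) μ :=
  IsHeatSolution.integrable_comp_quadratic hu h.continuous h.abs_le

theorem integral_le (h : IsEnergyProfile p A B Φ Φ' Φ'') {u : Torus n → ℝ}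
    (hu : MemLp u 2 volume) : ∫ x, Φ (u x) ≤ (|Φ 0| + B) * (1 + ∫ x, u x ^ 2) := by
  have h1 : Integrable (fun x => 1 + u x ^ 2) volume :=
    (integrable_const 1).add hu.integrable_sq
  refine (integral_mono (h.integrable hu) (h1.const_mul _) fun x =>
    (le_abs_self _).trans (h.abs_le _)).trans_eq ?_
  rw [integral_const_mul, integral_add (integrable_const 1) hu.integrable_sq]
  simp

theorem le_integral (h : IsEnergyProfile p A B Φ Φ' Φ'') {u : Torus n → ℝ}
    (hu : MemLp u 2 volume) : Φ 0 ≤ ∫ x, Φ (u x) := by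
  have := integral_mono (μ := (volume : Measure (Torus n))) (integrable_const (Φ 0))
    (h.integrable hu) fun x => h.mono 0 (u x) (by simp)
  simpa using this

/-- The form bound is applied to `v = √Φ(w)`, for which `v² = Φ(w)` and `|Dv|² = Φ'(w)²/(4Φ(w))
|Dw|² ≤ (A/4) Φ''(w) |Dw|²`. -/
theorem lintegral_weight_le (h : IsEnergyProfile p A B Φ Φ' Φ'') (hA : 0 ≤ A) {G : Torus n → ℝ}
    {δ a : ℝ} (hG : IsFormBound G δ a) (hδ : 0 ≤ δ) {w : Torus n → ℝ} {Dw : Torus n → Vec n}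
    (hw : MemLp w 2 volume) (hD : MemLp Dw 2 volume) (hwD : IsWeakGradient w Dw) :
    ∫⁻ x, ENNReal.ofReal (Φ (w x) * G x) ≤ ENNReal.ofReal
      (δ * (A / 4) * (∫ x, Φ'' (w x) * ‖Dw x‖ ^ 2) + a * ∫ x, Φ (w x)) := by
  set β : ℝ → ℝ := fun s => √(Φ s) with hβ
  set β' : ℝ → ℝ := fun s => Φ' s / (2 * √(Φ s)) with hβ'
  have hβd : ∀ s, HasDerivAt β (β' s) s := fun s => (h.hasDerivAt s).sqrt (h.pos s).ne'
  have hs0 : ∀ s, 0 < √(Φ s) := fun s => Real.sqrt_pos.2 (h.pos s)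
  have hβc : Continuous β := h.continuous.sqrt
  have hβ'c : Continuous β' := h.continuous'.div (continuous_const.mul hβc) fun s => by
    have := hs0 s; positivity
  have hβsq : ∀ s, β' s ^ 2 ≤ A / 4 * Φ'' s := by
    intro s
    have h1 := h.sq_deriv_le s
    have h2 := h.pos s
    rw [hβ', div_pow, mul_pow, Real.sq_sqrt h2.le, div_le_iff₀ (by positivity)]
    linarith
  have hB0 : 0 ≤ B := (abs_nonneg _).trans (h.bound 0)
  have hβb : ∀ s, |β' s| ≤ √(A / 4 * B) := fun s => by
    refine Real.abs_le_sqrt ((hβsq s).trans ?_)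
    exact mul_le_mul_of_nonneg_left ((le_abs_self _).trans (h.bound s)) (by positivity)
  have hv : MemLp (fun x => β (w x)) 2 volume := by
    rw [memLp_two_iff_integrable_sq (hβc.comp_aestronglyMeasurable hw.1)]
    refine (h.integrable hw).congr (Eventually.of_forall fun x => ?_)
    exact (Real.sq_sqrt (h.pos _).le).symm
  have hDv : MemLp (fun x => β' (w x) • Dw x) 2 volume := by
    refine hD.of_le_mul (c := √(A / 4 * B))
      ((hβ'c.comp_aestronglyMeasurable hw.1).smul hD.1) (Eventually.of_forall fun x => ?_)
    rw [norm_smul]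
    exact mul_le_mul_of_nonneg_right (hβb _) (norm_nonneg _)
  have hg := hwD.comp (hw.integrable one_le_two) (hD.mono_exponent one_le_two) hβd hβ'c hβb
  have hmain := hG _ _ hv hDv hg
  have e1 : ∀ x, β (w x) ^ 2 = Φ (w x) := fun x => Real.sq_sqrt (h.pos _).le
  simp only [e1, mul_comm (G _)] at hmain
  refine hmain.trans (ENNReal.ofReal_le_ofReal (add_le_add ?_ le_rfl))
  rw [mul_assoc]
  refine mul_le_mul_of_nonneg_left ?_ hδ
  rw [← integral_const_mul]
  have hDsq : Integrable (fun x => ‖Dw x‖ ^ 2) volume := hD.integrable_norm_pow two_ne_zero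
  refine integral_mono (hDv.integrable_norm_pow two_ne_zero) ?_ fun x => ?_
  · refine Integrable.const_mul ?_ _
    exact hDsq.bdd_mul (c := B) (h.continuous''.comp_aestronglyMeasurable hw.1)
      (Eventually.of_forall fun x => h.bound _)
  · simp only [norm_smul, mul_pow, Real.norm_eq_abs, sq_abs]
    rw [← mul_assoc]
    exact mul_le_mul_of_nonneg_right (hβsq _) (sq_nonneg _)

/-- Hölder's inequality with the conjugate exponent `p' = p/(p-1)`: as `(1 - 1/p) p' = 1`, the
factor `Φ^{1-1/p}` has `L^{p'}` norm `(∫Φ)^{1-1/p}`. -/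
theorem lintegral_source_le (h : IsEnergyProfile p A B Φ Φ' Φ'') (hp : 1 < p) (hA : 0 ≤ A)
    {w f : Torus n → ℝ} (hw : MemLp w 2 volume) (hf : AEStronglyMeasurable f volume) {N : ℝ}
    (hfN : eLpNorm f (ENNReal.ofReal p) volume ≤ ENNReal.ofReal N) :
    ∫⁻ x, ENNReal.ofReal (|Φ' (w x)| * |f x|) ≤
      ENNReal.ofReal (A * N * (∫ x, Φ (w x)) ^ (1 - 1 / p)) := by
  have hp0 : 0 < p := by linarith
  have hconj : (Real.conjExponent p).HolderConjugate p :=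
    (Real.HolderConjugate.conjExponent hp).symm
  have hexp : (1 - 1 / p) * Real.conjExponent p = 1 := by
    rw [Real.conjExponent]
    have : p - 1 ≠ 0 := by linarith
    field_simp
  have hm0 : 0 ≤ ∫ x, Φ (w x) := integral_nonneg fun x => (h.pos _).le
  have hΦm : AEMeasurable (fun x => ENNReal.ofReal (Φ (w x) ^ (1 - 1 / p))) volume := by
    refine AEMeasurable.ennreal_ofReal (AEStronglyMeasurable.aemeasurable ?_)
    exact (h.continuous.rpow_const fun s => Or.inl (h.pos s).ne').comp_aestronglyMeasurable hw.1
  calc ∫⁻ x, ENNReal.ofReal (|Φ' (w x)| * |f x|)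
      ≤ ∫⁻ x, ENNReal.ofReal A * (ENNReal.ofReal (Φ (w x) ^ (1 - 1 / p)) * ‖f x‖ₑ) := by
        refine lintegral_mono fun x => ?_
        rw [← Real.enorm_abs (f x), Real.enorm_of_nonneg (abs_nonneg _), ← mul_assoc,
          ← ENNReal.ofReal_mul hA, ← ENNReal.ofReal_mul (mul_nonneg hA
            (Real.rpow_nonneg (h.pos _).le _))]
        exact ENNReal.ofReal_le_ofReal
          (mul_le_mul_of_nonneg_right (h.abs_deriv_le _) (abs_nonneg _))
    _ = ENNReal.ofReal A * ∫⁻ x, ENNReal.ofReal (Φ (w x) ^ (1 - 1 / p)) * ‖f x‖ₑ := by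
        rw [lintegral_const_mul' _ _ ENNReal.ofReal_ne_top]
    _ ≤ ENNReal.ofReal A * ((∫⁻ x, ENNReal.ofReal (Φ (w x) ^ (1 - 1 / p)) ^
          (Real.conjExponent p)) ^ (1 / Real.conjExponent p) * (∫⁻ x, ‖f x‖ₑ ^ p) ^ (1 / p)) := by
        gcongr
        exact ENNReal.lintegral_mul_le_Lp_mul_Lq volume hconj hΦm hf.enorm
    _ ≤ ENNReal.ofReal A * (ENNReal.ofReal ((∫ x, Φ (w x)) ^ (1 - 1 / p)) *
          ENNReal.ofReal N) := by
        gcongr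
        · have e1 : ∀ x, ENNReal.ofReal (Φ (w x) ^ (1 - 1 / p)) ^ (Real.conjExponent p) =
              ENNReal.ofReal (Φ (w x)) := fun x => by
            rw [ENNReal.ofReal_rpow_of_nonneg (Real.rpow_nonneg (h.pos _).le _) hconj.nonneg,
              ← Real.rpow_mul (h.pos _).le, hexp, Real.rpow_one]
          simp only [e1]
          rw [← ofReal_integral_eq_lintegral_ofReal (h.integrable hw)
            (Eventually.of_forall fun x => (h.pos _).le),
            ENNReal.ofReal_rpow_of_nonneg hm0 (by have := hconj.nonneg; positivity)]
          rw [eq_one_div_of_mul_eq_one_left hexp]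
        · refine le_trans (le_of_eq ?_) hfN
          rw [eLpNorm_eq_lintegral_rpow_enorm_toReal (by simpa using hp0) ENNReal.ofReal_ne_top,
            ENNReal.toReal_ofReal hp0.le]
    _ = _ := by
        rw [← ENNReal.ofReal_mul (Real.rpow_nonneg hm0 _), ← ENNReal.ofReal_mul hA]
        congr 1
        ring

end IsEnergyProfile

namespace IsHeatSolution

variable {n : ℕ} {ε T : ℝ} {w : ℝ → Torus n → ℝ} {Dw : ℝ → Torus n → Vec n}
  {R f G : ℝ → Torus n → ℝ} {V : ℝ → Torus n → Vec n}

/-- Continuity into `L²` on a compact interval. The bound serves only to make `∫Φ(w)` bounded in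
time and does not enter any constant. -/
theorem exists_bound_slice (h : IsHeatSolution ε T w Dw R) :
    ∃ C : ℝ, ∀ t ∈ Icc 0 T, ∫ x, w t x ^ 2 ≤ C := by
  have key : ∃ C : ℝ≥0, ∀ t ∈ Icc 0 T, eLpNorm (w t) 2 volume ≤ C := by
    refine isCompact_Icc.induction_on (p := fun S => ∃ C : ℝ≥0, ∀ t ∈ S ∩ Icc 0 T,
      eLpNorm (w t) 2 volume ≤ C) ⟨0, by simp⟩ ?_ ?_ ?_ |>.imp fun C hC t ht => hC t ⟨ht, ht⟩
    · rintro S S' hS ⟨C, hC⟩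
      exact ⟨C, fun t ht => hC t ⟨hS ht.1, ht.2⟩⟩
    · rintro S S' ⟨C, hC⟩ ⟨C', hC'⟩
      refine ⟨max C C', fun t ht => ?_⟩
      rcases ht.1 with h1 | h1
      · exact (hC t ⟨h1, ht.2⟩).trans (by simp)
      · exact (hC' t ⟨h1, ht.2⟩).trans (by simp)
    · intro t ht
      have h1 := (h.continuous t ht).eventually (gt_mem_nhds zero_lt_one)
      refine ⟨{s | s ∈ Icc 0 T → eLpNorm (w s - w t) 2 volume < 1}, ?_,
        (eLpNorm (w t) 2 volume).toNNReal + 1, fun s hs => ?_⟩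
      · filter_upwards [h1] with s hs _ using hs
      · have h2 := eLpNorm_add_le ((h.memLp_slice s hs.2).sub (h.memLp_slice t ht)).1
          (h.memLp_slice t ht).1 one_le_two
        rw [sub_add_cancel] at h2
        refine h2.trans ?_
        rw [ENNReal.coe_add, ENNReal.coe_toNNReal (h.memLp_slice t ht).2.ne, add_comm]
        exact add_le_add le_rfl (hs.1 hs.2).le
  obtain ⟨C, hC⟩ := key
  refine ⟨C ^ 2, fun t ht => ?_⟩
  have h1 := (h.memLp_slice t ht).eLpNorm_eq_integral_rpow_norm two_ne_zero ENNReal.ofNat_ne_top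
  have h2 := hC t ht
  rw [h1] at h2
  have h3 : (∫ x, ‖w t x‖ ^ (2 : ℝ≥0∞).toReal) = ∫ x, w t x ^ 2 := by simp
  rw [h3] at h2
  have h4 : 0 ≤ ∫ x, w t x ^ 2 := integral_nonneg fun x => sq_nonneg _
  have h5 : √(∫ x, w t x ^ 2) ≤ C := by
    rw [Real.sqrt_eq_rpow]
    have := ENNReal.toReal_mono ENNReal.coe_ne_top h2
    rw [ENNReal.toReal_ofReal (by positivity)] at this
    simpa using this
  exact (Real.sqrt_le_left C.2).1 h5

/-- The form bound controls the weight term by `δ(A/4)∬Φ''(w)|Dw|²`, which the diffusion absorbs,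
plus `∫ a m` with `m = ∫Φ(w)`. With the Hölder bound for the source this leaves `m(t) ≤ m(T) + ∫ (a
m + A N m^{1-1/p})` over `(t, T)`. -/
theorem integral_profile_rpow_le (h : IsHeatSolution ε T w Dw R)
    (hV : MemLp (fun z : ℝ × Torus n => V z.1 z.2) 2 (cylMeasure n T))
    (hG : Integrable (fun z : ℝ × Torus n => G z.1 z.2) (cylMeasure n T))
    (hG0 : ∀ t x, 0 ≤ G t x) (hVG : DivLE T V G)
    (hf : Integrable (fun z : ℝ × Torus n => f z.1 z.2) (cylMeasure n T))
    (hR : ∀ᵐ z ∂(cylMeasure n T), R z.1 z.2 = inner ℝ (V z.1 z.2) (Dw z.1 z.2) - f z.1 z.2)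
    {p A B : ℝ} {Φ Φ' Φ'' : ℝ → ℝ} (hΦ : IsEnergyProfile p A B Φ Φ' Φ'') (hp : 1 < p) (hA : 0 ≤ A)
    {δ : ℝ} (hδ : 0 ≤ δ) (hδA : δ * (A / 4) ≤ ε) {a N : ℝ → ℝ} (ha0 : ∀ t, 0 ≤ a t)
    (ha : IntegrableOn a (Ioo 0 T)) (hN0 : ∀ t, 0 ≤ N t) (hN : IntegrableOn N (Ioo 0 T))
    (hform : ∀ᵐ t ∂(volume.restrict (Ioo 0 T)), IsFormBound (G t) δ (a t))
    (hfN : ∀ᵐ t ∂(volume.restrict (Ioo 0 T)),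
      eLpNorm (f t) (ENNReal.ofReal p) volume ≤ ENNReal.ofReal (N t))
    {s : ℝ} (hs : s ∈ Icc 0 T) :
    (∫ x, Φ (w s x)) ^ (1 / p) ≤ Real.exp (∫ t in s..T, a t) *
      ((∫ x, Φ (w T x)) ^ (1 / p) + ∫ t in s..T, A * N t) := by
  have hp0 : 0 < p := by linarith
  have hTI : T ∈ Icc 0 T := ⟨hs.1.trans hs.2, le_rfl⟩
  have hB0 : 0 ≤ B := (abs_nonneg _).trans (hΦ.bound 0)
  set m : ℝ → ℝ := fun t => ∫ x, Φ (w t x) with hm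
  obtain ⟨C₂, hC₂⟩ := h.exists_bound_slice
  obtain ⟨M, hM⟩ : ∃ M : ℝ, ∀ t ∈ Icc 0 T, m t ≤ M :=
    ⟨(|Φ 0| + B) * (1 + C₂), fun t ht => (hΦ.integral_le (h.memLp_slice t ht)).trans
      (mul_le_mul_of_nonneg_left (add_le_add le_rfl (hC₂ t ht)) (by positivity))⟩
  have hm0 : ∀ t, 0 ≤ m t := fun t => integral_nonneg fun x => (hΦ.pos _).le
  have hmm : AEStronglyMeasurable m (volume.restrict (Ioo 0 T)) :=
    (Integrable.integral_prod_left (hΦ.integrable h.memLp)).1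
  have hr0 : 0 ≤ 1 - 1 / p := by
    rw [sub_nonneg, div_le_one hp0]; exact hp.le
  have hmr : AEStronglyMeasurable (fun t => m t ^ (1 - 1 / p)) (volume.restrict (Ioo 0 T)) :=
    (Real.continuous_rpow_const hr0).comp_aestronglyMeasurable hmm
  set F : ℝ → ℝ := fun t => a t * m t + A * N t * m t ^ (1 - 1 / p) with hF
  have hF0 : ∀ t, 0 ≤ F t := fun t => add_nonneg (mul_nonneg (ha0 t) (hm0 t))
    (mul_nonneg (mul_nonneg hA (hN0 t)) (Real.rpow_nonneg (hm0 t) _))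
  have hI1 : IntegrableOn (fun t => a t * m t) (Ioo 0 T) := by
    refine Integrable.mul_bdd (c := M) ha hmm ?_
    filter_upwards [ae_restrict_mem measurableSet_Ioo] with t ht
    rw [Real.norm_of_nonneg (hm0 t)]
    exact hM t ⟨ht.1.le, ht.2.le⟩
  have hI2 : IntegrableOn (fun t => A * N t * m t ^ (1 - 1 / p)) (Ioo 0 T) := by
    refine Integrable.mul_bdd (c := M ^ (1 - 1 / p)) (hN.const_mul A) hmr ?_
    filter_upwards [ae_restrict_mem measurableSet_Ioo] with t ht
    rw [Real.norm_of_nonneg (Real.rpow_nonneg (hm0 t) _)]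
    exact Real.rpow_le_rpow (hm0 t) (hM t ⟨ht.1.le, ht.2.le⟩) hr0
  have hFi : IntegrableOn F (Ioo 0 T) := hI1.add hI2
  have hii : ∀ {g : ℝ → ℝ}, IntegrableOn g (Ioo 0 T) → ∀ t ∈ Icc 0 T,
      IntervalIntegrable g volume t T := fun hg t ht => by
    rw [intervalIntegrable_iff_integrableOn_Ioo_of_le ht.2]
    exact hg.mono_set (Ioo_subset_Ioo_left ht.1)
  have hmle : ∀ t ∈ Icc 0 T, m t ≤ m T + ∫ τ in t..T, F τ := by
    intro t ht
    have hsub : volume.restrict (Ioo t T) ≤ volume.restrict (Ioo 0 T) :=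
      Measure.restrict_mono (Ioo_subset_Ioo_left ht.1) le_rfl
    have hle2 : slabMeasure n t T ≤ cylMeasure n T := slabMeasure_le ht.1 le_rfl
    have hwm := h.memLp.1.mono_measure hle2
    have hDsq : Integrable (fun z : ℝ × Torus n => ‖Dw z.1 z.2‖ ^ 2) (cylMeasure n T) :=
      h.memLp_grad.integrable_norm_pow two_ne_zero
    have hΦD : Integrable (fun z : ℝ × Torus n => Φ'' (w z.1 z.2) * ‖Dw z.1 z.2‖ ^ 2)
        (slabMeasure n t T) :=
      (hDsq.mono_measure hle2).bdd_mul (c := B)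
        (hΦ.continuous''.comp_aestronglyMeasurable hwm) (Eventually.of_forall fun x => hΦ.bound _)
    have hgood : ∀ᵐ τ ∂(volume.restrict (Ioo 0 T)), MemLp (w τ) 2 volume ∧
        AEStronglyMeasurable (f τ) volume ∧ MemLp (Dw τ) 2 volume := by
      have h1 := hf.prod_right_ae
      have h2 : ∀ᵐ τ ∂(volume.restrict (Ioo 0 T)), Integrable (fun x => ‖Dw τ x‖ ^ 2) volume :=
        hDsq.prod_right_ae
      have h3 : ∀ᵐ τ ∂(volume.restrict (Ioo 0 T)), AEStronglyMeasurable (Dw τ) volume :=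
        h.memLp_grad.1.prodMk_left
      filter_upwards [h1, h2, h3, ae_restrict_mem measurableSet_Ioo] with τ h1 h2 h3 h4
      exact ⟨h.memLp_slice τ ⟨h4.1.le, h4.2.le⟩, h1.1,
        (memLp_two_iff_integrable_sq_norm h3).2 h2⟩
    have hk1 : IntegrableOn (fun τ => δ * (A / 4) * (∫ x, Φ'' (w τ x) * ‖Dw τ x‖ ^ 2) +
        a τ * m τ) (Ioo t T) :=
      (hΦD.integral_prod_left.const_mul _).add (hI1.mono_set (Ioo_subset_Ioo_left ht.1))
    have hGs := integral_slab_le_of_lintegral_slice_le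
      (g := fun z : ℝ × Torus n => Φ (w z.1 z.2) * G z.1 z.2) (s := t) (t := T)
      ((hΦ.continuous.comp_aestronglyMeasurable hwm).mul (hG.1.mono_measure hle2))
      (fun z => mul_nonneg (hΦ.pos _).le (hG0 _ _)) hk1 (by
        filter_upwards [ae_mono hsub hgood, ae_mono hsub h.weakGrad, ae_mono hsub hform]
          with τ h1 h2 h3
        refine ⟨add_nonneg (mul_nonneg (by positivity) (integral_nonneg fun x =>
          mul_nonneg (hΦ.nonneg'' _) (sq_nonneg _))) (mul_nonneg (ha0 _) (hm0 _)), ?_⟩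
        exact hΦ.lintegral_weight_le hA h3 hδ h1.1 h1.2.2 h2)
    have hfs := integral_slab_le_of_lintegral_slice_le
      (g := fun z : ℝ × Torus n => |Φ' (w z.1 z.2)| * |f z.1 z.2|) (s := t) (t := T)
      ((hΦ.continuous'.abs.comp_aestronglyMeasurable hwm).mul
        (continuous_abs.comp_aestronglyMeasurable (hf.1.mono_measure hle2)))
      (fun z => by positivity) (hI2.mono_set (Ioo_subset_Ioo_left ht.1)) (by
        filter_upwards [ae_mono hsub hgood, ae_mono hsub hfN] with τ h1 h2
        exact ⟨mul_nonneg (mul_nonneg hA (hN0 τ)) (Real.rpow_nonneg (hm0 τ) _),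
          hΦ.lintegral_source_le hp hA h1.1 h1.2.1 h2⟩)
    have hE := h.energy_inequality hV hG hG0 hVG hf hR hΦ.hasDerivAt hΦ.hasDerivAt'
      hΦ.continuous'' (fun s => (hΦ.pos s).le) hΦ.deriv_zero hΦ.bound hΦ.mono hΦ.mono'
      ht.1 ht.2 le_rfl hGs.1 hfs.1
    have h1 := hGs.2
    rw [integral_add (hΦD.integral_prod_left.const_mul _)
      (hI1.mono_set (Ioo_subset_Ioo_left ht.1)), integral_const_mul] at h1
    have h2 : ∫ z, Φ'' (w z.1 z.2) * ‖Dw z.1 z.2‖ ^ 2 ∂(slabMeasure n t T) =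
        ∫ τ in Ioo t T, ∫ x, Φ'' (w τ x) * ‖Dw τ x‖ ^ 2 := integral_prod _ hΦD
    have h3 : 0 ≤ ∫ τ in Ioo t T, ∫ x, Φ'' (w τ x) * ‖Dw τ x‖ ^ 2 :=
      integral_nonneg fun τ => integral_nonneg fun x => mul_nonneg (hΦ.nonneg'' _) (sq_nonneg _)
    -- The diffusion absorbs the gradient part of the weight term.
    have h4 := mul_le_mul_of_nonneg_right hδA h3
    have h5 : ∫ τ in t..T, F τ =
        (∫ τ in Ioo t T, a τ * m τ) + ∫ τ in Ioo t T, A * N τ * m τ ^ (1 - 1 / p) := by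
      rw [intervalIntegral.integral_of_le ht.2, integral_Ioc_eq_integral_Ioo, hF]
      exact integral_add (hI1.mono_set (Ioo_subset_Ioo_left ht.1))
        (hI2.mono_set (Ioo_subset_Ioo_left ht.1))
    rw [h2] at hE
    rw [h5]
    have h6 := hfs.2
    simp only [hm] at *
    linarith
  have hmT : 0 < m T := (hΦ.pos 0).trans_le (hΦ.le_integral (h.memLp_slice T hTI))
  -- Only an inequality is available for `m`, so Gronwall is applied to its majorant, which is a
  -- primitive. The majorant is at least `m T ≥ Φ 0 > 0`.
  have hg := gronwall_rpow (y := fun t => m T + ∫ τ in t..T, F τ) (b := fun t => A * N t) hp.le hs.2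
    (hii ha s hs) (hii (hN.const_mul A) s hs) (hii hFi s hs) ha0
    (fun t => mul_nonneg hA (hN0 t)) hF0 hmT (by simp) (by simp)
    (Eventually.of_forall fun t ht => by
      have ht' : t ∈ Icc 0 T := ⟨hs.1.trans ht.1, ht.2⟩
      have h1 := hmle t ht'
      exact add_le_add (mul_le_mul_of_nonneg_left h1 (ha0 t))
        (mul_le_mul_of_nonneg_left (Real.rpow_le_rpow (hm0 t) h1 hr0)
          (mul_nonneg hA (hN0 t))))
  simp only [intervalIntegral.integral_same, add_zero] at hg
  exact (Real.rpow_le_rpow (hm0 s) (hmle s hs) (by positivity)).trans hg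

end IsHeatSolution

/-! ### The `L^p` estimate -/

/-- The constant of the power profiles with exponent `p`. -/
noncomputable def profileConst (p : ℝ) : ℝ :=
  2 * (1 + p / 2) + 4 * (1 + p / 2) ^ 2 / min 2 (2 * (p / 2) * (2 * (p / 2) - 1))

theorem profileConst_nonneg {p : ℝ} (hp : 1 < p) : 0 ≤ profileConst p := by
  have : 0 < min 2 (2 * (p / 2) * (2 * (p / 2) - 1)) :=
    lt_min two_pos (mul_pos (by linarith) (by linarith))
  unfold profileConst
  positivity

/-- The regularisation parameter of the `j`-th power profile. -/
noncomputable def profileSlope (b : ℝ) (j : ℕ) : ℝ := if 1 < b then 1 / ((j : ℝ) + 1) else 0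

theorem tendsto_profileSlope (b : ℝ) : Tendsto (profileSlope b) atTop (𝓝 0) := by
  by_cases h : 1 < b
  · have : profileSlope b = fun j : ℕ => 1 / ((j : ℝ) + 1) := funext fun j => by
      simp [profileSlope, h]
    rw [this]
    exact tendsto_one_div_add_atTop_nhds_zero_nat
  · have : profileSlope b = fun _ => 0 := funext fun j => by simp [profileSlope, h]
    rw [this]
    exact tendsto_const_nhds

theorem profileSlope_nonneg (b : ℝ) (j : ℕ) : 0 ≤ profileSlope b j := by
  unfold profileSlope
  split_ifs <;> positivity

/-- The `j`-th approximation of `|s| ^ p`. -/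
noncomputable def approxPow (p : ℝ) (j : ℕ) : ℝ → ℝ :=
  powProfile (p / 2) (profileSlope (p / 2) j) (1 / ((j : ℝ) + 1))

theorem exists_isEnergyProfile_approxPow {p : ℝ} (hp : 1 < p) (j : ℕ) :
    ∃ B Φ' Φ'', IsEnergyProfile p (profileConst p) B (approxPow p j) Φ' Φ'' := by
  obtain ⟨B, hB⟩ := isEnergyProfile_powProfile (b := p / 2) hp rfl
    (by positivity : (0 : ℝ) < 1 / ((j : ℝ) + 1)) (profileSlope_nonneg (p / 2) j)
    (fun h => by simp [profileSlope, not_lt.2 h.le])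
    (fun h => by simp only [profileSlope, h, if_true]; positivity)
  exact ⟨B, _, _, hB⟩

theorem sq_rpow_half (p s : ℝ) : (s ^ 2) ^ (p / 2) = |s| ^ p := by
  rw [← sq_abs, ← Real.rpow_natCast, ← Real.rpow_mul (abs_nonneg s)]
  congr 1
  push_cast
  ring

theorem tendsto_approxPow {p : ℝ} (hp : 1 < p) (s : ℝ) :
    Tendsto (fun j => approxPow p j s) atTop (𝓝 (|s| ^ p)) := by
  have h1 : Tendsto (fun j : ℕ => s ^ 2 + 1 / ((j : ℝ) + 1)) atTop (𝓝 (s ^ 2)) := by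
    simpa using (tendsto_one_div_add_atTop_nhds_zero_nat (𝕜 := ℝ)).const_add (s ^ 2)
  have h2 : Tendsto (fun j : ℕ => 1 + profileSlope (p / 2) j * (s ^ 2 + 1 / ((j : ℝ) + 1))) atTop
      (𝓝 1) := by
    simpa using ((tendsto_profileSlope (p / 2)).mul h1).const_add 1
  have h3 := (h1.rpow_const (p := p / 2) (Or.inr (by linarith))).mul
    (h2.rpow_const (p := 1 - p / 2) (Or.inl one_ne_zero))
  rwa [Real.one_rpow, mul_one, sq_rpow_half] at h3

/-- A majorant uniform in `j`, for dominated convergence at the terminal time. -/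
theorem approxPow_le {p : ℝ} (hp : 1 < p) (j : ℕ) (s : ℝ) :
    approxPow p j s ≤ (1 + |s|) ^ p := by
  have hj : (0 : ℝ) < 1 / ((j : ℝ) + 1) := by positivity
  have hj1 : 1 / ((j : ℝ) + 1) ≤ 1 := by
    rw [div_le_one (by positivity)]; linarith [(Nat.cast_nonneg j : (0 : ℝ) ≤ j)]
  have hy : 0 < s ^ 2 + 1 / ((j : ℝ) + 1) := by positivity
  rw [approxPow, powProfile]
  have h1 : (1 + profileSlope (p / 2) j * (s ^ 2 + 1 / ((j : ℝ) + 1))) ^ (1 - p / 2) ≤ 1 := by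
    by_cases h : 1 < p / 2
    · refine Real.rpow_le_one_of_one_le_of_nonpos ?_ (by linarith)
      have := mul_nonneg (profileSlope_nonneg (p / 2) j) hy.le
      linarith
    · simp [profileSlope, h]
  refine (mul_le_of_le_one_right (Real.rpow_nonneg hy.le _) h1).trans ?_
  rw [← abs_of_pos (by positivity : 0 < 1 + |s|), ← sq_rpow_half]
  refine Real.rpow_le_rpow hy.le ?_ (by linarith)
  nlinarith [sq_abs s, abs_nonneg s]

namespace IsHeatSolution

variable {n : ℕ} {ε T : ℝ} {w : ℝ → Torus n → ℝ} {Dw : ℝ → Torus n → Vec n}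
  {R f G : ℝ → Torus n → ℝ} {V : ℝ → Torus n → Vec n}

/-- The profiles tend to `|s|^p` while the constants stay fixed. At time `T` dominated convergence
applies because `w T` is in `L^p`. At time `s` only Fatou's lemma is available, as the integrability
of `|w s|^p` is part of the conclusion. -/
theorem eLpNorm_le (h : IsHeatSolution ε T w Dw R)
    (hV : MemLp (fun z : ℝ × Torus n => V z.1 z.2) 2 (cylMeasure n T))
    (hG : Integrable (fun z : ℝ × Torus n => G z.1 z.2) (cylMeasure n T))
    (hG0 : ∀ t x, 0 ≤ G t x) (hVG : DivLE T V G)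
    (hf : Integrable (fun z : ℝ × Torus n => f z.1 z.2) (cylMeasure n T))
    (hR : ∀ᵐ z ∂(cylMeasure n T), R z.1 z.2 = inner ℝ (V z.1 z.2) (Dw z.1 z.2) - f z.1 z.2)
    {p : ℝ} (hp : 1 < p) {δ : ℝ} (hδ : 0 ≤ δ) (hδA : δ * (profileConst p / 4) ≤ ε)
    {a N : ℝ → ℝ} (ha0 : ∀ t, 0 ≤ a t)
    (ha : IntegrableOn a (Ioo 0 T)) (hN0 : ∀ t, 0 ≤ N t) (hN : IntegrableOn N (Ioo 0 T))
    (hform : ∀ᵐ t ∂(volume.restrict (Ioo 0 T)), IsFormBound (G t) δ (a t))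
    (hfN : ∀ᵐ t ∂(volume.restrict (Ioo 0 T)),
      eLpNorm (f t) (ENNReal.ofReal p) volume ≤ ENNReal.ofReal (N t))
    (hwT : MemLp (w T) (ENNReal.ofReal p) volume) {s : ℝ} (hs : s ∈ Icc 0 T) :
    eLpNorm (w s) (ENNReal.ofReal p) volume ≤ ENNReal.ofReal
      (Real.exp (∫ t in Ioo 0 T, a t) * ((eLpNorm (w T) (ENNReal.ofReal p) volume).toReal +
        profileConst p * ∫ t in Ioo 0 T, N t)) := by
  have hp0 : 0 < p := by linarith
  have hA := profileConst_nonneg hp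
  have hpp : ENNReal.ofReal p ≠ 0 := by simpa using hp0
  have hTI : T ∈ Icc 0 T := ⟨hs.1.trans hs.2, le_rfl⟩
  set A := profileConst p with hAdef
  set X : ℕ → ℝ := fun j => Real.exp (∫ t in Ioo 0 T, a t) *
    ((∫ x, approxPow p j (w T x)) ^ (1 / p) + A * ∫ t in Ioo 0 T, N t) with hX
  set X₀ : ℝ := Real.exp (∫ t in Ioo 0 T, a t) *
    ((eLpNorm (w T) (ENNReal.ofReal p) volume).toReal + A * ∫ t in Ioo 0 T, N t) with hX0
  have hpos : ∀ j x, 0 < approxPow p j x := fun j x => by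
    obtain ⟨B, Φ', Φ'', hΦ⟩ := exists_isEnergyProfile_approxPow hp j
    exact hΦ.pos x
  have hcont : ∀ j, Continuous (approxPow p j) := fun j => by
    obtain ⟨B, Φ', Φ'', hΦ⟩ := exists_isEnergyProfile_approxPow hp j
    exact hΦ.continuous
  have hint : ∀ j, Integrable (fun x => approxPow p j (w s x)) volume := fun j => by
    obtain ⟨B, Φ', Φ'', hΦ⟩ := exists_isEnergyProfile_approxPow hp j
    exact hΦ.integrable (h.memLp_slice s hs)
  have hsub : ∀ {g : ℝ → ℝ}, (∀ t, 0 ≤ g t) → IntegrableOn g (Ioo 0 T) →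
      ∫ t in s..T, g t ≤ ∫ t in Ioo 0 T, g t := fun hg0 hg => by
    rw [intervalIntegral.integral_of_le hs.2, integral_Ioc_eq_integral_Ioo]
    exact setIntegral_mono_set hg (Eventually.of_forall hg0)
      (Ioo_subset_Ioo_left hs.1).eventuallyLE
  have hle : ∀ j, ∫ x, approxPow p j (w s x) ≤ X j ^ p := by
    intro j
    obtain ⟨B, Φ', Φ'', hΦ⟩ := exists_isEnergyProfile_approxPow hp j
    have h1 := h.integral_profile_rpow_le hV hG hG0 hVG hf hR hΦ hp hA hδ hδA ha0 ha hN0 hN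
      hform hfN hs
    have hm0 : 0 ≤ ∫ x, approxPow p j (w s x) := integral_nonneg fun x => (hpos j _).le
    have h2 : (∫ x, approxPow p j (w s x)) ^ (1 / p) ≤ X j := by
      refine h1.trans ?_
      rw [intervalIntegral.integral_const_mul]
      have e0 : 0 ≤ ∫ t in s..T, N t := intervalIntegral.integral_nonneg hs.2 fun t _ => hN0 t
      have e1 : 0 ≤ (∫ x, approxPow p j (w T x)) ^ (1 / p) :=
        Real.rpow_nonneg (integral_nonneg fun x => (hpos j _).le) _
      refine mul_le_mul (Real.exp_le_exp.2 (hsub ha0 ha))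
        (add_le_add le_rfl (mul_le_mul_of_nonneg_left (hsub hN0 hN) hA)) (by positivity)
        (Real.exp_pos _).le
    calc ∫ x, approxPow p j (w s x) = ((∫ x, approxPow p j (w s x)) ^ (1 / p)) ^ p := by
          rw [← Real.rpow_mul hm0, one_div_mul_cancel hp0.ne', Real.rpow_one]
      _ ≤ X j ^ p := Real.rpow_le_rpow (by positivity) h2 hp0.le
  have hXlim : Tendsto X atTop (𝓝 X₀) := by
    have h1 : Tendsto (fun j => ∫ x, approxPow p j (w T x)) atTop (𝓝 (∫ x, |w T x| ^ p)) := by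
      refine tendsto_integral_of_dominated_convergence (fun x => (1 + |w T x|) ^ p)
        (fun j => (hcont j).comp_aestronglyMeasurable hwT.1) ?_
        (fun j => Eventually.of_forall fun x => ?_)
        (Eventually.of_forall fun x => tendsto_approxPow hp _)
      · have h2 := ((memLp_const (1 : ℝ)).add hwT.abs).integrable_norm_rpow hpp
          ENNReal.ofReal_ne_top
        rw [ENNReal.toReal_ofReal hp0.le] at h2
        refine h2.congr (Eventually.of_forall fun x => ?_)
        simp only [Pi.add_apply, Pi.abs_apply]
        rw [Real.norm_of_nonneg (by positivity)]
      · rw [Real.norm_of_nonneg (hpos j _).le]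
        exact approxPow_le hp j _
    have h2 : (∫ x, |w T x| ^ p) ^ (1 / p) = (eLpNorm (w T) (ENNReal.ofReal p) volume).toReal := by
      rw [hwT.eLpNorm_eq_integral_rpow_norm hpp ENNReal.ofReal_ne_top,
        ENNReal.toReal_ofReal hp0.le, ENNReal.toReal_ofReal (by positivity), one_div]
      rfl
    have h3 := h1.rpow_const (p := 1 / p) (Or.inr (by positivity))
    rw [h2] at h3
    exact (h3.add_const _).const_mul _
  have hX00 : 0 ≤ X₀ := mul_nonneg (Real.exp_pos _).le (add_nonneg ENNReal.toReal_nonneg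
    (mul_nonneg hA (integral_nonneg hN0)))
  rw [eLpNorm_eq_lintegral_rpow_enorm_toReal hpp ENNReal.ofReal_ne_top,
    ENNReal.toReal_ofReal hp0.le]
  have hfin : ∫⁻ x, ‖w s x‖ₑ ^ p ≤ ENNReal.ofReal (X₀ ^ p) := by
    calc ∫⁻ x, ‖w s x‖ₑ ^ p
        = ∫⁻ x, liminf (fun j => ENNReal.ofReal (approxPow p j (w s x))) atTop := by
          refine lintegral_congr fun x => ?_
          rw [(ENNReal.tendsto_ofReal (tendsto_approxPow hp (w s x))).liminf_eq,
            Real.enorm_eq_ofReal_abs, ENNReal.ofReal_rpow_of_nonneg (abs_nonneg _) hp0.le]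
      _ ≤ liminf (fun j => ∫⁻ x, ENNReal.ofReal (approxPow p j (w s x))) atTop :=
          lintegral_liminf_le' fun j => (hint j).1.aemeasurable.ennreal_ofReal
      _ ≤ liminf (fun j => ENNReal.ofReal (X j ^ p)) atTop := by
          refine liminf_le_liminf (Eventually.of_forall fun j => ?_)
          rw [← ofReal_integral_eq_lintegral_ofReal (hint j)
            (Eventually.of_forall fun x => (hpos j _).le)]
          exact ENNReal.ofReal_le_ofReal (hle j)
      _ = ENNReal.ofReal (X₀ ^ p) :=
          (ENNReal.tendsto_ofReal (hXlim.rpow_const (Or.inr hp0.le))).liminf_eq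
  refine (ENNReal.rpow_le_rpow hfin (by positivity)).trans_eq ?_
  rw [ENNReal.ofReal_rpow_of_nonneg (by positivity) (by positivity), ← Real.rpow_mul hX00,
    mul_one_div_cancel hp0.ne', Real.rpow_one]

end IsHeatSolution

/-! ### Test functions and differences of solutions -/

section TestFunction

variable {n : ℕ} {T : ℝ} {φ : ℝ → Torus n → ℝ}

theorem isQuotientMap_prodMap_torusMk :
    IsQuotientMap (Prod.map id torusMk : ℝ × (Fin n → ℝ) → ℝ × Torus n) := by
  have h : IsOpenMap (torusMk (n := n)) := by
    refine IsOpenMap.piMap (fun i => QuotientAddGroup.isOpenMap_coe) ?_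
    exact Eventually.of_forall fun i => QuotientAddGroup.mk_surjective
  refine (IsOpenMap.id.prodMap h).isQuotientMap ?_ (Function.surjective_id.prodMap torusMk_surjective)
  exact continuous_id.prodMap isQuotientMap_torusMk.continuous

theorem IsTestFunction.continuous (h : IsTestFunction T φ) :
    Continuous fun z : ℝ × Torus n => φ z.1 z.2 := by
  rw [isQuotientMap_prodMap_torusMk.continuous_iff]
  exact h.smooth.continuous

theorem IsTestFunction.continuous_deriv (h : IsTestFunction T φ) :
    Continuous fun z : ℝ × Torus n => deriv (fun s => φ s z.2) z.1 := by
  rw [isQuotientMap_prodMap_torusMk.continuous_iff]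
  have hs := h.smooth
  have e : (fun z : ℝ × Torus n => deriv (fun s => φ s z.2) z.1) ∘ Prod.map id torusMk =
      fun z : ℝ × (Fin n → ℝ) =>
        fderiv ℝ (fun z : ℝ × (Fin n → ℝ) => φ z.1 fun i => (z.2 i : UnitAddCircle)) z (1, 0) := by
    funext ⟨t, X⟩
    have h1 := (hs.differentiable (by simp) (t, X)).hasFDerivAt
    have h2 : HasDerivAt (fun s : ℝ => (s, X)) ((1 : ℝ), (0 : Fin n → ℝ)) t :=
      (hasDerivAt_id t).prodMk (hasDerivAt_const t X)
    exact (h1.comp_hasDerivAt t h2).deriv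
  rw [e]
  exact (hs.continuous_fderiv (by simp)).clm_apply continuous_const

theorem IsTestFunction.continuous_torusGrad (h : IsTestFunction T φ) (i : Fin n) :
    Continuous fun z : ℝ × Torus n => torusGrad (φ z.1) z.2 i := by
  rw [isQuotientMap_prodMap_torusMk.continuous_iff]
  have hs := h.smooth
  have e : (fun z : ℝ × Torus n => torusGrad (φ z.1) z.2 i) ∘ Prod.map id torusMk =
      fun z : ℝ × (Fin n → ℝ) =>
        fderiv ℝ (fun z : ℝ × (Fin n → ℝ) => φ z.1 fun i => (z.2 i : UnitAddCircle)) z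
          (0, Pi.single i 1) := by
    funext ⟨t, X⟩
    have h1 := (hs.differentiable (by simp) (t, X)).hasFDerivAt
    have h2 : HasDerivAt (fun s : ℝ => (t, X + s • (Pi.single i (1 : ℝ) : Fin n → ℝ)))
        ((0 : ℝ), (Pi.single i 1 : Fin n → ℝ)) 0 := by
      refine (hasDerivAt_const _ t).prodMk ?_
      simpa using ((hasDerivAt_id (0 : ℝ)).smul_const
        (Pi.single i (1 : ℝ) : Fin n → ℝ)).const_add X
    have h1' : HasFDerivAt (fun z : ℝ × (Fin n → ℝ) => φ z.1 fun i => (z.2 i : UnitAddCircle))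
        (fderiv ℝ (fun z : ℝ × (Fin n → ℝ) => φ z.1 fun i => (z.2 i : UnitAddCircle)) (t, X))
        (t, X + (0 : ℝ) • (Pi.single i (1 : ℝ) : Fin n → ℝ)) := by simpa using h1
    have h3 := (h1'.comp_hasDerivAt (0 : ℝ) h2).deriv
    have e2 : (fun s : ℝ => φ t (torusMk X + Pi.single i (s : UnitAddCircle))) =
        fun s : ℝ => φ t (torusMk (X + s • (Pi.single i (1 : ℝ) : Fin n → ℝ))) := by
      funext s
      rw [torusMk_add_single]
    simp only [Function.comp, Prod.map, id, torusGrad]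
    rw [e2]
    exact h3
  rw [e]
  exact (hs.continuous_fderiv (by simp)).clm_apply continuous_const

theorem exists_bound_of_continuous_of_support {F : ℝ × Torus n → ℝ} (hF : Continuous F) {a b : ℝ}
    (h0 : ∀ t, t ∉ Icc a b → ∀ x, F (t, x) = 0) : ∃ B, ∀ z, |F z| ≤ B := by
  obtain ⟨B, hB⟩ := ((isCompact_Icc (a := a) (b := b)).prod
    (isCompact_univ (X := Torus n))).exists_bound_of_continuousOn hF.continuousOn
  refine ⟨max B 0, fun z => ?_⟩
  by_cases hz : z.1 ∈ Icc a b
  · exact (hB z ⟨hz, mem_univ _⟩).trans (le_max_left _ _)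
  · rw [show F z = 0 from h0 z.1 hz z.2, abs_zero]
    exact le_max_right _ _

theorem IsTestFunction.exists_bound (h : IsTestFunction T φ) :
    ∃ B, ∀ z : ℝ × Torus n, |φ z.1 z.2| ≤ B ∧ |deriv (fun s => φ s z.2) z.1| ≤ B ∧
      ∀ i, |torusGrad (φ z.1) z.2 i| ≤ B := by
  obtain ⟨a, b, -, -, h0⟩ := h.support
  obtain ⟨B₁, hB₁⟩ := exists_bound_of_continuous_of_support h.continuous h0
  obtain ⟨B₂, hB₂⟩ := exists_bound_of_continuous_of_support (a := a) (b := b) h.continuous_deriv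
    fun t ht x => by
      have : (fun s => φ s x) =ᶠ[𝓝 t] fun _ => 0 := by
        filter_upwards [isClosed_Icc.isOpen_compl.mem_nhds ht] with s hs using h0 s hs x
      simp [this.deriv_eq]
  choose B₃ hB₃ using fun i => exists_bound_of_continuous_of_support (a := a) (b := b)
    (h.continuous_torusGrad i) fun t ht x => by
      simp [torusGrad, h0 t ht]
  have hn : ∀ i, 0 ≤ B₃ i := fun i => (abs_nonneg _).trans (hB₃ i (0, 0))
  have hn1 : 0 ≤ B₁ := (abs_nonneg _).trans (hB₁ (0, 0))
  have hn2 : 0 ≤ B₂ := (abs_nonneg _).trans (hB₂ (0, 0))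
  have hn3 : 0 ≤ ∑ i, B₃ i := Finset.sum_nonneg fun i _ => hn i
  refine ⟨B₁ + B₂ + ∑ i, B₃ i, fun z => ⟨?_, ?_, fun i => ?_⟩⟩
  · linarith [hB₁ z]
  · linarith [hB₂ z]
  · have := Finset.single_le_sum (f := B₃) (fun i _ => hn i) (Finset.mem_univ i)
    linarith [hB₃ i z]

variable {α : Type*} [MeasurableSpace α] {μ : Measure α}

/-- The map `π` lets one statement serve both on the cylinder and on its product with the interval
of parameters `θ`. -/
theorem IsTestFunction.integrable_mul (h : IsTestFunction T φ) {F : α → ℝ} (hF : Integrable F μ)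
    {π : α → ℝ × Torus n} (hπ : AEMeasurable π μ) :
    Integrable (fun a => F a * φ (π a).1 (π a).2) μ := by
  obtain ⟨B, hB⟩ := h.exists_bound
  exact hF.mul_bdd (c := B) (h.continuous.measurable.comp_aemeasurable hπ).aestronglyMeasurable
    (Eventually.of_forall fun a => (hB (π a)).1)

theorem IsTestFunction.integrable_mul_deriv (h : IsTestFunction T φ) {F : α → ℝ}
    (hF : Integrable F μ) {π : α → ℝ × Torus n} (hπ : AEMeasurable π μ) :
    Integrable (fun a => F a * deriv (fun s => φ s (π a).2) (π a).1) μ := by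
  obtain ⟨B, hB⟩ := h.exists_bound
  exact hF.mul_bdd (c := B)
    (h.continuous_deriv.measurable.comp_aemeasurable hπ).aestronglyMeasurable
    (Eventually.of_forall fun a => (hB (π a)).2.1)

theorem IsTestFunction.integrable_inner [IsFiniteMeasure μ] (h : IsTestFunction T φ) {F : α → Vec n}
    (hF : MemLp F 1 μ) {π : α → ℝ × Torus n} (hπ : AEMeasurable π μ) :
    Integrable (fun a => inner ℝ (F a) (torusGrad (φ (π a).1) (π a).2)) μ := by
  obtain ⟨B, hB⟩ := h.exists_bound
  simp only [inner_vec_eq_sum]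
  refine integrable_finsetSum _ fun i _ => ?_
  exact ((hF.vec_apply i).integrable le_rfl).mul_bdd (c := B)
    ((h.continuous_torusGrad i).measurable.comp_aemeasurable hπ).aestronglyMeasurable
    (Eventually.of_forall fun a => (hB (π a)).2.2 i)

end TestFunction

section Difference

variable {n : ℕ} {ε T : ℝ} {H : Torus n → ℝ → Vec n → ℝ} {f₁ f₂ : ℝ → Torus n → ℝ}
  {g₁ g₂ : Torus n → ℝ} {u₁ u₂ : ℝ → Torus n → ℝ} {Du₁ Du₂ : ℝ → Torus n → Vec n}

theorem IsWeakGradient.sub {w₁ w₂ : Torus n → ℝ} {v₁ v₂ : Torus n → Vec n}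
    (h₁ : IsWeakGradient w₁ v₁) (h₂ : IsWeakGradient w₂ v₂) (hw₁ : Integrable w₁ volume)
    (hw₂ : Integrable w₂ volume) (hv₁ : MemLp v₁ 1 volume) (hv₂ : MemLp v₂ 1 volume) :
    IsWeakGradient (fun x => w₁ x - w₂ x) (fun x => v₁ x - v₂ x) := by
  intro ψ hψ i
  have hc := (hψ.hasPartial i).continuous
  obtain ⟨B, hB⟩ := hc.exists_torus_bound
  obtain ⟨B', hB'⟩ := hψ.continuous.exists_torus_bound
  have i1 : ∀ {F : Torus n → ℝ}, Integrable F volume →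
      Integrable (fun x => F x * torusGrad ψ x i) volume := fun hF =>
    hF.mul_bdd (c := B) hc.aestronglyMeasurable (Eventually.of_forall hB)
  have i2 : ∀ {F : Torus n → ℝ}, Integrable F volume → Integrable (fun x => F x * ψ x) volume :=
    fun hF => hF.mul_bdd (c := B') hψ.continuous.aestronglyMeasurable (Eventually.of_forall hB')
  simp only [sub_mul, PiLp.sub_apply]
  rw [integral_sub (i1 hw₁) (i1 hw₂), integral_sub (i2 ((hv₁.vec_apply i).integrable le_rfl))
    (i2 ((hv₂.vec_apply i).integrable le_rfl)), h₁ ψ hψ i, h₂ ψ hψ i]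
  ring

theorem MeasureTheory.MemLp.cyl_slice {E : Type*} [NormedAddCommGroup E] {F : ℝ → Torus n → E}
    (hF : MemLp (fun z : ℝ × Torus n => F z.1 z.2) 2 (cylMeasure n T)) :
    ∀ᵐ t ∂(volume.restrict (Ioo 0 T)), MemLp (F t) 2 volume := by
  have h1 : ∀ᵐ t ∂(volume.restrict (Ioo 0 T)), Integrable (fun x => ‖F t x‖ ^ 2) volume :=
    (hF.integrable_norm_pow two_ne_zero).prod_right_ae
  have h2 : ∀ᵐ t ∂(volume.restrict (Ioo 0 T)), AEStronglyMeasurable (F t) volume :=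
    hF.1.prodMk_left
  filter_upwards [h1, h2] with t h1 h2
  exact (memLp_two_iff_integrable_sq_norm h2).2 h1

/-- The difference of two energy solutions solves a heat equation with an integrable source. -/
theorem IsEnergySolution.isHeatSolution_sub (h₁ : IsEnergySolution ε T H f₁ g₁ u₁ Du₁)
    (h₂ : IsEnergySolution ε T H f₂ g₂ u₂ Du₂)
    (hf₁ : Integrable (fun z : ℝ × Torus n => f₁ z.1 z.2) (cylMeasure n T))
    (hf₂ : Integrable (fun z : ℝ × Torus n => f₂ z.1 z.2) (cylMeasure n T)) :
    IsHeatSolution ε T (fun t x => u₁ t x - u₂ t x) (fun t x => Du₁ t x - Du₂ t x)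
      (fun t x => (H x t (Du₁ t x) - H x t (Du₂ t x)) - (f₁ t x - f₂ t x)) where
  memLp := h₁.parabolic.memLp.sub h₂.parabolic.memLp
  memLp_grad := h₁.parabolic.memLp_grad.sub h₂.parabolic.memLp_grad
  weakGrad := by
    filter_upwards [h₁.parabolic.weakGrad, h₂.parabolic.weakGrad,
      h₁.parabolic.memLp.cyl_slice, h₂.parabolic.memLp.cyl_slice,
      h₁.parabolic.memLp_grad.cyl_slice, h₂.parabolic.memLp_grad.cyl_slice]
      with t a1 a2 a3 a4 a5 a6
    exact a1.sub a2 (a3.integrable one_le_two) (a4.integrable one_le_two)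
      (a5.mono_exponent one_le_two) (a6.mono_exponent one_le_two)
  memLp_slice t ht := (h₁.parabolic.memLp_slice t ht).sub (h₂.parabolic.memLp_slice t ht)
  continuous t ht := by
    have h0 := (h₁.parabolic.continuous t ht).add (h₂.parabolic.continuous t ht)
    rw [add_zero] at h0
    refine tendsto_of_tendsto_of_tendsto_of_le_of_le' tendsto_const_nhds h0
      (Eventually.of_forall fun _ => zero_le) ?_
    filter_upwards [self_mem_nhdsWithin] with s hs
    have e : ((fun x => u₁ s x - u₂ s x) - fun x => u₁ t x - u₂ t x) =
        (u₁ s - u₁ t) - (u₂ s - u₂ t) := by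
      funext x
      simp only [Pi.sub_apply]
      ring
    rw [e]
    exact eLpNorm_sub_le ((h₁.parabolic.memLp_slice s hs).sub (h₁.parabolic.memLp_slice t ht)).1
      ((h₂.parabolic.memLp_slice s hs).sub (h₂.parabolic.memLp_slice t ht)).1 one_le_two
  integrable := (h₁.integrable.sub h₂.integrable).sub (hf₁.sub hf₂)
  equation φ hφ := by
    have e1 := h₁.equation φ hφ
    have e2 := h₂.equation φ hφ
    have hid : AEMeasurable (fun z : ℝ × Torus n => z) (cylMeasure n T) := aemeasurable_id
    have a1 := hφ.integrable_mul_deriv (h₁.parabolic.memLp.integrable one_le_two) hid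
    have a2 := hφ.integrable_mul_deriv (h₂.parabolic.memLp.integrable one_le_two) hid
    have b1 := hφ.integrable_inner (h₁.parabolic.memLp_grad.mono_exponent one_le_two) hid
    have b2 := hφ.integrable_inner (h₂.parabolic.memLp_grad.mono_exponent one_le_two) hid
    have c1 := hφ.integrable_mul h₁.integrable hid
    have c2 := hφ.integrable_mul h₂.integrable hid
    have d1 := hφ.integrable_mul hf₁ hid
    have d2 := hφ.integrable_mul hf₂ hid
    have c12 : Integrable (fun z : ℝ × Torus n => H z.2 z.1 (Du₁ z.1 z.2) * φ z.1 z.2 -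
        H z.2 z.1 (Du₂ z.1 z.2) * φ z.1 z.2) (cylMeasure n T) := c1.sub c2
    have d12 : Integrable (fun z : ℝ × Torus n => f₁ z.1 z.2 * φ z.1 z.2 -
        f₂ z.1 z.2 * φ z.1 z.2) (cylMeasure n T) := d1.sub d2
    simp only [sub_mul, inner_sub_left]
    rw [integral_sub a1 a2, integral_sub b1 b2, integral_sub c12 d12, integral_sub c1 c2,
      integral_sub d1 d2]
    linarith

/-- The fundamental theorem of calculus along a segment. -/
theorem sub_eq_inner_integral_gradient {F : Vec n → ℝ} (hF : ContDiff ℝ 1 F) (ξ η : Vec n) :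
    F ξ - F η = inner ℝ (∫ θ in Icc (0 : ℝ) 1, gradient F (θ • ξ + (1 - θ) • η)) (ξ - η) := by
  have hc : Continuous fun θ : ℝ => gradient F (θ • ξ + (1 - θ) • η) := by
    have h1 : Continuous (gradient F) :=
      (InnerProductSpace.toDual ℝ (Vec n)).symm.continuous.comp (hF.continuous_fderiv one_ne_zero)
    exact h1.comp (by fun_prop)
  have hd : ∀ θ : ℝ, HasDerivAt (fun θ : ℝ => F (θ • ξ + (1 - θ) • η))
      (inner ℝ (gradient F (θ • ξ + (1 - θ) • η)) (ξ - η)) θ := by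
    intro θ
    have h1 : HasDerivAt (fun θ : ℝ => θ • ξ + (1 - θ) • η) (ξ - η) θ := by
      have := ((hasDerivAt_id θ).smul_const ξ).add
        (((hasDerivAt_id θ).const_sub 1).smul_const η)
      refine this.congr_deriv ?_
      simp [sub_eq_add_neg]
    have h2 := (hF.differentiable one_ne_zero (θ • ξ + (1 - θ) • η)).hasGradientAt.hasFDerivAt
    exact h2.comp_hasDerivAt θ h1
  have hi := intervalIntegral.integral_eq_sub_of_hasDerivAt (a := 0) (b := 1)
    (fun θ _ => hd θ) ((hc.inner continuous_const).intervalIntegrable _ _)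
  simp only [one_smul, sub_self, zero_smul, add_zero, sub_zero, zero_add] at hi
  rw [← hi, intervalIntegral.integral_of_le zero_le_one, ← integral_Icc_eq_integral_Ioc]
  have := integral_inner (𝕜 := ℝ) (hc.integrableOn_Icc (μ := volume) (a := (0 : ℝ)) (b := 1))
    (ξ - η)
  rw [real_inner_comm, ← this]
  exact integral_congr_ae (Eventually.of_forall fun θ => real_inner_comm _ _)

end Difference

/-! ### Mixed norms -/

section MixedNorm

variable {n : ℕ}

theorem measurable_eLpNorm_slice {α : Type*} [MeasurableSpace α] {G : α × Torus n → ℝ}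
    (hG : StronglyMeasurable G) (q : ℝ≥0∞) :
    Measurable fun a => eLpNorm (fun x => G (a, x)) q volume := by
  rcases eq_or_ne q 0 with rfl | hq0
  · simp only [eLpNorm_exponent_zero, measurable_const]
  rcases eq_or_ne q ⊤ with rfl | hq
  -- The essential supremum is at most `c` exactly when the section of the superlevel set is null,
  -- and measures of sections are measurable.
  · refine measurable_of_Iic fun c => ?_
    have hs : MeasurableSet {z : α × Torus n | c < ‖G z‖ₑ} :=
      measurableSet_lt measurable_const hG.measurable.enorm
    have e : (fun a => eLpNorm (fun x => G (a, x)) ⊤ (volume : Measure (Torus n))) ⁻¹' Iic c =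
        {a | volume (Prod.mk a ⁻¹' {z : α × Torus n | c < ‖G z‖ₑ}) = 0} := by
      ext a
      simp only [mem_preimage, mem_Iic, eLpNorm_exponent_top, mem_ofPred_eq]
      have h1 : volume (Prod.mk a ⁻¹' {z : α × Torus n | c < ‖G z‖ₑ}) = 0 ↔
          ∀ᵐ x, ‖G (a, x)‖ₑ ≤ c := by
        rw [ae_iff]
        simp only [not_le]
        rfl
      rw [h1]
      constructor
      · intro h
        filter_upwards [ae_le_eLpNormEssSup (f := fun x => G (a, x)) (μ := volume)] with x hx
        exact hx.trans h
      · exact fun h => eLpNormEssSup_le_of_ae_enorm_bound h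
    rw [e]
    exact measurable_measure_prodMk_left hs (measurableSet_singleton 0)
  · simp only [eLpNorm_eq_lintegral_rpow_enorm_toReal hq0 hq]
    refine Measurable.pow_const ?_ _
    exact (hG.measurable.enorm.pow_const _).lintegral_prod_right'

theorem aemeasurable_eLpNorm_slice {α : Type*} [MeasurableSpace α] {μ : Measure α} [SFinite μ]
    {G : α × Torus n → ℝ} (hG : AEStronglyMeasurable G (μ.prod volume)) (q : ℝ≥0∞) :
    AEMeasurable (fun a => eLpNorm (fun x => G (a, x)) q volume) μ := by
  refine ⟨_, measurable_eLpNorm_slice hG.stronglyMeasurable_mk q, ?_⟩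
  filter_upwards [Measure.ae_ae_of_ae_prod hG.ae_eq_mk] with a ha
  exact eLpNorm_congr_ae ha

variable {T : ℝ} {r q : ℝ≥0∞} {G : ℝ → Torus n → ℝ}

theorem eLpNorm_slice_le_mixedNorm
    (hG : AEStronglyMeasurable (fun z : ℝ × Torus n => G z.1 z.2) (cylMeasure n T)) {ρ : ℝ≥0∞}
    (hρ : ρ ≤ r) : eLpNorm (fun t => eLpNorm (G t) q volume) ρ (volume.restrict (Ioo 0 T)) ≤
      mixedNorm T r q G * ENNReal.ofReal T ^ (1 / ρ.toReal - 1 / r.toReal) := by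
  have hm : AEMeasurable (fun t => eLpNorm (G t) q volume) (volume.restrict (Ioo 0 T)) :=
    aemeasurable_eLpNorm_slice (G := fun z : ℝ × Torus n => G z.1 z.2) hG q
  refine (eLpNorm_le_eLpNorm_mul_rpow_measure_univ hρ hm.aestronglyMeasurable).trans_eq ?_
  simp [mixedNorm]

theorem ofReal_rpow_ne_top {T : ℝ} (hT : 0 < T) (e : ℝ) : ENNReal.ofReal T ^ e ≠ ⊤ := by
  rw [ENNReal.ofReal_rpow_of_pos hT]
  exact ENNReal.ofReal_ne_top

theorem lintegral_enorm_le_mixedNorm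
    (hG : AEStronglyMeasurable (fun z : ℝ × Torus n => G z.1 z.2) (cylMeasure n T))
    (hr : 1 ≤ r) (hq : 1 ≤ q) : ∫⁻ z, ‖G z.1 z.2‖ₑ ∂(cylMeasure n T) ≤
      mixedNorm T r q G * ENNReal.ofReal T ^ (1 - 1 / r.toReal) := by
  have h1 := eLpNorm_slice_le_mixedNorm (q := q) hG hr
  rw [eLpNorm_one_eq_lintegral_enorm] at h1
  simp only [enorm_eq_self, ENNReal.toReal_one, div_one] at h1
  refine le_trans ?_ h1
  rw [cylMeasure, lintegral_prod _ hG.enorm]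
  refine lintegral_mono_ae ?_
  filter_upwards [hG.prodMk_left] with t ht
  rw [← eLpNorm_one_eq_lintegral_enorm]
  exact eLpNorm_le_eLpNorm_of_exponent_le hq ht

theorem MemMixed.integrable (hT : 0 < T) (hG : MemMixed T r q G) (hr : 1 ≤ r) (hq : 1 ≤ q) :
    Integrable (fun z : ℝ × Torus n => G z.1 z.2) (cylMeasure n T) :=
  ⟨hG.1, (lintegral_enorm_le_mixedNorm hG.1 hr hq).trans_lt
    (ENNReal.mul_lt_top hG.2 (ofReal_rpow_ne_top hT _).lt_top)⟩

theorem lintegral_rpow_slice_le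
    (hG : AEStronglyMeasurable (fun z : ℝ × Torus n => G z.1 z.2) (cylMeasure n T)) {ρ : ℝ}
    (hρ0 : 0 < ρ) (hρ : ENNReal.ofReal ρ ≤ r) :
    ∫⁻ t in Ioo 0 T, eLpNorm (G t) q volume ^ ρ ≤
      (mixedNorm T r q G * ENNReal.ofReal T ^ (1 / ρ - 1 / r.toReal)) ^ ρ := by
  have h1 := eLpNorm_slice_le_mixedNorm (q := q) hG hρ
  rw [eLpNorm_eq_lintegral_rpow_enorm_toReal (by simpa using hρ0) ENNReal.ofReal_ne_top,
    ENNReal.toReal_ofReal hρ0.le] at h1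
  simp only [enorm_eq_self] at h1
  have h2 := ENNReal.rpow_le_rpow h1 hρ0.le
  rwa [← ENNReal.rpow_mul, one_div_mul_cancel hρ0.ne', ENNReal.rpow_one] at h2

end MixedNorm

/-! ### Averages of a family of fields -/

/-- No integrability is needed: the Bochner integral of a function that is not integrable is `0`. -/
theorem ofReal_integral_le_lintegral_ofReal {α : Type*} [MeasurableSpace α] {ν : Measure α}
    {F : α → ℝ} (hF : ∀ a, 0 ≤ F a) :
    ENNReal.ofReal (∫ a, F a ∂ν) ≤ ∫⁻ a, ENNReal.ofReal (F a) ∂ν := by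
  by_cases h : Integrable F ν
  · exact (ofReal_integral_eq_lintegral_ofReal h (Eventually.of_forall hF)).le
  · simp [integral_undef h]

/-- Nonnegativity of the variance of `‖F‖`. -/
theorem norm_integral_sq_le {α E : Type*} [MeasurableSpace α] {ν : Measure α}
    [IsProbabilityMeasure ν] [NormedAddCommGroup E] [NormedSpace ℝ E] {F : α → E}
    (hF : MemLp F 2 ν) : ‖∫ a, F a ∂ν‖ ^ 2 ≤ ∫ a, ‖F a‖ ^ 2 ∂ν := by
  have hsq : Integrable (fun a => ‖F a‖ ^ 2) ν := hF.integrable_norm_pow two_ne_zero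
  have hn : Integrable (fun a => ‖F a‖) ν := (hF.integrable one_le_two).norm
  set c := ∫ a, ‖F a‖ ∂ν with hc
  have h1 : ‖∫ a, F a ∂ν‖ ≤ c := norm_integral_le_integral_norm _
  have h2 : 0 ≤ ∫ a, (‖F a‖ ^ 2 - (2 * c * ‖F a‖ - c ^ 2)) ∂ν := by
    refine integral_nonneg fun a => ?_
    have := sq_nonneg (‖F a‖ - c)
    simp only [Pi.zero_apply]
    linarith
  have h3 : Integrable (fun a => 2 * c * ‖F a‖ - c ^ 2) ν :=
    (hn.const_mul _).sub (integrable_const _)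
  rw [integral_sub hsq h3, integral_sub (hn.const_mul _) (integrable_const _),
    integral_const_mul, ← hc] at h2
  simp only [integral_const, probReal_univ, one_smul] at h2
  have h4 := pow_le_pow_left₀ (norm_nonneg _) h1 2
  linarith

section Average

variable {n : ℕ} {T : ℝ} {ν : Measure ℝ} [IsProbabilityMeasure ν]
  {G : ℝ → ℝ → Torus n → ℝ} {V : ℝ → ℝ → Torus n → Vec n}

theorem memLp_integral_param
    (hV : MemLp (fun z : ℝ × ℝ × Torus n => V z.1 z.2.1 z.2.2) 2 (ν.prod (cylMeasure n T))) :
    MemLp (fun z : ℝ × Torus n => ∫ θ, V θ z.1 z.2 ∂ν) 2 (cylMeasure n T) := by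
  have hm : AEStronglyMeasurable (fun z : ℝ × Torus n => ∫ θ, V θ z.1 z.2 ∂ν) (cylMeasure n T) :=
    hV.1.prod_swap.integral_prod_right'
  have hsq := hV.integrable_norm_pow two_ne_zero
  rw [memLp_two_iff_integrable_sq_norm hm]
  refine hsq.integral_prod_right.mono' (hm.norm.pow 2) ?_
  have h1 := hsq.prod_left_ae
  have h2 := hV.1.prod_swap.prodMk_left
  filter_upwards [h1, h2] with z h1 h2
  rw [norm_pow, norm_norm]
  exact norm_integral_sq_le ((memLp_two_iff_integrable_sq_norm h2).2 h1)

theorem divLE_integral_param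
    (hV : MemLp (fun z : ℝ × ℝ × Torus n => V z.1 z.2.1 z.2.2) 2 (ν.prod (cylMeasure n T)))
    (hG : Integrable (fun z : ℝ × ℝ × Torus n => G z.1 z.2.1 z.2.2) (ν.prod (cylMeasure n T)))
    (h : ∀ᵐ θ ∂ν, DivLE T (V θ) (G θ)) :
    DivLE T (fun t x => ∫ θ, V θ t x ∂ν) (fun t x => ∫ θ, G θ t x ∂ν) := by
  intro φ hφ hφ0
  have i1 := hφ.integrable_inner (hV.mono_exponent one_le_two) measurable_snd.aemeasurable
  have i2 := hφ.integrable_mul hG measurable_snd.aemeasurable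
  have e1 : ∫ z, inner ℝ (∫ θ, V θ z.1 z.2 ∂ν) (torusGrad (φ z.1) z.2) ∂(cylMeasure n T) =
      ∫ θ, ∫ z, inner ℝ (V θ z.1 z.2) (torusGrad (φ z.1) z.2) ∂(cylMeasure n T) ∂ν := by
    rw [integral_integral_swap i1]
    refine integral_congr_ae ?_
    filter_upwards [(hV.integrable one_le_two).prod_left_ae] with z hz
    have := integral_inner (𝕜 := ℝ) hz (torusGrad (φ z.1) z.2)
    rw [real_inner_comm, ← this]
    exact integral_congr_ae (Eventually.of_forall fun θ => real_inner_comm _ _)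
  have e2 : ∫ z, (∫ θ, G θ z.1 z.2 ∂ν) * φ z.1 z.2 ∂(cylMeasure n T) =
      ∫ θ, ∫ z, G θ z.1 z.2 * φ z.1 z.2 ∂(cylMeasure n T) ∂ν := by
    rw [integral_integral_swap i2]
    simp only [integral_mul_const]
  simp only
  rw [e1, e2, ← integral_neg]
  refine integral_mono_ae i1.integral_prod_left.neg i2.integral_prod_left ?_
  filter_upwards [h] with θ hθ
  exact hθ φ hφ hφ0

theorem integrable_family {r q : ℝ≥0∞} {K : ℝ≥0} (hT : 0 < T) (hr : 1 ≤ r) (hq : 1 ≤ q)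
    (hG : AEStronglyMeasurable (fun z : ℝ × ℝ × Torus n => G z.1 z.2.1 z.2.2)
      (ν.prod (cylMeasure n T))) (hK : ∀ᵐ θ ∂ν, mixedNorm T r q (G θ) ≤ K) :
    Integrable (fun z : ℝ × ℝ × Torus n => G z.1 z.2.1 z.2.2) (ν.prod (cylMeasure n T)) := by
  refine ⟨hG, ?_⟩
  rw [HasFiniteIntegral, lintegral_prod _ hG.enorm]
  have h1 : ∫⁻ θ, ∫⁻ z, ‖G θ z.1 z.2‖ₑ ∂(cylMeasure n T) ∂ν ≤
      ∫⁻ _, (K : ℝ≥0∞) * ENNReal.ofReal T ^ (1 - 1 / r.toReal) ∂ν := by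
    refine lintegral_mono_ae ?_
    filter_upwards [hG.prodMk_left, hK] with θ h1 h2
    exact (lintegral_enorm_le_mixedNorm h1 hr hq).trans (mul_le_mul_left h2 _)
  refine h1.trans_lt ?_
  rw [lintegral_const, measure_univ, mul_one]
  exact ENNReal.mul_lt_top ENNReal.coe_lt_top (ofReal_rpow_ne_top hT _).lt_top

/-- The form bound of an average of weights. -/
theorem exists_formBound_integral_param {r q : ℝ≥0∞} {K : ℝ≥0} (hT : 0 < T)
    {ρ : ℝ} (hρ0 : 0 < ρ) (hρ : ENNReal.ofReal ρ ≤ r)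
    (hG : AEStronglyMeasurable (fun z : ℝ × ℝ × Torus n => G z.1 z.2.1 z.2.2)
      (ν.prod (cylMeasure n T))) (hG0 : ∀ θ t x, 0 ≤ G θ t x)
    (hK : ∀ᵐ θ ∂ν, mixedNorm T r q (G θ) ≤ K) {δ C : ℝ} (hδ : 0 ≤ δ) (hC : 0 ≤ C)
    (hform : ∀ G : Torus n → ℝ, (∀ x, 0 ≤ G x) → MemLp G q volume →
      IsFormBound G δ (C * (1 + (eLpNorm G q volume).toReal ^ ρ))) :
    ∃ a : ℝ → ℝ, (∀ t, 0 ≤ a t) ∧ IntegrableOn a (Ioo 0 T) ∧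
      ∫ t in Ioo 0 T, a t ≤ (ENNReal.ofReal C * (ENNReal.ofReal T +
        (K * ENNReal.ofReal T ^ (1 / ρ - 1 / r.toReal)) ^ ρ)).toReal ∧
      ∀ᵐ t ∂(volume.restrict (Ioo 0 T)), IsFormBound (fun x => ∫ θ, G θ t x ∂ν) δ (a t) := by
  set μ : Measure ℝ := volume.restrict (Ioo 0 T) with hμ
  set M : ℝ≥0∞ := ENNReal.ofReal C * (ENNReal.ofReal T +
    (K * ENNReal.ofReal T ^ (1 / ρ - 1 / r.toReal)) ^ ρ) with hM
  have hMtop : M ≠ ⊤ := ENNReal.mul_ne_top ENNReal.ofReal_ne_top (ENNReal.add_ne_top.2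
    ⟨ENNReal.ofReal_ne_top, ENNReal.rpow_ne_top_of_nonneg hρ0.le
      (ENNReal.mul_ne_top ENNReal.coe_ne_top (ofReal_rpow_ne_top hT _))⟩)
  -- The form inequality is linear in the weight, so its average over `θ` is a form bound for the
  -- averaged weight, with the averaged remainder. No mixed norm of the average has to be estimated.
  set k : ℝ → ℝ → ℝ≥0∞ := fun θ t =>
    ENNReal.ofReal C * (1 + eLpNorm (G θ t) q volume ^ ρ) with hk
  have hmp1 := measurePreserving_prodAssoc ν μ (volume : Measure (Torus n))
  have hG1 : AEStronglyMeasurable (fun z : (ℝ × ℝ) × Torus n => G z.1.1 z.1.2 z.2)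
      ((ν.prod μ).prod volume) := hG.comp_measurePreserving hmp1
  have hmp2 : MeasurePreserving (fun z : ℝ × ℝ × Torus n => (z.2.1, z.1, z.2.2))
      (μ.prod (ν.prod volume)) (ν.prod (μ.prod (volume : Measure (Torus n)))) := by
    have h1 := (measurePreserving_prodAssoc μ ν (volume : Measure (Torus n))).symm
      MeasurableEquiv.prodAssoc
    have h2 := (Measure.measurePreserving_swap (μ := μ) (ν := ν)).prod
      (MeasurePreserving.id (volume : Measure (Torus n)))
    exact hmp1.comp (h2.comp h1)
  have hG2 : AEStronglyMeasurable (fun z : ℝ × ℝ × Torus n => G z.2.1 z.1 z.2.2)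
      (μ.prod (ν.prod volume)) := hG.comp_measurePreserving hmp2
  have hΓm : AEMeasurable (fun z : ℝ × ℝ => eLpNorm (G z.1 z.2) q volume) (ν.prod μ) :=
    aemeasurable_eLpNorm_slice (G := fun z : (ℝ × ℝ) × Torus n => G z.1.1 z.1.2 z.2) hG1 q
  have hkm : AEMeasurable (Function.uncurry k) (ν.prod μ) :=
    ((hΓm.pow_const ρ).const_add 1).const_mul _
  have hkθ : ∀ᵐ θ ∂ν, ∫⁻ t, k θ t ∂μ ≤ M := by
    filter_upwards [hG.prodMk_left, hK] with θ h1 h2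
    simp only [hk]
    rw [lintegral_const_mul' _ _ ENNReal.ofReal_ne_top, lintegral_add_left measurable_const, hM]
    gcongr
    · simp [hμ]
    · exact (lintegral_rpow_slice_le h1 hρ0 hρ).trans
        (ENNReal.rpow_le_rpow (mul_le_mul_left h2 _) hρ0.le)
  have hktot : ∫⁻ t, ∫⁻ θ, k θ t ∂ν ∂μ ≤ M := by
    rw [← lintegral_lintegral_swap hkm]
    refine (lintegral_mono_ae hkθ).trans_eq ?_
    rw [lintegral_const, measure_univ, mul_one]
  have hkt : AEMeasurable (fun t => ∫⁻ θ, k θ t ∂ν) μ := hkm.lintegral_prod_left'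
  have hktop : ∀ᵐ t ∂μ, ∫⁻ θ, k θ t ∂ν < ⊤ :=
    ae_lt_top' hkt (hktot.trans_lt hMtop.lt_top).ne
  refine ⟨fun t => (∫⁻ θ, k θ t ∂ν).toReal, fun t => ENNReal.toReal_nonneg,
    integrable_toReal_of_lintegral_ne_top hkt (hktot.trans_lt hMtop.lt_top).ne, ?_, ?_⟩
  · rw [integral_toReal hkt hktop]
    exact ENNReal.toReal_mono hMtop hktot
  -- The form bound requires slices in `L^q`; finiteness follows from that of the integral of the
  -- `ρ`-th powers of the norms.
  have hfin : ∀ᵐ t ∂μ, ∀ᵐ θ ∂ν, eLpNorm (G θ t) q volume < ⊤ := by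
    have h1 : ∀ᵐ z ∂(ν.prod μ), eLpNorm (G z.1 z.2) q volume < ⊤ := by
      have h2 : ∫⁻ z, eLpNorm (G z.1 z.2) q volume ^ ρ ∂(ν.prod μ) ≠ ⊤ := by
        rw [lintegral_prod _ (hΓm.pow_const ρ)]
        have h3 : ∫⁻ θ, ∫⁻ t, eLpNorm (G θ t) q volume ^ ρ ∂μ ∂ν ≤
            ∫⁻ _, (K * ENNReal.ofReal T ^ (1 / ρ - 1 / r.toReal)) ^ ρ ∂ν := by
          refine lintegral_mono_ae ?_
          filter_upwards [hG.prodMk_left, hK] with θ h1 h2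
          exact (lintegral_rpow_slice_le h1 hρ0 hρ).trans
            (ENNReal.rpow_le_rpow (mul_le_mul_left h2 _) hρ0.le)
        refine (h3.trans_lt ?_).ne
        rw [lintegral_const, measure_univ, mul_one]
        exact ENNReal.rpow_lt_top_of_nonneg hρ0.le
          (ENNReal.mul_ne_top ENNReal.coe_ne_top (ofReal_rpow_ne_top hT _))
      filter_upwards [ae_lt_top' (hΓm.pow_const ρ) h2] with z hz
      exact (ENNReal.rpow_lt_top_iff_of_pos hρ0).1 hz
    exact Measure.ae_ae_of_ae_prod
      ((Measure.measurePreserving_swap (μ := μ) (ν := ν)).quasiMeasurePreserving.ae h1)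
  filter_upwards [hktop, hfin, hG2.prodMk_left] with t h1 h2 h3
  have h3' : ∀ᵐ θ ∂ν, AEStronglyMeasurable (G θ t) volume := h3.prodMk_left
  intro v Dv hv hD hvD
  set S := ∫ x, v x ^ 2 with hS
  set D := ∫ x, ‖Dv x‖ ^ 2 with hDdef
  have hS0 : 0 ≤ S := integral_nonneg fun x => sq_nonneg _
  have hD0 : 0 ≤ D := integral_nonneg fun x => sq_nonneg _
  have hGv : AEMeasurable (Function.uncurry fun θ x => ENNReal.ofReal (G θ t x * v x ^ 2))
      (ν.prod volume) :=
    (h3.mul ((hv.1.pow 2).comp_snd)).aemeasurable.ennreal_ofReal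
  calc ∫⁻ x, ENNReal.ofReal ((∫ θ, G θ t x ∂ν) * v x ^ 2)
      ≤ ∫⁻ x, ∫⁻ θ, ENNReal.ofReal (G θ t x * v x ^ 2) ∂ν := by
        refine lintegral_mono fun x => ?_
        rw [← integral_mul_const]
        exact ofReal_integral_le_lintegral_ofReal fun θ => mul_nonneg (hG0 _ _ _) (sq_nonneg _)
    _ = ∫⁻ θ, (∫⁻ x, ENNReal.ofReal (G θ t x * v x ^ 2)) ∂ν := (lintegral_lintegral_swap hGv).symm
    _ ≤ ∫⁻ θ, (ENNReal.ofReal (δ * D) + k θ t * ENNReal.ofReal S) ∂ν := by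
        refine lintegral_mono_ae ?_
        filter_upwards [h2, h3'] with θ h4 h5
        refine (hform _ (hG0 θ t) ⟨h5, h4⟩ v Dv hv hD hvD).trans ?_
        have h6 : 0 ≤ C * (1 + (eLpNorm (G θ t) q volume).toReal ^ ρ) := by positivity
        rw [ENNReal.ofReal_add (by positivity) (by positivity), ENNReal.ofReal_mul h6]
        gcongr
        rw [ENNReal.ofReal_mul hC, ENNReal.ofReal_add zero_le_one (by positivity),
          ENNReal.ofReal_one, ← ENNReal.ofReal_rpow_of_nonneg ENNReal.toReal_nonneg hρ0.le,
          ENNReal.ofReal_toReal h4.ne]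
    _ = ENNReal.ofReal (δ * D) + (∫⁻ θ, k θ t ∂ν) * ENNReal.ofReal S := by
        rw [lintegral_add_left measurable_const, lintegral_mul_const' _ _ ENNReal.ofReal_ne_top,
          lintegral_const, measure_univ, mul_one]
    _ = ENNReal.ofReal (δ * D + (∫⁻ θ, k θ t ∂ν).toReal * S) := by
        rw [ENNReal.ofReal_add (by positivity) (by positivity),
          ENNReal.ofReal_mul ENNReal.toReal_nonneg, ENNReal.ofReal_toReal h1.ne]

end Average

/-! ### The main estimate -/

/-- With `α = n/(2q)`, the condition `α + 1/r ≤ 1` says `1/(1-α) ≤ r`. Hence the power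
`‖G(t)‖_q^{1/(1-α)}` in the form bound is integrable in time. -/
theorem exponent_facts {n : ℕ} {q r : ℝ≥0∞} (hqn : (n : ℝ≥0∞) / 2 < q)
    (hqr : (n : ℝ≥0∞) / (2 * q) + 1 / r ≤ 1) :
    (n : ℝ) / (2 * q.toReal) < 1 ∧ 1 ≤ r ∧
      ENNReal.ofReal (1 - (n : ℝ) / (2 * q.toReal))⁻¹ ≤ r := by
  have h1 : (n : ℝ) / (2 * q.toReal) < 1 := by
    rcases eq_or_ne q ⊤ with rfl | hq
    · simp
    · have h2 := (ENNReal.toReal_lt_toReal (hqn.trans_le le_top).ne hq).2 hqn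
      simp only [ENNReal.toReal_div, ENNReal.toReal_natCast, ENNReal.toReal_ofNat] at h2
      have h3 : 0 < q.toReal := lt_of_le_of_lt (by positivity) h2
      rw [div_lt_one (by positivity)]
      linarith
  have h2 : 1 / r ≤ 1 := le_add_self.trans hqr
  have h3 : 1 ≤ r := by
    rw [one_div] at h2
    exact ENNReal.inv_le_one.1 h2
  refine ⟨h1, h3, ?_⟩
  have hα0 : 0 ≤ (n : ℝ) / (2 * q.toReal) := by positivity
  have h4 : ((n : ℝ≥0∞) / (2 * q)).toReal + (1 / r).toReal ≤ 1 := by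
    have := ENNReal.toReal_mono ENNReal.one_ne_top hqr
    rwa [ENNReal.toReal_add ((le_self_add.trans hqr).trans_lt ENNReal.one_lt_top).ne
      (h2.trans_lt ENNReal.one_lt_top).ne, ENNReal.toReal_one] at this
  simp only [ENNReal.toReal_div, ENNReal.toReal_mul, ENNReal.toReal_natCast,
    ENNReal.toReal_ofNat] at h4
  rw [ENNReal.ofReal_inv_of_pos (by linarith), ENNReal.inv_le_iff_inv_le, ← one_div]
  rw [← ENNReal.ofReal_toReal (h2.trans_lt ENNReal.one_lt_top).ne]
  refine ENNReal.ofReal_le_ofReal ?_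
  rw [ENNReal.toReal_div]
  linarith

instance unitInterval_isProbabilityMeasure :
    IsProbabilityMeasure (volume.restrict (Icc (0 : ℝ) 1)) :=
  ⟨by simp⟩

/-! ### Time integrability of the source norms, and the estimate for general Hamiltonians. -/

section Source

variable {n : ℕ} {T : ℝ} {p : ℝ≥0∞} {f₁ f₂ : ℝ → Torus n → ℝ}

theorem MemMixed.aemeasurable_eLpNorm_sub (h₁ : MemMixed T 1 p f₁) (h₂ : MemMixed T 1 p f₂) :
    AEMeasurable (fun t => eLpNorm (f₁ t - f₂ t) p volume) (volume.restrict (Ioo 0 T)) :=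
  aemeasurable_eLpNorm_slice (G := fun z : ℝ × Torus n => f₁ z.1 z.2 - f₂ z.1 z.2)
    (h₁.1.sub h₂.1) p

theorem MemMixed.lintegral_eLpNorm_sub_lt_top (hp : 1 ≤ p) (h₁ : MemMixed T 1 p f₁)
    (h₂ : MemMixed T 1 p f₂) : ∫⁻ t in Ioo 0 T, eLpNorm (f₁ t - f₂ t) p volume < ⊤ := by
  have hn : ∀ {f : ℝ → Torus n → ℝ}, MemMixed T 1 p f →
      ∫⁻ t in Ioo 0 T, eLpNorm (f t) p volume < ⊤ := fun h => by
    have := h.2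
    rw [mixedNorm, eLpNorm_one_eq_lintegral_enorm] at this
    simpa only [enorm_eq_self] using this
  have hm : AEMeasurable (fun t => eLpNorm (f₁ t) p volume) (volume.restrict (Ioo 0 T)) :=
    aemeasurable_eLpNorm_slice (G := fun z : ℝ × Torus n => f₁ z.1 z.2) h₁.1 p
  calc ∫⁻ t in Ioo 0 T, eLpNorm (f₁ t - f₂ t) p volume
      ≤ ∫⁻ t in Ioo 0 T, (eLpNorm (f₁ t) p volume + eLpNorm (f₂ t) p volume) := by
        refine lintegral_mono_ae ?_
        filter_upwards [h₁.1.prodMk_left, h₂.1.prodMk_left] with t a1 a2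
        exact eLpNorm_sub_le a1 a2 hp
    _ = _ := lintegral_add_left' hm _
    _ < ⊤ := ENNReal.add_lt_top.2 ⟨hn h₁, hn h₂⟩

end Source

theorem exists_eLpNorm_sub_le {n : ℕ} {ε T : ℝ} (hε : 0 < ε) (hT : 0 < T)
    {p q r : ℝ≥0∞} (hp : 1 < p) (hp' : p < ⊤) (hq : 1 ≤ q) (hqn : (n : ℝ≥0∞) / 2 < q)
    (hqr : (n : ℝ≥0∞) / (2 * q) + 1 / r ≤ 1) (K : ℝ≥0) :
    ∃ C : ℝ≥0, ∀ (H : Torus n → ℝ → Vec n → ℝ) (f₁ f₂ : ℝ → Torus n → ℝ) (g₁ g₂ : Torus n → ℝ)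
        (u₁ u₂ : ℝ → Torus n → ℝ) (Du₁ Du₂ : ℝ → Torus n → Vec n),
        IsHamiltonian T H →
        MemLp g₁ p volume → MemLp g₂ p volume → MemMixed T 1 p f₁ → MemMixed T 1 p f₂ →
        IsEnergySolution ε T H f₁ g₁ u₁ Du₁ → IsEnergySolution ε T H f₂ g₂ u₂ Du₂ →
        MemLp (fun z : ℝ × ℝ × Torus n => segmentField H Du₁ Du₂ z.1 z.2.1 z.2.2) 2
          ((volume.restrict (Icc (0 : ℝ) 1)).prod (cylMeasure n T)) →
        DivPosPartBound T r q K (segmentField H Du₁ Du₂) →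
        ∀ t ∈ Ioo 0 T, eLpNorm (u₁ t - u₂ t) p volume ≤
          C * (eLpNorm (g₁ - g₂) p volume
            + ∫⁻ s in Ioo 0 T, eLpNorm (f₁ s - f₂ s) p volume) := by
  obtain ⟨hα1, hr, hρ⟩ := exponent_facts hqn hqr
  set α : ℝ := (n : ℝ) / (2 * q.toReal) with hα
  have hρ0 : 0 < (1 - α)⁻¹ := inv_pos.2 (by linarith)
  have hpr : 1 < p.toReal := by
    simpa using (ENNReal.toReal_lt_toReal ENNReal.one_ne_top hp'.ne).2 hp
  have hpo : ENNReal.ofReal p.toReal = p := ENNReal.ofReal_toReal hp'.ne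
  set A := profileConst p.toReal with hA
  have hA0 : 0 ≤ A := profileConst_nonneg hpr
  -- Small enough for `δ A/4 ≤ ε`; the summand `1` keeps the denominator positive.
  set δ : ℝ := 4 * ε / (1 + A) with hδ
  have hδ0 : 0 < δ := by positivity
  have hδA : δ * (A / 4) ≤ ε := by
    rw [hδ, div_mul_eq_mul_div, div_le_iff₀ (by positivity)]
    nlinarith
  obtain ⟨C₀, hC₀, hform⟩ := exists_weight_interpolation (n := n) hq hα hα1 hδ0
  -- A bound for the time integral of the form remainder. It is fixed before `H` and the solutions,
  -- which makes the final constant uniform.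
  set M : ℝ := (ENNReal.ofReal C₀ * (ENNReal.ofReal T + (K * ENNReal.ofReal T ^
    (1 / (1 - α)⁻¹ - 1 / r.toReal)) ^ (1 - α)⁻¹)).toReal with hM
  -- The factor `1 + A` dominates the coefficient `1` of the terminal data and the coefficient `A`
  -- of the source.
  refine ⟨(Real.exp M * (1 + A)).toNNReal, ?_⟩
  intro H f₁ f₂ g₁ g₂ u₁ u₂ Du₁ Du₂ hH hg₁ hg₂ hf₁ hf₂ hu₁ hu₂ hV hdiv t ht
  obtain ⟨G, hGm, hG0, hGθ⟩ := hdiv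
  have hK : ∀ᵐ θ ∂(volume.restrict (Icc (0 : ℝ) 1)), mixedNorm T r q (G θ) ≤ K :=
    hGθ.mono fun θ h => h.2.1
  have hGi := integrable_family hT hr hq hGm hK
  have hf₁i := hf₁.integrable hT le_rfl hp.le
  have hf₂i := hf₂.integrable hT le_rfl hp.le
  have hw := hu₁.isHeatSolution_sub hu₂ hf₁i hf₂i
  obtain ⟨a, ha0, hai, haM, haG⟩ := exists_formBound_integral_param hT hρ0 hρ hGm hG0 hK
    hδ0.le hC₀ fun G hG0 hG v Dv hv hD h => hform G v Dv hG0 hG hv hD h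
  -- The difference of the Hamiltonians is exactly linear in `Du₁ - Du₂`, with the averaged field as
  -- coefficient.
  have hR : ∀ᵐ z ∂(cylMeasure n T),
      (H z.2 z.1 (Du₁ z.1 z.2) - H z.2 z.1 (Du₂ z.1 z.2)) - (f₁ z.1 z.2 - f₂ z.1 z.2) =
        inner ℝ (∫ θ in Icc (0 : ℝ) 1, segmentField H Du₁ Du₂ θ z.1 z.2)
          (Du₁ z.1 z.2 - Du₂ z.1 z.2) - (f₁ z.1 z.2 - f₂ z.1 z.2) := by
    filter_upwards [hH.contDiff] with z hz
    rw [sub_eq_inner_integral_gradient hz]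
    rfl
  have hNm := hf₁.aemeasurable_eLpNorm_sub hf₂
  have hNtop := hf₁.lintegral_eLpNorm_sub_lt_top hp.le hf₂
  have hNlt := ae_lt_top' hNm hNtop.ne
  have hwT : (fun x => u₁ T x - u₂ T x) =ᵐ[volume] g₁ - g₂ := by
    filter_upwards [hu₁.terminal, hu₂.terminal] with x h1 h2
    simp [h1, h2]
  have hg : MemLp (g₁ - g₂) p volume := hg₁.sub hg₂
  have hest := hw.eLpNorm_le (memLp_integral_param hV) hGi.integral_prod_right
    (fun t x => integral_nonneg fun θ => hG0 θ t x)
    (divLE_integral_param hV hGi (hGθ.mono fun θ h => h.2.2)) (hf₁i.sub hf₂i) hR hpr hδ0.le hδA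
    ha0 hai (fun t => ENNReal.toReal_nonneg)
    (integrable_toReal_of_lintegral_ne_top hNm hNtop.ne) haG
    (by
      filter_upwards [hNlt] with t ht
      rw [ENNReal.ofReal_toReal ht.ne, hpo])
    (by rw [hpo]; exact (memLp_congr_ae hwT).2 hg) (Ioo_subset_Icc_self ht)
  rw [hpo, eLpNorm_congr_ae hwT, integral_toReal hNm hNlt] at hest
  refine hest.trans ?_
  have key : ∀ X Y : ℝ≥0∞, X ≠ ⊤ → Y ≠ ⊤ → ENNReal.ofReal (Real.exp (∫ t in Ioo 0 T, a t) *
      (X.toReal + A * Y.toReal)) ≤ ((Real.exp M * (1 + A)).toNNReal : ℝ≥0∞) * (X + Y) := by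
    intro X Y hX hY
    rw [← ENNReal.ofReal_toReal (ENNReal.add_ne_top.2 ⟨hX, hY⟩), ENNReal.toReal_add hX hY,
      ← ENNReal.ofReal, ← ENNReal.ofReal_mul (by positivity)]
    refine ENNReal.ofReal_le_ofReal ?_
    have hX0 : 0 ≤ X.toReal := ENNReal.toReal_nonneg
    have hY0 : 0 ≤ Y.toReal := ENNReal.toReal_nonneg
    rw [mul_assoc (Real.exp M)]
    refine mul_le_mul (Real.exp_le_exp.2 haM) ?_ (by positivity) (Real.exp_pos _).le
    nlinarith [mul_nonneg hA0 hX0]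
  exact key _ _ hg.2.ne hNtop.ne

/-! ### Quadratic Hamiltonians -/

section Quadratic

variable {n : ℕ} {ε T : ℝ}

theorem gradient_norm_sq_div_two (ξ : Vec n) : gradient (fun ξ : Vec n => ‖ξ‖ ^ 2 / 2) ξ = ξ := by
  refine HasGradientAt.gradient ?_
  rw [hasGradientAt_iff_hasFDerivAt]
  have h := ((hasStrictFDerivAt_norm_sq ξ).hasFDerivAt).mul_const (1 / 2 : ℝ)
  simp only [mul_one_div] at h
  refine h.congr_fderiv ?_
  ext η
  simp

theorem isHamiltonian_norm_sq (T : ℝ) :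
    IsHamiltonian T fun (_ : Torus n) (_ : ℝ) (ξ : Vec n) => ‖ξ‖ ^ 2 / 2 where
  measurable _ := aestronglyMeasurable_const
  contDiff := Eventually.of_forall fun _ => (contDiff_norm_sq ℝ).div_const 2

theorem segmentField_norm_sq (Du₁ Du₂ : ℝ → Torus n → Vec n) (θ t : ℝ) (x : Torus n) :
    segmentField (fun _ _ ξ => ‖ξ‖ ^ 2 / 2) Du₁ Du₂ θ t x =
      θ • Du₁ t x + (1 - θ) • Du₂ t x :=
  gradient_norm_sq_div_two _

theorem memLp_segment {Du₁ Du₂ : ℝ → Torus n → Vec n}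
    (h₁ : MemLp (fun z : ℝ × Torus n => Du₁ z.1 z.2) 2 (cylMeasure n T))
    (h₂ : MemLp (fun z : ℝ × Torus n => Du₂ z.1 z.2) 2 (cylMeasure n T)) :
    MemLp (fun z : ℝ × ℝ × Torus n => z.1 • Du₁ z.2.1 z.2.2 + (1 - z.1) • Du₂ z.2.1 z.2.2) 2
      ((volume.restrict (Icc (0 : ℝ) 1)).prod (cylMeasure n T)) := by
  have hθ : ∀ᵐ z ∂((volume.restrict (Icc (0 : ℝ) 1)).prod (cylMeasure n T)),
      z.1 ∈ Icc (0 : ℝ) 1 :=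
    Measure.quasiMeasurePreserving_fst.ae (ae_restrict_mem measurableSet_Icc)
  have key : ∀ {c : ℝ → ℝ} {D : ℝ → Torus n → Vec n}, Continuous c →
      (∀ θ ∈ Icc (0 : ℝ) 1, |c θ| ≤ 1) →
      MemLp (fun z : ℝ × Torus n => D z.1 z.2) 2 (cylMeasure n T) →
      MemLp (fun z : ℝ × ℝ × Torus n => c z.1 • D z.2.1 z.2.2) 2
        ((volume.restrict (Icc (0 : ℝ) 1)).prod (cylMeasure n T)) := by
    intro c D hc hc1 hD
    have hD' : MemLp (fun z : ℝ × ℝ × Torus n => D z.2.1 z.2.2) 2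
        ((volume.restrict (Icc (0 : ℝ) 1)).prod (cylMeasure n T)) := hD.comp_snd _
    refine hD'.of_le ((hc.comp continuous_fst).aestronglyMeasurable.smul hD'.1) ?_
    filter_upwards [hθ] with z hz
    rw [norm_smul]
    exact mul_le_of_le_one_left (norm_nonneg _) (hc1 _ hz)
  refine (key continuous_id (fun θ hθ => ?_) h₁).add
    (key (c := fun θ => 1 - θ) (by fun_prop) (fun θ hθ => ?_) h₂)
  · rw [id, abs_of_nonneg hθ.1]; exact hθ.2
  · rw [abs_of_nonneg (by linarith [hθ.2])]; linarith [hθ.1]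

/-- A common one-sided bound survives convex combinations. The positive part of `k` is taken because
the weight has to be nonnegative. -/
theorem divLE_segment {Du₁ Du₂ : ℝ → Torus n → Vec n} {k : ℝ → Torus n → ℝ}
    (h₁ : MemLp (fun z : ℝ × Torus n => Du₁ z.1 z.2) 2 (cylMeasure n T))
    (h₂ : MemLp (fun z : ℝ × Torus n => Du₂ z.1 z.2) 2 (cylMeasure n T))
    (hk : Integrable (fun z : ℝ × Torus n => k z.1 z.2) (cylMeasure n T))
    (hd₁ : DivLE T Du₁ k) (hd₂ : DivLE T Du₂ k) {θ : ℝ} (hθ : θ ∈ Icc (0 : ℝ) 1) :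
    DivLE T (fun t x => θ • Du₁ t x + (1 - θ) • Du₂ t x) (fun t x => max (k t x) 0) := by
  intro φ hφ hφ0
  have hid : AEMeasurable (fun z : ℝ × Torus n => z) (cylMeasure n T) := aemeasurable_id
  have b1 := hφ.integrable_inner (h₁.mono_exponent one_le_two) hid
  have b2 := hφ.integrable_inner (h₂.mono_exponent one_le_two) hid
  have hk' := integral_mono (hφ.integrable_mul hk hid) (hφ.integrable_mul hk.pos_part hid)
    fun z => mul_le_mul_of_nonneg_right (le_max_left (k z.1 z.2) 0) (hφ0 z.1 z.2)
  have a1 := mul_le_mul_of_nonneg_left (hd₁ φ hφ hφ0) hθ.1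
  have a2 := mul_le_mul_of_nonneg_left (hd₂ φ hφ hφ0) (by linarith [hθ.2] : 0 ≤ 1 - θ)
  simp only [inner_add_left, real_inner_smul_left]
  rw [integral_add (b1.const_mul θ) (b2.const_mul (1 - θ)), integral_const_mul, integral_const_mul]
  linarith

theorem mixedNorm_posPart_le {r q : ℝ≥0∞} (k : ℝ → Torus n → ℝ) :
    mixedNorm T r q (fun t x => max (k t x) 0) ≤ mixedNorm T r q k := by
  refine eLpNorm_mono_enorm fun t => ?_
  simp only [enorm_eq_self]
  refine eLpNorm_mono fun x => ?_
  rw [Real.norm_of_nonneg (le_max_right _ _)]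
  exact max_le (le_abs_self _) (abs_nonneg _)

theorem divPosPartBound_segment {r q : ℝ≥0∞} {K : ℝ≥0} (hT : 0 < T) (hr : 1 ≤ r) (hq : 1 ≤ q)
    {Du₁ Du₂ : ℝ → Torus n → Vec n} {k : ℝ → Torus n → ℝ}
    (h₁ : MemLp (fun z : ℝ × Torus n => Du₁ z.1 z.2) 2 (cylMeasure n T))
    (h₂ : MemLp (fun z : ℝ × Torus n => Du₂ z.1 z.2) 2 (cylMeasure n T))
    (hk : MemMixed T r q k) (hkK : mixedNorm T r q k ≤ K)
    (hd₁ : DivLE T Du₁ k) (hd₂ : DivLE T Du₂ k) :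
    DivPosPartBound T r q K (fun θ t x => θ • Du₁ t x + (1 - θ) • Du₂ t x) := by
  have hm : AEStronglyMeasurable (fun z : ℝ × Torus n => max (k z.1 z.2) 0) (cylMeasure n T) :=
    (continuous_id.max continuous_const).comp_aestronglyMeasurable hk.1
  refine ⟨fun _ t x => max (k t x) 0, hm.comp_snd, fun _ _ _ => le_max_right _ _, ?_⟩
  filter_upwards [ae_restrict_mem measurableSet_Icc] with θ hθ
  exact ⟨⟨hm, (mixedNorm_posPart_le k).trans_lt hk.2⟩, (mixedNorm_posPart_le k).trans hkK,
    divLE_segment h₁ h₂ (hk.integrable hT hr hq) hd₁ hd₂ hθ⟩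

end Quadratic

/-- If two solutions agree at all interior times, they agree at the initial time. -/
theorem IsHeatSolution.ae_eq_zero_initial {n : ℕ} {ε T : ℝ} {w : ℝ → Torus n → ℝ}
    {Dw : ℝ → Torus n → Vec n} {R : ℝ → Torus n → ℝ} (h : IsHeatSolution ε T w Dw R) (hT : 0 < T)
    (h0 : ∀ t ∈ Ioo 0 T, w t =ᵐ[volume] 0) : w 0 =ᵐ[volume] 0 := by
  have h1 := (h.continuous 0 ⟨le_rfl, hT.le⟩).mono_left
    (nhdsWithin_mono 0 (Ioo_subset_Icc_self (a := (0 : ℝ)) (b := T)))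
  have hne : (𝓝[Ioo 0 T] (0 : ℝ)).NeBot := left_nhdsWithin_Ioo_neBot hT
  have h2 : Tendsto (fun s => eLpNorm (w s - w 0) 2 volume) (𝓝[Ioo 0 T] 0)
      (𝓝 (eLpNorm (w 0) 2 volume)) := by
    refine tendsto_const_nhds.congr' ?_
    filter_upwards [self_mem_nhdsWithin] with s hs
    rw [← eLpNorm_neg]
    refine eLpNorm_congr_ae ?_
    filter_upwards [h0 s hs] with x hx
    simp [hx]
  have h3 := tendsto_nhds_unique h2 h1
  exact (eLpNorm_eq_zero_iff (h.memLp_slice 0 ⟨le_rfl, hT.le⟩).1 two_ne_zero).1 h3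

/-! ### The main theorem. -/

theorem mainTheorem5 (n : ℕ) (hn : 1 ≤ n) (ε T : ℝ) (hε : 0 < ε) (hT : 0 < T)
    (p q r : ℝ≥0∞) (hp : 1 < p) (hp' : p < ⊤)
    (hq : 1 ≤ q) (hqn : (n : ℝ≥0∞) / 2 < q) (hqr : (n : ℝ≥0∞) / (2 * q) + 1 / r ≤ 1)
    (K : ℝ≥0) :
    ∃ C : ℝ≥0,
      (∀ (H : Torus n → ℝ → Vec n → ℝ) (f₁ f₂ : ℝ → Torus n → ℝ) (g₁ g₂ : Torus n → ℝ)
        (u₁ u₂ : ℝ → Torus n → ℝ) (Du₁ Du₂ : ℝ → Torus n → Vec n),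
        IsHamiltonian T H →
        MemLp g₁ p volume → MemLp g₂ p volume → MemMixed T 1 p f₁ → MemMixed T 1 p f₂ →
        IsEnergySolution ε T H f₁ g₁ u₁ Du₁ → IsEnergySolution ε T H f₂ g₂ u₂ Du₂ →
        MemLp (fun z : ℝ × ℝ × Torus n => segmentField H Du₁ Du₂ z.1 z.2.1 z.2.2) 2
          ((volume.restrict (Icc (0 : ℝ) 1)).prod (cylMeasure n T)) →
        DivPosPartBound T r q K (segmentField H Du₁ Du₂) →
        ∀ t ∈ Ioo 0 T, eLpNorm (u₁ t - u₂ t) p volume ≤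
          C * (eLpNorm (g₁ - g₂) p volume
            + ∫⁻ s in Ioo 0 T, eLpNorm (f₁ s - f₂ s) p volume)) ∧
      (∀ (f₁ f₂ : ℝ → Torus n → ℝ) (g₁ g₂ : Torus n → ℝ)
        (u₁ u₂ : ℝ → Torus n → ℝ) (Du₁ Du₂ : ℝ → Torus n → Vec n) (k : ℝ → Torus n → ℝ),
        MemLp g₁ p volume → MemLp g₂ p volume → MemMixed T 1 p f₁ → MemMixed T 1 p f₂ →
        IsEnergySolution ε T (fun _ _ ξ => ‖ξ‖ ^ 2 / 2) f₁ g₁ u₁ Du₁ →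
        IsEnergySolution ε T (fun _ _ ξ => ‖ξ‖ ^ 2 / 2) f₂ g₂ u₂ Du₂ →
        MemMixed T r q k → mixedNorm T r q k ≤ K → DivLE T Du₁ k → DivLE T Du₂ k →
        (∀ t ∈ Ioo 0 T, eLpNorm (u₁ t - u₂ t) p volume ≤
          C * (eLpNorm (g₁ - g₂) p volume
            + ∫⁻ s in Ioo 0 T, eLpNorm (f₁ s - f₂ s) p volume)) ∧
        ((∀ᵐ s ∂(volume.restrict (Ioo 0 T)), f₁ s =ᵐ[volume] f₂ s) → g₁ =ᵐ[volume] g₂ →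
          ∀ t ∈ Icc 0 T, u₁ t =ᵐ[volume] u₂ t)) := by
  obtain ⟨C, hC⟩ := exists_eLpNorm_sub_le hε hT hp hp' hq hqn hqr K
  refine ⟨C, hC, ?_⟩
  intro f₁ f₂ g₁ g₂ u₁ u₂ Du₁ Du₂ k hg₁ hg₂ hf₁ hf₂ hu₁ hu₂ hk hkK hd₁ hd₂
  have hD₁ := hu₁.parabolic.memLp_grad
  have hD₂ := hu₂.parabolic.memLp_grad
  have hest : ∀ t ∈ Ioo 0 T, eLpNorm (u₁ t - u₂ t) p volume ≤
      C * (eLpNorm (g₁ - g₂) p volume + ∫⁻ s in Ioo 0 T, eLpNorm (f₁ s - f₂ s) p volume) := by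
    refine hC _ f₁ f₂ g₁ g₂ u₁ u₂ Du₁ Du₂ (isHamiltonian_norm_sq T) hg₁ hg₂ hf₁ hf₂ hu₁ hu₂ ?_ ?_
    · simp only [segmentField_norm_sq]
      exact memLp_segment hD₁ hD₂
    · have e : segmentField (fun _ _ ξ => ‖ξ‖ ^ 2 / 2) Du₁ Du₂ =
          fun θ t x => θ • Du₁ t x + (1 - θ) • Du₂ t x := by
        funext θ t x
        exact segmentField_norm_sq Du₁ Du₂ θ t x
      rw [e]
      exact divPosPartBound_segment hT (exponent_facts hqn hqr).2.1 hq hD₁ hD₂ hk hkK hd₁ hd₂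
  refine ⟨hest, fun hf hg => ?_⟩
  have hw := hu₁.isHeatSolution_sub hu₂ (hf₁.integrable hT le_rfl hp.le)
    (hf₂.integrable hT le_rfl hp.le)
  have hint : ∀ t ∈ Ioo 0 T, u₁ t - u₂ t =ᵐ[volume] 0 := by
    intro t ht
    have h1 : eLpNorm (g₁ - g₂) p volume = 0 := by
      rw [eLpNorm_congr_ae (sub_ae_eq_zero _ _ |>.2 hg), eLpNorm_zero]
    have h2 : ∫⁻ s in Ioo 0 T, eLpNorm (f₁ s - f₂ s) p volume = 0 := by
      rw [lintegral_congr_ae (g := fun _ => 0), lintegral_zero]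
      filter_upwards [hf] with s hs
      rw [eLpNorm_congr_ae (sub_ae_eq_zero _ _ |>.2 hs), eLpNorm_zero]
    have h3 := hest t ht
    rw [h1, h2, add_zero, mul_zero, nonpos_iff_eq_zero] at h3
    exact (eLpNorm_eq_zero_iff (hw.memLp_slice t (Ioo_subset_Icc_self ht)).1
      (zero_lt_one.trans hp).ne').1 h3
  intro t ht
  -- The estimate covers the open interval only: `t = 0` follows by continuity in `L²`, and `t = T`
  -- from the terminal condition.
  rcases ht.1.eq_or_lt with h0 | h0
  · subst h0
    exact sub_ae_eq_zero _ _ |>.1 (hw.ae_eq_zero_initial hT hint)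
  · rcases ht.2.eq_or_lt with hTt | hTt
    · subst hTt
      exact hu₁.terminal.trans (hg.trans hu₂.terminal.symm)
    · exact sub_ae_eq_zero _ _ |>.1 (hint t ⟨h0, hTt⟩)
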